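/- Let $R$ be a complete discrete valuation ring with field of fractions $K$, uniformizer $\pi$ and an absolute value $|\cdot|$ on $K$ with unit ball $R$. Let $A$ be an (associative, unital) $R$-algebra, flat as an $R$-module, with an increasing exhaustive filtration $F_0A\subseteq F_1A\subseteq\cdots$ by $R$-submodules such that $1\in F_0A$ and $F_iA\cdot F_jA\subseteq F_{i+j}A$ for all $i,j$. Assume: (1) $F_iA\cdot F_jA=F_jA\cdot F_iA$ as $R$-submodules of $A$, for all $i,j$; (2) $F_0A$ is a commutative noetherian integral domain and $F_0A/\pi F_0A$ is a regular integral domain; (3) the associated graded ring $\mathrm{gr}^F_\bullet A$ is commutative and isomorphic, as a graded ring, to a polynomial ring $F_0A[y_1,\dots,y_r]$ for some $r\ge 0$, graded by total degree. For $n\ge 0$ let $A_n\subseteq A$ be the image of the Rees ring $\bigoplus_{i\ge 0}(F_iA)X^i\subseteq A[X]$ under $X\mapsto\pi^n$, let $\hat A_n=\varprojlim_k A_n/\pi^kA_n$ be its $\pi$-adic completion, and let $\hat A_{n,K}=\hat A_n\otimes_RK$, a normed $K$-algebra with unit ball $\hat A_n$. The inclusions $A_{n+1}\subseteq A_n$ induce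 homomorphisms $\hat A_{n+1,K}\to\hat A_{n,K}$, and $\varprojlim_n\hat A_{n,K}$ carries the projective limit topology. Let $A_K=A\otimes_RK$ carry the finest locally convex (nonarchimedean) topology for which the inclusion of $(F_0A)_K=F_0A\otimes_RK$, normed with unit ball $F_0A$, is continuous. Its Arens–Michael envelope $\hat A_K$ is the Hausdorff completion of $A_K$ with respect to all continuous submultiplicative nonarchimedean seminorms. Then: (a) for every $n\ge 0$ the homomorphism $\hat A_{n+1,K}\to\hat A_{n,K}$ is flat, on the left and on the right; (b) $\varprojlim_n\hat A_{n,K}$ is a (two-sided) Fréchet–Stein algebra: it is a complete Hausdorff $K$-algebra whose topology is defined by an increasing sequence $q_0\le q_1\le\cdots$ of submultiplicative nonarchimedean seminorms such that the completion with respect to each $q_n$ is a left and right noetherian ring and the transition homomorphism from the completion with respect to $q_{n+1}$ to the completion with respect to $q_n$ is flat on both sides, for all $n$; (c) there is an isomorphism of topological $K$-algebras $\varprojlim_n\hat A_{n,K}\cong\hat A_K$ compatible with the canonical homomorphisms from $A_K$ to both sides. -/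

import Mathlib

open scoped TensorProduct Topology

universe u v w

namespace AMEnvelope

noncomputable section

/-! ### Flat homomorphisms of noncommutative rings -/

section Flat

variable {S : Type u} {T : Type v} [Ring S] [Ring T] (f : S →+* T)

/-- The relations `(t * f s) ⊗ n = t ⊗ (s • n)` that cut `T ⊗[S] N` out of `T ⊗[ℤ] N`. -/
def balancedRel (N : Type w) [AddCommGroup N] [Module S N] : AddSubgroup (T ⊗[ℤ] N) :=
  AddSubgroup.closure
    {z | ∃ (t : T) (s : S) (n : N), z = (t * f s) ⊗ₜ[ℤ] n - t ⊗ₜ[ℤ] (s • n)}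

/-- The tensor product `T ⊗[S] N` of `T`, as a right `S`-module via `f`, with a left
`S`-module `N`. -/
abbrev BaseChange (N : Type w) [AddCommGroup N] [Module S N] : Type (max v w) :=
  (T ⊗[ℤ] N) ⧸ balancedRel f N

/-- The map `T ⊗[S] N → T ⊗[S] N'` induced by an `S`-linear map `N → N'`. -/
def baseChangeMap {N N' : Type w} [AddCommGroup N] [Module S N] [AddCommGroup N'] [Module S N']
    (φ : N →ₗ[S] N') : BaseChange f N →+ BaseChange f N' :=
  QuotientAddGroup.map _ _
    (TensorProduct.map LinearMap.id φ.toAddMonoidHom.toIntLinearMap).toAddMonoidHom (by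
      refine (AddSubgroup.closure_le _).2 ?_
      rintro _ ⟨t, s, n, rfl⟩
      refine AddSubgroup.subset_closure ⟨t, s, φ n, ?_⟩
      simp)

/-- `T` is flat as a right `S`-module via `f`: the functor `T ⊗[S] -` on left `S`-modules
preserves injections. -/
def RightFlat : Prop :=
  ∀ (N N' : Type u) [AddCommGroup N] [Module S N] [AddCommGroup N'] [Module S N']
    (φ : N →ₗ[S] N'), Function.Injective φ → Function.Injective (baseChangeMap f φ)

/-- `f` is flat on both sides. Flatness of `T` as a left `S`-module is expressed through the
opposite rings. -/
def IsFlatHom : Prop := RightFlat f ∧ RightFlat (RingHom.op f)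

end Flat

/-! ### Nonarchimedean seminorms and completions -/

section Seminorms

/-- The uniform structure defined by a seminorm. -/
abbrev seminormUniformity {K : Type*} {V : Type*} [NormedField K] [AddCommGroup V] [Module K V]
    (q : Seminorm K V) : UniformSpace V :=
  q.toAddGroupSeminorm.toSeminormedAddCommGroup.toUniformSpace

/-- A submultiplicative nonarchimedean seminorm on a `K`-algebra. -/
structure AlgSeminorm (K : Type*) (V : Type*) [NormedField K] [Ring V] [Algebra K V] extends
    Seminorm K V where
  add_le_max' : ∀ x y, toFun (x + y) ≤ max (toFun x) (toFun y)
  mul_le' : ∀ x y, toFun (x * y) ≤ toFun x * toFun y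

variable {K : Type*} {V : Type*} [NormedField K] [Ring V] [Algebra K V]

/-- The algebra `V`, endowed with the uniform structure defined by a set of submultiplicative
seminorms. -/
def SeminormedAlg (_Q : Set (AlgSeminorm K V)) : Type _ := V

namespace SeminormedAlg

variable (Q : Set (AlgSeminorm K V))

instance : Ring (SeminormedAlg Q) := inferInstanceAs (Ring V)

instance : Algebra K (SeminormedAlg Q) := inferInstanceAs (Algebra K V)

instance : UniformSpace (SeminormedAlg Q) :=
  (⨅ q : Q, seminormUniformity q.1.toSeminorm : UniformSpace V)

instance : IsUniformAddGroup (SeminormedAlg Q) :=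
  isUniformAddGroup_iInf (G := V) fun q =>
    q.1.toSeminorm.toAddGroupSeminorm.toSeminormedAddCommGroup.to_isUniformAddGroup

instance : ContinuousMul (SeminormedAlg Q) := by
  have h : @ContinuousMul V (⨅ q : Q, (seminormUniformity q.1.toSeminorm).toTopologicalSpace) _ :=
    continuousMul_iInf fun q => by
      let _ : SeminormedRing V :=
        { q.1.toSeminorm.toAddGroupSeminorm.toSeminormedAddCommGroup, ‹Ring V› with
          norm_mul_le := q.1.mul_le' }
      exact (inferInstance : ContinuousMul V)
  rw [← UniformSpace.toTopologicalSpace_iInf] at h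
  exact h

instance : IsTopologicalRing (SeminormedAlg Q) where

instance : UniformContinuousConstSMul K (SeminormedAlg Q) :=
  haveI : ContinuousConstSMul K (SeminormedAlg Q) :=
    ⟨fun c => by simpa only [Algebra.smul_def] using continuous_const_mul _⟩
  uniformContinuousConstSMul_of_continuousConstSMul K _

end SeminormedAlg

/-- The Banach algebra `V_q`: the Hausdorff completion of `V` with respect to the submultiplicative
seminorm `q`. -/
abbrev SeminormCompletion (q : AlgSeminorm K V) : Type _ :=
  UniformSpace.Completion (SeminormedAlg ({q} : Set (AlgSeminorm K V)))

/-- The identity of `V`, from the `q'`-topology to the `q`-topology. -/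
def idHom (q q' : AlgSeminorm K V) :
    SeminormedAlg ({q'} : Set (AlgSeminorm K V)) →+* SeminormedAlg ({q} : Set (AlgSeminorm K V)) :=
  RingHom.id V

theorem continuous_idHom {q q' : AlgSeminorm K V} (h : q.toSeminorm ≤ q'.toSeminorm) :
    Continuous (idHom q q') := by
  have key : seminormUniformity q'.toSeminorm ≤ seminormUniformity q.toSeminorm := by
    let u' := q'.toSeminorm.toAddGroupSeminorm.toSeminormedAddCommGroup
    let u := q.toSeminorm.toAddGroupSeminorm.toSeminormedAddCommGroup
    have h1 := @LipschitzWith.of_dist_le_mul V V u'.toPseudoMetricSpace u.toPseudoMetricSpace 1 id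
        fun x y => by
          simp only [NNReal.coe_one, one_mul, id]
          rw [@dist_eq_norm V u, @dist_eq_norm V u']
          exact h (x - y)
    exact le_iff_uniformContinuous_id.2
      (@LipschitzWith.uniformContinuous V V u'.toPseudoMetricSpace.toPseudoEMetricSpace
        u.toPseudoMetricSpace.toPseudoEMetricSpace 1 id h1)
  have key2 : (⨅ r : ({q'} : Set (AlgSeminorm K V)), seminormUniformity r.1.toSeminorm) ≤
      ⨅ r : ({q} : Set (AlgSeminorm K V)), seminormUniformity r.1.toSeminorm :=
    le_iInf fun r => (iInf_le _ ⟨q', rfl⟩).trans (by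
      obtain ⟨r, rfl⟩ := r
      exact key)
  exact continuous_id_iff_le.2 (UniformSpace.toTopologicalSpace_mono key2)

/-- The transition homomorphism `V_{q'} → V_q` for `q ≤ q'`. -/
def completionTransition {q q' : AlgSeminorm K V} (h : q.toSeminorm ≤ q'.toSeminorm) :
    SeminormCompletion q' →+* SeminormCompletion q :=
  UniformSpace.Completion.mapRingHom (idHom q q') (continuous_idHom h)

/-- (Two-sided) Fréchet–Stein algebras: the `K`-algebra is a Fréchet space, i.e. complete, Hausdorff,
with topology defined by an increasing sequence of submultiplicative nonarchimedean seminorms `q n`,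
the Banach algebras attached to the `q n` are left and right noetherian, and the transition
homomorphisms between them are flat on both sides. -/
structure IsFrechetStein (K : Type*) (V : Type*) [NormedField K] [Ring V] [Algebra K V]
    [UniformSpace V] : Prop where
  isUniformAddGroup : IsUniformAddGroup V
  completeSpace : CompleteSpace V
  t2Space : T2Space V
  exists_seminorms : ∃ (q : ℕ → AlgSeminorm K V)
    (hq : ∀ n, (q n).toSeminorm ≤ (q (n + 1)).toSeminorm),
    ‹UniformSpace V›.toTopologicalSpace =
      ⨅ n, (seminormUniformity (q n).toSeminorm).toTopologicalSpace ∧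
    (∀ n, IsNoetherianRing (SeminormCompletion (q n)) ∧
      IsNoetherianRing (SeminormCompletion (q n))ᵐᵒᵖ) ∧
    ∀ n, IsFlatHom (completionTransition (hq n))

end Seminorms

/-! ### Normed algebras defined by a lattice -/

section Lattice

/-- The absolute value of `K` has `R` as its unit ball. -/
class IsUnitBall (R K : Type*) [CommRing R] [NormedField K] [Algebra R K] : Prop where
  norm_le_one_iff : ∀ x : K, ‖x‖ ≤ 1 ↔ ∃ r : R, algebraMap R K r = x

variable (R K : Type*) [CommRing R] [NormedField K] [Algebra R K]
variable (B : Type*) [Ring B] [Algebra R B]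

/-- The `K`-algebra `B_K = K ⊗[R] B`; it carries the topology for which the image of `B` is the
unit ball, see `latticeSeminorm`. -/
def LatticeAlg : Type _ := K ⊗[R] B

instance : Ring (LatticeAlg R K B) := inferInstanceAs (Ring (K ⊗[R] B))

instance : Algebra K (LatticeAlg R K B) := inferInstanceAs (Algebra K (K ⊗[R] B))

/-- The map `B → K ⊗[R] B`. -/
def latticeIncl : B →+* LatticeAlg R K B :=
  (Algebra.TensorProduct.includeRight : B →ₐ[R] K ⊗[R] B).toRingHom

variable {B} in
theorem latticeIncl_smul (r : R) (b : B) :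
    latticeIncl R K B (r • b) = algebraMap R K r • latticeIncl R K B b := by
  change (1 : K) ⊗ₜ[R] (r • b) = algebraMap R K r • ((1 : K) ⊗ₜ[R] b)
  rw [TensorProduct.smul_tmul', ← TensorProduct.smul_tmul, Algebra.smul_def, smul_eq_mul]

/-- The absolute values of the scalars `c` with `v ∈ c • B`. -/
def gaugeSet (v : LatticeAlg R K B) : Set ℝ :=
  {r | ∃ (c : K) (b : B), v = c • latticeIncl R K B b ∧ r = ‖c‖}

theorem gaugeSet_bddBelow (v : LatticeAlg R K B) : BddBelow (gaugeSet R K B v) :=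
  ⟨0, by rintro _ ⟨c, b, -, rfl⟩; exact norm_nonneg c⟩

theorem exists_common [IsUnitBall R K] (c d : K) (b b' : B) (h : ‖d‖ ≤ ‖c‖) :
    ∃ b'' : B, c • latticeIncl R K B b + d • latticeIncl R K B b' =
      c • latticeIncl R K B b'' := by
  by_cases hc : c = 0
  · have hd : d = 0 := by simpa [hc] using h
    exact ⟨0, by simp [hc, hd]⟩
  · obtain ⟨r, hr⟩ := (IsUnitBall.norm_le_one_iff (R := R) (d / c)).1 (by
      rw [norm_div]
      exact div_le_one_of_le₀ h (norm_nonneg _))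
    refine ⟨b + r • b', ?_⟩
    rw [map_add, latticeIncl_smul, hr, smul_add, smul_smul, mul_div_cancel₀ _ hc]

theorem exists_add_mem_gaugeSet [IsUnitBall R K] {v w : LatticeAlg R K B} {r s : ℝ}
    (hr : r ∈ gaugeSet R K B v) (hs : s ∈ gaugeSet R K B w) :
    max r s ∈ gaugeSet R K B (v + w) := by
  obtain ⟨c, b, rfl, rfl⟩ := hr
  obtain ⟨d, b', rfl, rfl⟩ := hs
  rcases le_total ‖d‖ ‖c‖ with h | h
  · obtain ⟨b'', hb⟩ := exists_common R K B c d b b' h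
    exact ⟨c, b'', hb, max_eq_left h⟩
  · obtain ⟨b'', hb⟩ := exists_common R K B d c b' b h
    exact ⟨d, b'', by rw [add_comm, hb], max_eq_right h⟩

theorem gaugeSet_nonempty [IsUnitBall R K] (v : LatticeAlg R K B) :
    (gaugeSet R K B v).Nonempty := by
  induction (show K ⊗[R] B from v) using TensorProduct.induction_on with
  | zero => exact ⟨_, 0, 0, by simp; rfl, rfl⟩
  | tmul c b =>
    refine ⟨_, c, b, ?_, rfl⟩
    change c ⊗ₜ[R] b = c • ((1 : K) ⊗ₜ[R] b)
    rw [TensorProduct.smul_tmul', smul_eq_mul, mul_one]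
  | add x y hx hy =>
    obtain ⟨r, hr⟩ := hx
    obtain ⟨s, hs⟩ := hy
    exact ⟨_, exists_add_mem_gaugeSet R K B hr hs⟩

/-- The seminorm `v ↦ inf {|c| : v ∈ c • B}` on `B_K`, whose unit ball is the image of `B`. -/
def latticeSeminorm [IsUnitBall R K] : Seminorm K (LatticeAlg R K B) :=
  Seminorm.of (fun v => sInf (gaugeSet R K B v))
    (fun v w => by
      refine le_of_forall_pos_lt_add fun ε hε => ?_
      obtain ⟨r, hr, hr'⟩ := Real.lt_sInf_add_pos (gaugeSet_nonempty R K B v) (half_pos hε)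
      obtain ⟨s, hs, hs'⟩ := Real.lt_sInf_add_pos (gaugeSet_nonempty R K B w) (half_pos hε)
      have h0 : 0 ≤ r := by obtain ⟨c, -, -, rfl⟩ := hr; exact norm_nonneg c
      have h1 : 0 ≤ s := by obtain ⟨c, -, -, rfl⟩ := hs; exact norm_nonneg c
      have h2 := csInf_le (gaugeSet_bddBelow R K B (v + w)) (exists_add_mem_gaugeSet R K B hr hs)
      have h3 : max r s ≤ r + s := max_le (by linarith) (by linarith)
      linarith)
    (fun a v => by
      have aux : ∀ (a : K) (v : LatticeAlg R K B),
          sInf (gaugeSet R K B (a • v)) ≤ ‖a‖ * sInf (gaugeSet R K B v) := by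
        intro a v
        refine le_of_forall_pos_lt_add fun ε hε => ?_
        have h4 : 0 < ε / (‖a‖ + 1) := by positivity
        obtain ⟨r, ⟨c, b, hv, rfl⟩, hr'⟩ :=
          Real.lt_sInf_add_pos (gaugeSet_nonempty R K B v) h4
        have h5 : sInf (gaugeSet R K B (a • v)) ≤ ‖a * c‖ :=
          csInf_le (gaugeSet_bddBelow R K B _) ⟨a * c, b, by rw [hv, smul_smul], rfl⟩
        rw [norm_mul] at h5
        have h6 : ‖a‖ * (ε / (‖a‖ + 1)) < ε := by
          rw [mul_div_assoc', div_lt_iff₀ (by positivity)]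
          nlinarith [norm_nonneg a]
        nlinarith [norm_nonneg a]
      refine le_antisymm (aux a v) ?_
      by_cases ha : a = 0
      · rw [ha, norm_zero, zero_mul]
        exact Real.sInf_nonneg (by rintro _ ⟨c, -, -, rfl⟩; exact norm_nonneg c)
      · have h7 := aux a⁻¹ (a • v)
        rw [smul_smul, inv_mul_cancel₀ ha, one_smul, norm_inv] at h7
        rwa [← le_inv_mul_iff₀ (norm_pos_iff.2 ha)])

instance [IsUnitBall R K] : UniformSpace (LatticeAlg R K B) :=
  seminormUniformity (latticeSeminorm R K B)

variable {B} in
/-- The homomorphism `B_K → C_K` induced by a homomorphism `B → C`. -/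
def latticeMap {C : Type*} [Ring C] [Algebra R C] (f : B →ₐ[R] C) :
    LatticeAlg R K B →ₐ[K] LatticeAlg R K C :=
  (Algebra.TensorProduct.map (AlgHom.id K K) f : K ⊗[R] B →ₐ[K] K ⊗[R] C)

variable {R K B} in
theorem latticeAlg_hom_ext {W : Type*} [Ring W] [Algebra K W] {φ ψ : LatticeAlg R K B →ₐ[K] W}
    (h : ∀ b, φ (latticeIncl R K B b) = ψ (latticeIncl R K B b)) (z : LatticeAlg R K B) :
    φ z = ψ z := by
  induction (show K ⊗[R] B from z) using TensorProduct.induction_on with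
  | zero => exact (map_zero φ).trans (map_zero ψ).symm
  | tmul c b =>
    have hc : (show LatticeAlg R K B from c ⊗ₜ[R] b) = c • latticeIncl R K B b := by
      change c ⊗ₜ[R] b = c • ((1 : K) ⊗ₜ[R] b)
      rw [TensorProduct.smul_tmul', smul_eq_mul, mul_one]
    exact (congrArg φ hc).trans ((map_smul φ c _).trans ((congrArg (c • ·) (h b)).trans
      ((map_smul ψ c _).symm.trans (congrArg ψ hc).symm)))
  | add x y hx hy =>
    exact (map_add φ _ _).trans ((congrArg₂ (· + ·) hx hy).trans (map_add ψ _ _).symm)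

variable {B} in
theorem latticeMap_latticeIncl {C : Type*} [Ring C] [Algebra R C] (f : B →ₐ[R] C) (b : B) :
    latticeMap R K f (latticeIncl R K B b) = latticeIncl R K C (f b) := rfl

end Lattice

/-! ### The `ϖ`-adic completion of a (noncommutative) algebra -/

section AdicCompletion

variable {R : Type*} [CommRing R] (ϖ : R) (B : Type*) [Ring B] [Algebra R B]

/-- The two-sided ideal `ϖ ^ k B`. -/
def powIdeal (k : ℕ) : Ideal B := Ideal.span {algebraMap R B (ϖ ^ k)}

instance (k : ℕ) : (powIdeal ϖ B k).IsTwoSided where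
  mul_mem_of_left b ha := by
    rw [powIdeal, Ideal.mem_span_singleton'] at ha ⊢
    obtain ⟨c, rfl⟩ := ha
    exact ⟨c * b, by rw [mul_assoc, mul_assoc, Algebra.commutes]⟩

theorem powIdeal_antitone {k l : ℕ} (h : k ≤ l) : powIdeal ϖ B l ≤ powIdeal ϖ B k := by
  rw [powIdeal, Ideal.span_singleton_le_iff_mem, powIdeal, Ideal.mem_span_singleton']
  exact ⟨algebraMap R B (ϖ ^ (l - k)), by rw [← map_mul, ← pow_add, Nat.sub_add_cancel h]⟩

/-- The projection `B / ϖ ^ l B → B / ϖ ^ k B` for `k ≤ l`. -/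
def powProj {k l : ℕ} (h : k ≤ l) : B ⧸ powIdeal ϖ B l →ₐ[R] B ⧸ powIdeal ϖ B k :=
  Ideal.quotientMapₐ (powIdeal ϖ B k) (AlgHom.id R B) (powIdeal_antitone ϖ B h)

/-- The `ϖ`-adic completion of `B`, the projective limit of the rings `B / ϖ ^ k B`. -/
def piCompletionSub : Subalgebra R (∀ k, B ⧸ powIdeal ϖ B k) where
  carrier := {x | ∀ k l (h : k ≤ l), powProj ϖ B h (x l) = x k}
  mul_mem' hx hy k l h := by
    rw [Pi.mul_apply, Pi.mul_apply, map_mul, hx k l h, hy k l h]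
  add_mem' hx hy k l h := by
    rw [Pi.add_apply, Pi.add_apply, map_add, hx k l h, hy k l h]
  algebraMap_mem' r k l h := by
    rw [Pi.algebraMap_apply, Pi.algebraMap_apply, AlgHom.commutes]

/-- The `ϖ`-adic completion of `B`, as a type. -/
def PiCompletion : Type _ := piCompletionSub ϖ B

instance : Ring (PiCompletion ϖ B) := inferInstanceAs (Ring (piCompletionSub ϖ B))

instance : Algebra R (PiCompletion ϖ B) := inferInstanceAs (Algebra R (piCompletionSub ϖ B))

/-- The canonical homomorphism from `B` to its completion. -/
def toPiCompletion : B →ₐ[R] PiCompletion ϖ B :=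
  AlgHom.codRestrict (AlgHom.pi fun k => Ideal.Quotient.mkₐ R (powIdeal ϖ B k))
    (piCompletionSub ϖ B) fun _ _ _ _ => rfl

variable {B} {C : Type*} [Ring C] [Algebra R C] (f : B →ₐ[R] C)

theorem powIdeal_le_comap (k : ℕ) : powIdeal ϖ B k ≤ (powIdeal ϖ C k).comap f := by
  rw [powIdeal, Ideal.span_singleton_le_iff_mem, Ideal.mem_comap, AlgHom.commutes]
  exact Ideal.subset_span rfl

/-- The map `B / ϖ ^ k B → C / ϖ ^ k C` induced by `f`. -/
def powMap (k : ℕ) : B ⧸ powIdeal ϖ B k →ₐ[R] C ⧸ powIdeal ϖ C k :=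
  Ideal.quotientMapₐ (powIdeal ϖ C k) f (powIdeal_le_comap ϖ f k)

theorem powProj_powMap {k l : ℕ} (h : k ≤ l) (x : B ⧸ powIdeal ϖ B l) :
    powProj ϖ C h (powMap ϖ f l x) = powMap ϖ f k (powProj ϖ B h x) := by
  obtain ⟨x, rfl⟩ := Ideal.Quotient.mk_surjective x
  rfl

/-- The map of `ϖ`-adic completions induced by `f`. -/
def piCompletionMap : PiCompletion ϖ B →ₐ[R] PiCompletion ϖ C :=
  AlgHom.codRestrict
    (AlgHom.pi fun k =>
      (powMap ϖ f k).comp ((Pi.evalAlgHom R _ k).comp (piCompletionSub ϖ B).val))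
    (piCompletionSub ϖ C) fun x k l h => by
      have := x.2 k l h
      exact (powProj_powMap ϖ f h _).trans (congrArg _ this)

theorem piCompletionMap_toPiCompletion (b : B) :
    piCompletionMap ϖ f (toPiCompletion ϖ B b) = toPiCompletion ϖ C (f b) := rfl

end AdicCompletion

/-! ### Filtered algebras and their associated graded rings -/

section Filtration

/-- An increasing exhaustive multiplicative filtration `F 0 ⊆ F 1 ⊆ ...` of an `R`-algebra by
`R`-submodules. -/
structure AlgFiltration (R A : Type*) [CommRing R] [Ring A] [Algebra R A] where
  F : ℕ → Submodule R A
  mono : Monotone F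
  exhaustive : ∀ a : A, ∃ i, a ∈ F i
  one_mem : (1 : A) ∈ F 0
  mul_mem : ∀ {i j : ℕ} {a b : A}, a ∈ F i → b ∈ F j → a * b ∈ F (i + j)

namespace AlgFiltration

variable {R A : Type*} [CommRing R] [Ring A] [Algebra R A] (𝓕 : AlgFiltration R A)

/-- The subalgebra `F 0`. -/
def zeroPart : Subalgebra R A where
  carrier := 𝓕.F 0
  mul_mem' ha hb := 𝓕.mul_mem ha hb
  add_mem' ha hb := (𝓕.F 0).add_mem ha hb
  algebraMap_mem' r := by
    rw [Algebra.algebraMap_eq_smul_one]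
    exact (𝓕.F 0).smul_mem r 𝓕.one_mem

/-- The ring `F 0` as a commutative ring, once multiplication in it is known to commute. -/
abbrev zeroPartCommRing (h : ∀ x y : 𝓕.zeroPart, x * y = y * x) : CommRing 𝓕.zeroPart :=
  { (inferInstance : Ring 𝓕.zeroPart) with mul_comm := h }

/-- The step `F (i - 1)` of the filtration, with `F (-1) = 0`. -/
def lower : ℕ → Submodule R A
  | 0 => ⊥
  | i + 1 => 𝓕.F i

theorem mul_mem_lower_left {i j : ℕ} {a b : A} (ha : a ∈ 𝓕.lower i) (hb : b ∈ 𝓕.F j) :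
    a * b ∈ 𝓕.lower (i + j) := by
  cases i with
  | zero =>
    rw [(Submodule.mem_bot R).1 ha, zero_mul]
    exact Submodule.zero_mem _
  | succ i =>
    rw [Nat.add_right_comm]
    exact 𝓕.mul_mem ha hb

theorem mul_mem_lower_right {i j : ℕ} {a b : A} (ha : a ∈ 𝓕.F i) (hb : b ∈ 𝓕.lower j) :
    a * b ∈ 𝓕.lower (i + j) := by
  cases j with
  | zero =>
    rw [(Submodule.mem_bot R).1 hb, mul_zero]
    exact Submodule.zero_mem _
  | succ j => exact 𝓕.mul_mem ha hb

/-- The piece `gr_i = F i / F (i - 1)`. -/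
def grPiece (i : ℕ) : Type _ := 𝓕.F i ⧸ (𝓕.lower i).submoduleOf (𝓕.F i)

instance (i : ℕ) : AddCommGroup (𝓕.grPiece i) :=
  inferInstanceAs (AddCommGroup (𝓕.F i ⧸ (𝓕.lower i).submoduleOf (𝓕.F i)))

/-- The class in `gr_i` of an element of `F i`. -/
def symb (i : ℕ) : 𝓕.F i →+ 𝓕.grPiece i :=
  (Submodule.mkQ ((𝓕.lower i).submoduleOf (𝓕.F i))).toAddMonoidHom

theorem symb_surjective (i : ℕ) : Function.Surjective (𝓕.symb i) :=
  Submodule.mkQ_surjective _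

theorem symb_eq_iff {i : ℕ} {x y : 𝓕.F i} :
    𝓕.symb i x = 𝓕.symb i y ↔ (x : A) - y ∈ 𝓕.lower i :=
  Submodule.Quotient.eq _

/-- The product `F i × F j → F (i + j)`. -/
def fmul {i j : ℕ} (x : 𝓕.F i) (y : 𝓕.F j) : 𝓕.F (i + j) := ⟨x * y, 𝓕.mul_mem x.2 y.2⟩

/-- The product `gr_i × gr_j → gr_{i + j}`. -/
def grMul {i j : ℕ} : 𝓕.grPiece i → 𝓕.grPiece j → 𝓕.grPiece (i + j) :=
  Quotient.map₂ 𝓕.fmul (fun x x' hx y y' hy => by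
    have hx' : (x : A) - x' ∈ 𝓕.lower i := 𝓕.symb_eq_iff.1 (Quotient.sound hx)
    have hy' : (y : A) - y' ∈ 𝓕.lower j := 𝓕.symb_eq_iff.1 (Quotient.sound hy)
    refine Quotient.exact (𝓕.symb_eq_iff.2 ?_)
    have : (x : A) * y - x' * y' = (x - x') * y + x' * (y - y') := by noncomm_ring
    change (x : A) * y - x' * y' ∈ _
    rw [this]
    exact Submodule.add_mem _ (𝓕.mul_mem_lower_left hx' y.2) (𝓕.mul_mem_lower_right x'.2 hy'))

theorem symb_sigma_ext {i j : ℕ} (h : i = j) {x : 𝓕.F i} {y : 𝓕.F j} (hxy : (x : A) = y) :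
    (GradedMonoid.mk i (𝓕.symb i x) : GradedMonoid 𝓕.grPiece) =
      GradedMonoid.mk j (𝓕.symb j y) := by
  subst h
  rw [Subtype.ext hxy]

instance : GradedMonoid.GMul 𝓕.grPiece := ⟨𝓕.grMul⟩

theorem grMul_symb {i j : ℕ} (x : 𝓕.F i) (y : 𝓕.F j) :
    GradedMonoid.GMul.mul (𝓕.symb i x) (𝓕.symb j y) = 𝓕.symb (i + j) (𝓕.fmul x y) := rfl

instance : GradedMonoid.GOne 𝓕.grPiece := ⟨𝓕.symb 0 ⟨1, 𝓕.one_mem⟩⟩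

instance : DirectSum.GRing 𝓕.grPiece where
  mul_zero {i j} x := by
    obtain ⟨x, rfl⟩ := 𝓕.symb_surjective i x
    rw [← map_zero (𝓕.symb j), grMul_symb, ← map_zero (𝓕.symb (i + j))]
    exact congrArg _ (Subtype.ext (mul_zero _))
  zero_mul {i j} x := by
    obtain ⟨x, rfl⟩ := 𝓕.symb_surjective j x
    rw [← map_zero (𝓕.symb i), grMul_symb, ← map_zero (𝓕.symb (i + j))]
    exact congrArg _ (Subtype.ext (zero_mul _))
  mul_add {i j} x y z := by
    obtain ⟨x, rfl⟩ := 𝓕.symb_surjective i x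
    obtain ⟨y, rfl⟩ := 𝓕.symb_surjective j y
    obtain ⟨z, rfl⟩ := 𝓕.symb_surjective j z
    rw [← map_add, grMul_symb, grMul_symb, grMul_symb, ← map_add]
    exact congrArg _ (Subtype.ext (mul_add _ _ _))
  add_mul {i j} x y z := by
    obtain ⟨x, rfl⟩ := 𝓕.symb_surjective i x
    obtain ⟨y, rfl⟩ := 𝓕.symb_surjective i y
    obtain ⟨z, rfl⟩ := 𝓕.symb_surjective j z
    rw [← map_add, grMul_symb, grMul_symb, grMul_symb, ← map_add]
    exact congrArg _ (Subtype.ext (add_mul _ _ _))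
  one_mul := by
    rintro ⟨i, x⟩
    obtain ⟨x, rfl⟩ := 𝓕.symb_surjective i x
    exact 𝓕.symb_sigma_ext (zero_add i) (one_mul _)
  mul_one := by
    rintro ⟨i, x⟩
    obtain ⟨x, rfl⟩ := 𝓕.symb_surjective i x
    exact 𝓕.symb_sigma_ext (add_zero i) (mul_one _)
  mul_assoc := by
    rintro ⟨i, x⟩ ⟨j, y⟩ ⟨k, z⟩
    obtain ⟨x, rfl⟩ := 𝓕.symb_surjective i x
    obtain ⟨y, rfl⟩ := 𝓕.symb_surjective j y
    obtain ⟨z, rfl⟩ := 𝓕.symb_surjective k z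
    exact 𝓕.symb_sigma_ext (add_assoc i j k) (mul_assoc _ _ _)
  natCast n := 𝓕.symb 0 ⟨n, natCast_mem 𝓕.zeroPart n⟩
  natCast_zero := by
    rw [← map_zero (𝓕.symb 0)]
    exact congrArg _ (Subtype.ext Nat.cast_zero)
  natCast_succ n := by
    refine Eq.trans ?_ (map_add (𝓕.symb 0) _ _)
    exact congrArg _ (Subtype.ext (Nat.cast_succ n))
  intCast n := 𝓕.symb 0 ⟨n, intCast_mem 𝓕.zeroPart n⟩
  intCast_ofNat n := congrArg _ (Subtype.ext (Int.cast_natCast n))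
  intCast_negSucc_ofNat n := by
    rw [← map_neg]
    exact congrArg _ (Subtype.ext (Int.cast_negSucc n))

/-- The associated graded ring. -/
abbrev gr : Type _ := DirectSum ℕ 𝓕.grPiece

/-- The standing conditions on the filtration. -/
structure IsAdmissible (ϖ : R) : Prop where
  mul_swap : ∀ i j, 𝓕.F i * 𝓕.F j = 𝓕.F j * 𝓕.F i
  zero_comm : ∀ x y : 𝓕.zeroPart, x * y = y * x
  zero_noetherian : IsNoetherianRing 𝓕.zeroPart
  zero_domain : IsDomain 𝓕.zeroPart
  red_domain : letI := 𝓕.zeroPartCommRing zero_comm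
    IsDomain (𝓕.zeroPart ⧸ Ideal.span {algebraMap R 𝓕.zeroPart ϖ})
  red_regular : letI := 𝓕.zeroPartCommRing zero_comm
    IsRegularRing (𝓕.zeroPart ⧸ Ideal.span {algebraMap R 𝓕.zeroPart ϖ})
  gr_comm : ∀ x y : 𝓕.gr, x * y = y * x
  gr_polynomial : letI := 𝓕.zeroPartCommRing zero_comm
    ∃ (r : ℕ) (e : 𝓕.gr ≃+* MvPolynomial (Fin r) 𝓕.zeroPart),
      ∀ (i : ℕ) (x : 𝓕.gr),
        (∃ y : 𝓕.grPiece i, x = DirectSum.of 𝓕.grPiece i y) ↔ (e x).IsHomogeneous i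

/-! ### The algebras `A_n`, their completions and the projective limit -/

/-- The Rees ring, as a subring of `A[X]`. -/
def rees : Subalgebra R (Polynomial A) where
  carrier := {p | ∀ i, p.coeff i ∈ 𝓕.F i}
  mul_mem' {p q} hp hq i := by
    rw [Polynomial.coeff_mul]
    refine Submodule.sum_mem _ fun x hx => ?_
    rw [← Finset.HasAntidiagonal.mem_antidiagonal.1 hx]
    exact 𝓕.mul_mem (hp _) (hq _)
  add_mem' {p q} hp hq i := by
    rw [Polynomial.coeff_add]
    exact Submodule.add_mem _ (hp i) (hq i)
  algebraMap_mem' r i := by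
    rw [Polynomial.algebraMap_apply, Polynomial.coeff_C]
    split_ifs with h
    · rw [h]
      exact 𝓕.zeroPart.algebraMap_mem r
    · exact Submodule.zero_mem _

variable (R A) in
/-- Evaluation `A[X] → A` at a scalar. -/
def evalScalar (c : R) : Polynomial A →ₐ[R] A :=
  Polynomial.eval₂AlgHom (AlgHom.id R A) (algebraMap R A c) fun a => (Algebra.commutes c a).symm

/-- The subalgebra `A_n` of `A`: the image of the Rees ring under `X ↦ ϖ ^ n`. -/
def deform (ϖ : R) (n : ℕ) : Subalgebra R A := 𝓕.rees.map (evalScalar R A (ϖ ^ n))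

theorem pow_smul_mem_deform (ϖ : R) (n : ℕ) {i : ℕ} {a : A} (ha : a ∈ 𝓕.F i) :
    ϖ ^ (n * i) • a ∈ 𝓕.deform ϖ n := by
  refine ⟨Polynomial.monomial i a, fun j => ?_, ?_⟩
  · rw [Polynomial.coeff_monomial]
    split_ifs with h
    · rwa [← h]
    · exact Submodule.zero_mem _
  · change Polynomial.eval₂ _ _ (Polynomial.monomial i a) = _
    rw [Polynomial.eval₂_monomial, ← map_pow, ← pow_mul, Algebra.smul_def, Algebra.commutes]
    rfl

theorem deform_succ_le (ϖ : R) (n : ℕ) : 𝓕.deform ϖ (n + 1) ≤ 𝓕.deform ϖ n := by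
  rintro _ ⟨p, hp, rfl⟩
  change Polynomial.eval₂ _ _ p ∈ _
  rw [Polynomial.eval₂_eq_sum, Polynomial.sum]
  refine Subalgebra.sum_mem _ fun i _ => ?_
  have h := (𝓕.deform ϖ n).smul_mem (𝓕.pow_smul_mem_deform ϖ n (hp i)) (ϖ ^ i)
  rw [smul_smul, ← pow_add, Algebra.smul_def, Algebra.commutes] at h
  rw [← map_pow, ← pow_mul, Nat.succ_mul, Nat.add_comm]
  exact h

variable (K : Type*) [NormedField K] [Algebra R K] (ϖ : R)

/-- The algebra `Â_{n,K}`: the `ϖ`-adic completion of `A_n`, tensored with `K`. -/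
abbrev hatK (n : ℕ) : Type _ := LatticeAlg R K (PiCompletion ϖ (𝓕.deform ϖ n))

/-- The transition homomorphism `Â_{n+1,K} → Â_{n,K}`. -/
def hatTransition (n : ℕ) : 𝓕.hatK K ϖ (n + 1) →ₐ[K] 𝓕.hatK K ϖ n :=
  latticeMap R K (piCompletionMap ϖ (Subalgebra.inclusion (𝓕.deform_succ_le ϖ n)))

/-- The projective limit of the algebras `Â_{n,K}`, a subalgebra of their product with the
subspace topology. -/
def hatLimit : Subalgebra K (∀ n, 𝓕.hatK K ϖ n) where
  carrier := {x | ∀ n, 𝓕.hatTransition K ϖ n (x (n + 1)) = x n}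
  mul_mem' hx hy n := by rw [Pi.mul_apply, Pi.mul_apply, map_mul, hx n, hy n]
  add_mem' hx hy n := by rw [Pi.add_apply, Pi.add_apply, map_add, hx n, hy n]
  algebraMap_mem' r n := by rw [Pi.algebraMap_apply, Pi.algebraMap_apply, AlgHom.commutes]

/-- The homomorphism `A_n ⊗ K → A ⊗ K`. -/
def deformToAK (n : ℕ) : LatticeAlg R K (𝓕.deform ϖ n) →ₐ[K] K ⊗[R] A :=
  latticeMap R K (𝓕.deform ϖ n).val

theorem deformToAK_bijective [IsDomain R] [IsFractionRing R K] {ϖ : R} (hϖ : Irreducible ϖ)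
    (n : ℕ) : Function.Bijective (𝓕.deformToAK K ϖ n) := by
  have : Module.Flat R K := IsLocalization.flat K (nonZeroDivisors R)
  refine ⟨?_, fun v => ?_⟩
  · exact Module.Flat.lTensor_preserves_injective_linearMap (M := K)
      (𝓕.deform ϖ n).val.toLinearMap Subtype.val_injective
  · induction v using TensorProduct.induction_on with
    | zero => exact ⟨0, map_zero _⟩
    | tmul c a =>
      obtain ⟨i, hi⟩ := 𝓕.exhaustive a
      have h0 : algebraMap R K (ϖ ^ (n * i)) ≠ 0 := by
        rw [Ne, IsFractionRing.to_map_eq_zero_iff]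
        exact pow_ne_zero _ hϖ.ne_zero
      refine ⟨(c * (algebraMap R K (ϖ ^ (n * i)))⁻¹) ⊗ₜ[R]
        ⟨_, 𝓕.pow_smul_mem_deform ϖ n hi⟩, ?_⟩
      change (c * (algebraMap R K (ϖ ^ (n * i)))⁻¹) ⊗ₜ[R] (ϖ ^ (n * i) • a) = c ⊗ₜ[R] a
      rw [← TensorProduct.smul_tmul, Algebra.smul_def, mul_comm c, mul_inv_cancel_left₀ h0]
    | add x y hx hy =>
      obtain ⟨x, rfl⟩ := hx
      obtain ⟨y, rfl⟩ := hy
      exact ⟨x + y, map_add _ _ _⟩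

/-- The canonical homomorphism `A_K = A_n ⊗ K → Â_{n,K}`. -/
def toHatK [IsDomain R] [IsFractionRing R K] {ϖ : R} (hϖ : Irreducible ϖ) (n : ℕ) :
    K ⊗[R] A →ₐ[K] 𝓕.hatK K ϖ n :=
  (latticeMap R K (toPiCompletion ϖ (𝓕.deform ϖ n))).comp
    (AlgEquiv.ofBijective _ (𝓕.deformToAK_bijective K hϖ n)).symm.toAlgHom

theorem toHatK_deformToAK [IsDomain R] [IsFractionRing R K] {ϖ : R} (hϖ : Irreducible ϖ) (n : ℕ)
    (z : LatticeAlg R K (𝓕.deform ϖ n)) :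
    𝓕.toHatK K hϖ n (𝓕.deformToAK K ϖ n z) =
      latticeMap R K (toPiCompletion ϖ (𝓕.deform ϖ n)) z :=
  congrArg _ ((AlgEquiv.ofBijective _ (𝓕.deformToAK_bijective K hϖ n)).symm_apply_apply z)

theorem hatTransition_toHatK [IsDomain R] [IsFractionRing R K] {ϖ : R} (hϖ : Irreducible ϖ)
    (n : ℕ) (v : K ⊗[R] A) :
    𝓕.hatTransition K ϖ n (𝓕.toHatK K hϖ (n + 1) v) = 𝓕.toHatK K hϖ n v := by
  obtain ⟨z, rfl⟩ := (𝓕.deformToAK_bijective K hϖ (n + 1)).2 v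
  have h : 𝓕.deformToAK K ϖ (n + 1) z = 𝓕.deformToAK K ϖ n
      (latticeMap R K (Subalgebra.inclusion (𝓕.deform_succ_le ϖ n)) z) :=
    latticeAlg_hom_ext (φ := 𝓕.deformToAK K ϖ (n + 1)) (ψ := (𝓕.deformToAK K ϖ n).comp
      (latticeMap R K (Subalgebra.inclusion (𝓕.deform_succ_le ϖ n)))) (fun _ => rfl) z
  have h2 : 𝓕.hatTransition K ϖ n (latticeMap R K (toPiCompletion ϖ (𝓕.deform ϖ (n + 1))) z) =
      latticeMap R K (toPiCompletion ϖ (𝓕.deform ϖ n))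
        (latticeMap R K (Subalgebra.inclusion (𝓕.deform_succ_le ϖ n)) z) :=
    latticeAlg_hom_ext (φ := (𝓕.hatTransition K ϖ n).comp
        (latticeMap R K (toPiCompletion ϖ (𝓕.deform ϖ (n + 1)))))
      (ψ := (latticeMap R K (toPiCompletion ϖ (𝓕.deform ϖ n))).comp
        (latticeMap R K (Subalgebra.inclusion (𝓕.deform_succ_le ϖ n)))) (fun b => by
        rw [AlgHom.comp_apply, AlgHom.comp_apply, latticeMap_latticeIncl, latticeMap_latticeIncl,
          latticeMap_latticeIncl, hatTransition, latticeMap_latticeIncl,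
          piCompletionMap_toPiCompletion]) z
  rw [toHatK_deformToAK, h2, h, toHatK_deformToAK]

/-- The canonical homomorphism from `A_K` to the projective limit of the algebras `Â_{n,K}`. -/
def toHatLimit [IsDomain R] [IsFractionRing R K] {ϖ : R} (hϖ : Irreducible ϖ) :
    K ⊗[R] A →ₐ[K] 𝓕.hatLimit K ϖ :=
  AlgHom.codRestrict (AlgHom.pi fun n => 𝓕.toHatK K hϖ n) (𝓕.hatLimit K ϖ)
    fun v n => 𝓕.hatTransition_toHatK K hϖ n v

/-! ### The Arens–Michael envelope -/

/-- A topology on a `K`-vector space is locally convex (in the nonarchimedean sense) if it is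
defined by a family of nonarchimedean seminorms. -/
def IsLocallyConvex {V : Type*} [AddCommGroup V] [Module K V] (τ : TopologicalSpace V) : Prop :=
  ∃ Q : Set (Seminorm K V), (∀ q ∈ Q, ∀ x y, q (x + y) ≤ max (q x) (q y)) ∧
    τ = ⨅ q ∈ Q, (seminormUniformity q).toTopologicalSpace

/-- The inclusion of `(F 0)_K`, a normed algebra with unit ball `F 0`, into `A_K`. -/
def zeroPartToAK : LatticeAlg R K 𝓕.zeroPart →ₐ[K] K ⊗[R] A :=
  latticeMap R K 𝓕.zeroPart.val

/-- The finest locally convex topology on `A_K` for which the inclusion of `(F 0)_K` is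
continuous. -/
abbrev topologyAK [IsUnitBall R K] : TopologicalSpace (K ⊗[R] A) :=
  sInf {τ | IsLocallyConvex K τ ∧ Continuous[inferInstance, τ] (𝓕.zeroPartToAK K)}

/-- The set of continuous submultiplicative nonarchimedean seminorms on `A_K`. -/
def contSeminorms [IsUnitBall R K] : Set (AlgSeminorm K (K ⊗[R] A)) :=
  {q | Continuous[𝓕.topologyAK K, inferInstance] q.toSeminorm}

/-- The Arens–Michael envelope of `A_K`: its Hausdorff completion with respect to all continuous
submultiplicative seminorms. -/
abbrev ArensMichael [IsUnitBall R K] : Type _ :=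
  UniformSpace.Completion (SeminormedAlg (𝓕.contSeminorms K))

/-- The canonical homomorphism from `A_K` to its Arens–Michael envelope. -/
def toArensMichael [IsUnitBall R K] : K ⊗[R] A →+* 𝓕.ArensMichael K :=
  (UniformSpace.Completion.coeRingHom : SeminormedAlg (𝓕.contSeminorms K) →+* _)

end AlgFiltration

end Filtration

end

end AMEnvelope

open AMEnvelope

/-!
Flatness is tested on linear equations: `f : S → T` is flat as soon as every solution in `T` of a
linear system over `S` is a combination of solutions over `S`. In this form it passes through the
completion of a noetherian ring along a central element and through the inversion of a central
element.

Since `gr A` is commutative and generated in degree one by `y_1, ..., y_r`, the algebra `A_n` is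
generated over `F 0` by the elements `ϖ ^ n • y_j`, which commute with `F 0` and with each other up
to lower terms, and Hilbert's basis argument makes it noetherian; so are `Â_n` and `Â_{n,K}`. The
same argument applies over `Â_{n+1}` to the subring `B` of `Â_{n+1,K}` of the elements that map to
`Â_n`. It has `Â_n` as its `ϖ`-adic completion, so `Â_{n+1,K} → Â_{n,K}` is a completion of `B`
followed by the inversion of `ϖ`, hence flat.

A continuous submultiplicative seminorm on `A_K` is bounded on `F 0` and on the finitely many
`y_j`. Once `|ϖ| ^ n` compensates its values on the `y_j`, it is bounded on `A_n`. Hence the gauges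
of the lattices `A_n` are cofinal among these seminorms, and the projective limit of the
completions `Â_{n,K}` is the Arens–Michael envelope.
-/

namespace AMEnvelope

noncomputable section

/-! ### The equational criterion for flatness -/

section EquationalCriterion

variable {S : Type*} {T : Type*} [Ring S] [Ring T]

/-- The equational criterion for flatness of `T` as a right `S`-module via `f`: every linear
relation over `T` between elements of `S` is a combination of relations over `S`. -/
def IsEquationallyFlat (f : S →+* T) : Prop :=
  ∀ (m : ℕ) (t : Fin m → T) (a : Fin m → S), ∑ i, t i * f (a i) = 0 →
    ∃ (k : ℕ) (t' : Fin k → T) (s : Fin k → Fin m → S),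
      (∀ i, t i = ∑ l, t' l * f (s l i)) ∧ ∀ l, ∑ i, s l i * a i = 0

theorem IsEquationallyFlat.of_ringEquiv {S' T' : Type*} [Ring S'] [Ring T'] {f : S →+* T}
    {f' : S' →+* T'} (hf : IsEquationallyFlat f) (eS : S ≃+* S') (eT : T ≃+* T')
    (h : ∀ x, eT (f x) = f' (eS x)) : IsEquationallyFlat f' := by
  intro m t a hta
  obtain ⟨k, t', s, ht, hs⟩ := hf m (fun i => eT.symm (t i)) (fun i => eS.symm (a i)) <| by
    apply eT.injective
    simpa only [map_sum, map_mul, h, RingEquiv.apply_symm_apply, map_zero] using hta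
  refine ⟨k, fun l => eT (t' l), fun l i => eS (s l i), fun i => ?_, fun l => ?_⟩
  · rw [← eT.apply_symm_apply (t i), ht i, map_sum]
    simp only [map_mul, h]
  · apply eS.symm.injective
    simpa only [map_sum, map_mul, RingEquiv.symm_apply_apply, map_zero] using hs l

variable (f : S →+* T)

namespace BaseChange

variable {N : Type*} [AddCommGroup N] [Module S N] {M : Type*} [AddCommGroup M]

/-- The class of the pure tensor `t ⊗ n` in `T ⊗[S] N`. -/
def tmul (t : T) (n : N) : BaseChange f N := QuotientAddGroup.mk (t ⊗ₜ[ℤ] n)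

theorem tmul_sum {ι : Type*} (t : T) (s : Finset ι) (n : ι → N) :
    tmul f t (∑ i ∈ s, n i) = ∑ i ∈ s, tmul f t (n i) := by
  rw [tmul, TensorProduct.tmul_sum]
  exact map_sum (QuotientAddGroup.mk' (balancedRel f N)) _ _

theorem sum_tmul {ι : Type*} (s : Finset ι) (t : ι → T) (n : N) :
    tmul f (∑ i ∈ s, t i) n = ∑ i ∈ s, tmul f (t i) n := by
  rw [tmul, TensorProduct.sum_tmul]
  exact map_sum (QuotientAddGroup.mk' (balancedRel f N)) _ _

theorem tmul_add (t : T) (n n' : N) : tmul f t (n + n') = tmul f t n + tmul f t n' :=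
  congrArg _ (TensorProduct.tmul_add t n n')

theorem add_tmul (t t' : T) (n : N) : tmul f (t + t') n = tmul f t n + tmul f t' n :=
  congrArg _ (TensorProduct.add_tmul t t' n)

theorem tmul_zero (t : T) : tmul f t (0 : N) = 0 :=
  congrArg _ (TensorProduct.tmul_zero N t)

theorem mul_tmul (t : T) (s : S) (n : N) : tmul f (t * f s) n = tmul f t (s • n) :=
  QuotientAddGroup.eq_iff_sub_mem.2 (AddSubgroup.subset_closure ⟨t, s, n, rfl⟩)

theorem exists_sum_tmul_eq (x : BaseChange f N) :
    ∃ (m : ℕ) (t : Fin m → T) (n : Fin m → N), x = ∑ i, tmul f (t i) (n i) := by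
  obtain ⟨x, rfl⟩ := QuotientAddGroup.mk_surjective x
  obtain ⟨m, t, n, rfl⟩ := TensorProduct.exists_sum_tmul_eq x
  exact ⟨m, t, n, map_sum (QuotientAddGroup.mk' (balancedRel f N)) _ _⟩

variable {f}

/-- The additive map out of `T ⊗[S] N` defined by a balanced biadditive map. -/
def lift (g : T →+ N →+ M) (hg : ∀ t s n, g (t * f s) n = g t (s • n)) : BaseChange f N →+ M :=
  QuotientAddGroup.lift (balancedRel f N)
    (TensorProduct.liftAddHom g fun r t n => by
      rw [map_zsmul, map_zsmul, AddMonoidHom.zsmul_apply]) <| by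
    refine (AddSubgroup.closure_le _).2 ?_
    rintro _ ⟨t, s, n, rfl⟩
    rw [SetLike.mem_coe, AddMonoidHom.mem_ker, map_sub, TensorProduct.liftAddHom_tmul,
      TensorProduct.liftAddHom_tmul, hg, sub_self]

theorem map_tmul {N N' : Type w} [AddCommGroup N] [Module S N] [AddCommGroup N'] [Module S N']
    (φ : N →ₗ[S] N') (t : T) (n : N) : baseChangeMap f φ (tmul f t n) = tmul f t (φ n) := rfl

variable (f) in
/-- The multiplication map `T ⊗[S] I → T` of a left ideal `I` of `S`. -/
def mulMap (I : Ideal S) : BaseChange f I →+ T :=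
  lift ((AddMonoidHom.compHom.flip (f.toAddMonoidHom.comp I.toAddSubgroup.subtype)).comp
    AddMonoidHom.mul) fun t s n => by
      change t * f s * f n = t * f (s * n)
      rw [map_mul, mul_assoc]

theorem mulMap_tmul (I : Ideal S) (t : T) (a : I) : mulMap f I (tmul f t a) = t * f a := rfl

end BaseChange

variable {f} in
theorem IsEquationallyFlat.mulMap_injective (hf : IsEquationallyFlat f) (I : Ideal S) :
    Function.Injective (BaseChange.mulMap f I) := by
  rw [injective_iff_map_eq_zero]
  intro x hx
  obtain ⟨m, t, a, rfl⟩ := BaseChange.exists_sum_tmul_eq f x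
  obtain ⟨k, t', s, ht, hs⟩ := hf m t (fun i => a i) <| by
    simpa only [map_sum, BaseChange.mulMap_tmul] using hx
  have hs' (l : Fin k) : ∑ i, s l i • a i = 0 := Subtype.ext <| by
    simpa only [Submodule.coe_sum, Submodule.coe_smul, smul_eq_mul, Submodule.coe_zero] using hs l
  calc ∑ i, BaseChange.tmul f (t i) (a i)
      = ∑ l, BaseChange.tmul f (t' l) (∑ i, s l i • a i) := by
        simp only [ht, BaseChange.sum_tmul, BaseChange.mul_tmul, BaseChange.tmul_sum]
        exact Finset.sum_comm
    _ = 0 := Finset.sum_eq_zero fun l _ => by rw [hs' l, BaseChange.tmul_zero]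

/-- The left `S`-module of characters of `T`, regarded as a right `S`-module via `f`. -/
def RightDual (_f : S →+* T) : Type _ := CharacterModule T

namespace RightDual

instance : AddCommGroup (RightDual f) := inferInstanceAs (AddCommGroup (CharacterModule T))

instance : FunLike (RightDual f) T (AddCircle (1 : ℚ)) :=
  inferInstanceAs (FunLike (CharacterModule T) T _)

instance : AddMonoidHomClass (RightDual f) T (AddCircle (1 : ℚ)) :=
  inferInstanceAs (AddMonoidHomClass (T →+ AddCircle (1 : ℚ)) T _)

variable {f} in
@[ext]
theorem ext {χ ψ : RightDual f} (h : ∀ t, χ t = ψ t) : χ = ψ := DFunLike.ext _ _ h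

theorem add_apply (χ ψ : RightDual f) (t : T) : (χ + ψ) t = χ t + ψ t := rfl

instance : SMul S (RightDual f) where
  smul s χ := AddMonoidHom.comp (χ : T →+ AddCircle (1 : ℚ)) (AddMonoidHom.mulRight (f s))

theorem smul_apply (s : S) (χ : RightDual f) (t : T) : (s • χ) t = χ (t * f s) := rfl

instance : Module S (RightDual f) where
  one_smul χ := ext fun t => by rw [smul_apply, map_one, mul_one]
  mul_smul s s' χ := ext fun t => by
    rw [smul_apply, smul_apply, smul_apply, f.map_mul, mul_assoc]
  smul_zero _ := rfl
  smul_add _ _ _ := rfl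
  add_smul s s' χ := ext fun t => by
    rw [add_apply, smul_apply, smul_apply, smul_apply, map_add, mul_add, map_add]
  zero_smul χ := ext fun t => by
    rw [smul_apply, map_zero, mul_zero, map_zero]
    rfl

variable {f} {N : Type*} [AddCommGroup N] [Module S N]

/-- The character of `T ⊗[S] N` defined by a linear map from `N` to the characters of `T`. -/
def uncurry (g : N →ₗ[S] RightDual f) : CharacterModule (BaseChange f N) :=
  BaseChange.lift
    (AddMonoidHom.flip <| AddMonoidHom.mk' (fun n => AddMonoidHom.mk' (g n) (map_add (g n)))
      fun n n' => by
        rw [map_add]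
        rfl)
    fun t s n => by
      change g n (t * f s) = g (s • n) t
      rw [map_smul, smul_apply]

/-- The linear map from `N` to the characters of `T` defined by a character of `T ⊗[S] N`. -/
def curry (χ : CharacterModule (BaseChange f N)) : N →ₗ[S] RightDual f where
  toFun n := AddMonoidHom.mk' (fun t => χ (BaseChange.tmul f t n)) fun t t' => by
    rw [BaseChange.add_tmul, map_add]
  map_add' n n' := ext fun t => by
    change χ (BaseChange.tmul f t (n + n')) = _
    rw [BaseChange.tmul_add, map_add]
    rfl
  map_smul' s n := ext fun t => by
    change χ (BaseChange.tmul f t (s • n)) = χ (BaseChange.tmul f (t * f s) n)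
    rw [BaseChange.mul_tmul]

end RightDual

variable {f}

theorem IsEquationallyFlat.baer_rightDual (hf : IsEquationallyFlat f) :
    Module.Baer S (RightDual f) := by
  intro I g
  obtain ⟨χ, hχ⟩ := (Module.Baer.of_divisible (AddCircle (1 : ℚ))).extension_property_addMonoidHom
    (BaseChange.mulMap f I) (hf.mulMap_injective I) (RightDual.uncurry g)
  refine ⟨LinearMap.toSpanSingleton S (RightDual f) χ, fun x hx => RightDual.ext fun t => ?_⟩
  exact DFunLike.congr_fun hχ (BaseChange.tmul f t ⟨x, hx⟩)

end EquationalCriterion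

theorem IsEquationallyFlat.rightFlat {S : Type u} {T : Type v} [Ring S] [Ring T] {f : S →+* T}
    (hf : IsEquationallyFlat f) : RightFlat f := by
  intro N N' _ _ _ _ φ hφ
  rw [injective_iff_map_eq_zero]
  intro x hx
  refine CharacterModule.eq_zero_of_character_apply fun χ => ?_
  obtain ⟨g, hg⟩ := hf.baer_rightDual.extension_property φ hφ (RightDual.curry χ)
  have key (t : T) (n : N) :
      χ (BaseChange.tmul f t n) = RightDual.uncurry g (BaseChange.tmul f t (φ n)) :=
    (DFunLike.congr_fun (LinearMap.congr_fun hg n) t).symm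
  obtain ⟨m, t, n, rfl⟩ := BaseChange.exists_sum_tmul_eq f x
  calc χ (∑ i, BaseChange.tmul f (t i) (n i))
      = RightDual.uncurry g (baseChangeMap f φ (∑ i, BaseChange.tmul f (t i) (n i))) := by
        simp only [map_sum, BaseChange.map_tmul, key]
    _ = 0 := by rw [hx, map_zero]

/-! ### Rings complete along a central element -/

section CentralComplete

/-- The ring `U` is complete and separated for the adic topology of the central element `p`;
completeness is the convergence of all power series in `p`. -/
structure IsCentralComplete {U : Type*} [Ring U] (p : U) : Prop where
  commute : ∀ x, Commute p x
  separated : ∀ x, (∀ k : ℕ, p ^ k ∣ x) → x = 0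
  complete : ∀ c : ℕ → U, ∃ u, ∀ k, p ^ k ∣ u - ∑ i ∈ Finset.range k, p ^ i * c i

theorem op_dvd_op_of_commute {U : Type*} [Ring U] {p : U} (hp : ∀ x, Commute p x) {x : U} :
    MulOpposite.op p ∣ MulOpposite.op x ↔ p ∣ x := by
  constructor
  · rintro ⟨y, hy⟩
    exact ⟨y.unop, by rw [(hp _).eq]; exact congrArg MulOpposite.unop hy⟩
  · rintro ⟨y, rfl⟩
    exact ⟨MulOpposite.op y, by rw [(hp y).eq, MulOpposite.op_mul]⟩

theorem commute_op {U : Type*} [Ring U] {p : U} (hp : ∀ x, Commute p x) (x : Uᵐᵒᵖ) :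
    Commute (MulOpposite.op p) x :=
  (hp x.unop).op

theorem IsCentralComplete.op {U : Type*} [Ring U] {p : U} (h : IsCentralComplete p) :
    IsCentralComplete (MulOpposite.op p) where
  commute := commute_op h.commute
  separated x hx := MulOpposite.unop_injective <| h.separated x.unop fun k =>
    (op_dvd_op_of_commute fun y => (h.commute y).pow_left k).1 (hx k)
  complete c := by
    obtain ⟨u, hu⟩ := h.complete fun i => (c i).unop
    refine ⟨MulOpposite.op u, fun k => ?_⟩
    rw [← MulOpposite.op_pow]
    convert (op_dvd_op_of_commute fun y => (h.commute y).pow_left k).2 (hu k) using 1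
    rw [MulOpposite.op_sub, Finset.op_sum]
    congr 1
    refine Finset.sum_congr rfl fun i _ => ?_
    rw [((h.commute (c i).unop).pow_left i).eq, MulOpposite.op_mul, MulOpposite.op_pow,
      MulOpposite.op_unop]

/-- Iterating the congruence expresses an element of `M` through the `z l`, with power series in `p`
as coefficients. -/
theorem IsCentralComplete.subset_span_of_subset_add {U E : Type*} [Ring U] {p : U}
    (hp : IsCentralComplete p) [AddCommGroup E] [Module U E]
    (hE : ∀ x : E, (∀ k : ℕ, ∃ y : E, x = p ^ k • y) → x = 0) {ι : Type*} [Finite ι] {z : ι → E}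
    {M : Set E} (h : ∀ x ∈ M, ∃ y ∈ Submodule.span U (Set.range z), ∃ x' ∈ M, x = y + p • x') :
    M ⊆ Submodule.span U (Set.range z) := by
  have := Fintype.ofFinite ι
  intro x hx
  have h' (x : M) : ∃ (a : ι → U) (x' : M), (x : E) = ∑ l, a l • z l + p • (x' : E) := by
    obtain ⟨y, hy, x', hx', hxy⟩ := h x x.2
    obtain ⟨a, rfl⟩ := (Submodule.mem_span_range_iff_exists_fun U).1 hy
    exact ⟨a, ⟨x', hx'⟩, hxy⟩
  choose a next hnext using h'
  let s (n : ℕ) : M := next^[n] ⟨x, hx⟩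
  have hs (n : ℕ) : (s n : E) = ∑ l, a (s n) l • z l + p • (s (n + 1) : E) := by
    rw [show s (n + 1) = next (s n) from Function.iterate_succ_apply' next n _]
    exact hnext (s n)
  have hsum (n : ℕ) :
      x = ∑ i ∈ Finset.range n, p ^ i • ∑ l, a (s i) l • z l + p ^ n • (s n : E) := by
    induction n with
    | zero => simp [s]
    | succ n ih =>
      rw [Finset.sum_range_succ, add_assoc, pow_succ, mul_smul, ← smul_add, ← hs n]
      exact ih
  choose u y hy using fun l => hp.complete fun n => a (s n) l
  have hu (k : ℕ) : ∑ l, u l • z l =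
      ∑ i ∈ Finset.range k, p ^ i • ∑ l, a (s i) l • z l + p ^ k • ∑ l, y l k • z l := by
    simp only [Finset.smul_sum]
    rw [Finset.sum_comm, ← Finset.sum_add_distrib]
    refine Finset.sum_congr rfl fun l _ => ?_
    rw [eq_add_of_sub_eq' (hy l k), add_smul, Finset.sum_smul]
    simp only [mul_smul]
  refine (Submodule.mem_span_range_iff_exists_fun U).2 ⟨u, (sub_eq_zero.1 (hE _ fun k => ?_)).symm⟩
  refine ⟨s k - ∑ l, y l k • z l, ?_⟩
  nth_rewrite 1 [hsum k]
  rw [hu k, smul_sub, add_sub_add_left_eq_sub]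

/-- The increasing sequence of left ideals `{x | x * p ^ k ∈ I}` attached to a central element `p`
and a left ideal `I`; its stabilization replaces the Artin–Rees lemma. -/
def powColon {U : Type*} [Ring U] {p : U} (hp : ∀ x, Commute p x) (I : Ideal U) :
    ℕ →o Ideal U where
  toFun k := Submodule.comap (LinearMap.toSpanSingleton U U (p ^ k)) I
  monotone' k l h x hx := by
    change x * p ^ l ∈ I
    rw [← Nat.sub_add_cancel h, pow_add, ← mul_assoc, ← ((hp x).pow_left _).eq, mul_assoc]
    exact I.mul_mem_left _ hx

theorem mem_powColon {U : Type*} [Ring U] {p : U} (hp : ∀ x, Commute p x) {I : Ideal U} {k : ℕ}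
    {x : U} : x ∈ powColon hp I k ↔ x * p ^ k ∈ I := Iff.rfl

end CentralComplete

/-! ### Flatness of completions and of central localizations -/

section Completion

variable {P U : Type*} [Ring P] [Ring U]

/-- `U` is, via `g`, the completion of `P` along the central element `p`, which is regular in `U`:
`U` is complete along `g p`, and `P / p P = U / p U`. -/
structure IsCompletionAlong (g : P →+* U) (p : P) : Prop where
  commute : ∀ x, Commute p x
  complete : IsCentralComplete (g p)
  eq_zero_of_mul_eq_zero : ∀ u, g p * u = 0 → u = 0
  exists_eq_add : ∀ u, ∃ t u', u = g t + g p * u'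
  dvd_of_map_dvd : ∀ t, g p ∣ g t → p ∣ t

namespace IsCompletionAlong

variable {g : P →+* U} {p : P}

theorem op (h : IsCompletionAlong g p) : IsCompletionAlong (RingHom.op g) (MulOpposite.op p) where
  commute := commute_op h.commute
  complete := h.complete.op
  eq_zero_of_mul_eq_zero u hu := MulOpposite.unop_injective <| h.eq_zero_of_mul_eq_zero _ <| by
    rw [(h.complete.commute _).eq]
    exact congrArg MulOpposite.unop hu
  exists_eq_add u := by
    obtain ⟨t, u', h'⟩ := h.exists_eq_add u.unop
    refine ⟨MulOpposite.op t, MulOpposite.op u', MulOpposite.unop_injective ?_⟩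
    rw [h', (h.complete.commute u').eq]
    rfl
  dvd_of_map_dvd t ht := (op_dvd_op_of_commute h.commute).2 <|
    h.dvd_of_map_dvd t.unop ((op_dvd_op_of_commute h.complete.commute).1 ht)

theorem exists_eq_add_pow (h : IsCompletionAlong g p) (k : ℕ) (u : U) :
    ∃ t u', u = g t + g p ^ k * u' := by
  induction k generalizing u with
  | zero => exact ⟨0, u, by simp⟩
  | succ k ih =>
    obtain ⟨t, u', rfl⟩ := h.exists_eq_add u
    obtain ⟨t', u'', rfl⟩ := ih u'
    refine ⟨t + p * t', u'', ?_⟩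
    rw [map_add, map_mul, mul_add, ← add_assoc, ← mul_assoc, ← pow_succ']

theorem pow_dvd_of_map_pow_dvd (h : IsCompletionAlong g p) (k : ℕ) {t : P}
    (ht : g p ^ k ∣ g t) : p ^ k ∣ t := by
  induction k generalizing t with
  | zero => simp
  | succ k ih =>
    obtain ⟨u, hu⟩ := ht
    rw [pow_succ', mul_assoc] at hu
    obtain ⟨t', rfl⟩ := h.dvd_of_map_dvd t ⟨_, hu⟩
    rw [map_mul, ← sub_eq_zero, ← mul_sub] at hu
    rw [pow_succ']
    exact mul_dvd_mul_left p (ih ⟨u, sub_eq_zero.1 (h.eq_zero_of_mul_eq_zero _ hu)⟩)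

theorem exists_relation_add [IsNoetherianRing P] (h : IsCompletionAlong g p) {ι : Type*} [Fintype ι]
    (a : ι → P) (t : ι → U) (ht : ∑ i, t i * g (a i) = 0) :
    ∃ w : ι → P, ∑ i, w i * a i = 0 ∧ ∃ t' : ι → U, ∑ i, t' i * g (a i) = 0 ∧
      ∀ i, t i = g (w i) + g p * t' i := by
  let J : Ideal P := Ideal.span (Set.range a)
  obtain ⟨c, hc⟩ := monotone_stabilizes_iff_noetherian.2 ‹_› (powColon h.commute J)
  choose u v huv using fun i => h.exists_eq_add_pow (c + 1) (t i)
  have hsum : g (∑ i, u i * a i) = g p ^ (c + 1) * -∑ i, v i * g (a i) := by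
    rw [mul_neg, eq_neg_iff_add_eq_zero, ← ht, map_sum, Finset.mul_sum, ← Finset.sum_add_distrib]
    exact Finset.sum_congr rfl fun i _ => by rw [huv i, add_mul, map_mul, mul_assoc]
  obtain ⟨x, hx⟩ := h.pow_dvd_of_map_pow_dvd (c + 1) ⟨_, hsum⟩
  have hxJ : x ∈ powColon h.commute J c := by
    rw [hc (c + 1) c.le_succ, mem_powColon, ← ((h.commute x).pow_left _).eq, ← hx]
    exact Submodule.sum_mem _ fun i _ => J.mul_mem_left _ (Ideal.subset_span ⟨i, rfl⟩)
  rw [mem_powColon, ← ((h.commute x).pow_left _).eq] at hxJ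
  obtain ⟨y, hy⟩ := (Submodule.mem_span_range_iff_exists_fun P).1 hxJ
  simp only [smul_eq_mul] at hy
  have hw : ∑ i, (u i - p * y i) * a i = 0 := by
    simp only [sub_mul, mul_assoc, Finset.sum_sub_distrib]
    rw [← Finset.mul_sum, hy, hx, pow_succ', mul_assoc, sub_self]
  have htw (i : ι) : t i = g (u i - p * y i) + g p * (g p ^ c * v i + g (y i)) := by
    rw [huv i, map_sub, map_mul, pow_succ', mul_add, ← mul_assoc]
    abel
  refine ⟨fun i => u i - p * y i, hw, fun i => g p ^ c * v i + g (y i), ?_, htw⟩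
  refine h.eq_zero_of_mul_eq_zero _ ?_
  calc g p * ∑ i, (g p ^ c * v i + g (y i)) * g (a i)
      = ∑ i, t i * g (a i) - g (∑ i, (u i - p * y i) * a i) := by
        rw [map_sum, Finset.mul_sum, ← Finset.sum_sub_distrib]
        exact Finset.sum_congr rfl fun i _ => by
          rw [htw i, map_mul, add_mul (g _), add_sub_cancel_left, mul_assoc]
    _ = 0 := by rw [ht, hw, map_zero, sub_zero]

theorem isEquationallyFlat [IsNoetherianRing P] (h : IsCompletionAlong g p) :
    IsEquationallyFlat g := by
  intro m t a hta
  let Z : Submodule P (Fin m → P) := LinearMap.ker (Fintype.linearCombination P a)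
  have mem_Z (w : Fin m → P) : w ∈ Z ↔ ∑ i, w i * a i = 0 := by
    simp [Z, Fintype.linearCombination_apply]
  obtain ⟨k, z, hz⟩ := Submodule.fg_iff_exists_fin_generating_family.1 (IsNoetherian.noetherian Z)
  have hspan : {t : Fin m → U | ∑ i, t i * g (a i) = 0} ⊆
      Submodule.span U (Set.range fun l i => g (z l i)) := by
    refine h.complete.subset_span_of_subset_add (fun x hx => funext fun i => ?_) fun t ht => ?_
    · refine h.complete.separated _ fun k => ?_
      obtain ⟨y, rfl⟩ := hx k
      exact ⟨y i, rfl⟩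
    · obtain ⟨w, hw, t', ht', htw⟩ := h.exists_relation_add a t ht
      obtain ⟨b, rfl⟩ := (Submodule.mem_span_range_iff_exists_fun P).1 (hz ▸ (mem_Z w).2 hw)
      refine ⟨_, (Submodule.mem_span_range_iff_exists_fun U).2 ⟨fun l => g (b l), rfl⟩, t', ht',
        funext fun i => ?_⟩
      simp [htw i, Finset.sum_apply]
  obtain ⟨b, rfl⟩ := (Submodule.mem_span_range_iff_exists_fun U).1 (hspan hta)
  refine ⟨k, b, z, fun i => by simp [Finset.sum_apply], fun l => (mem_Z _).1 ?_⟩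
  exact hz ▸ Submodule.subset_span ⟨l, rfl⟩

end IsCompletionAlong

/-- The homomorphism `i : U →+* T` inverts the central regular element `p`, and `T` consists of the
fractions `i p ^ (-k) * i y`. -/
structure IsCentralLocalization {T : Type*} [Ring T] (i : U →+* T) (p : U) : Prop where
  injective : Function.Injective i
  isUnit : IsUnit (i p)
  commute : ∀ x, Commute (i p) x
  exists_pow_mul_eq : ∀ x, ∃ (k : ℕ) (y : U), i p ^ k * x = i y

namespace IsCentralLocalization

variable {T : Type*} [Ring T] {i : U →+* T} {p : U}

theorem op (h : IsCentralLocalization i p) :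
    IsCentralLocalization (RingHom.op i) (MulOpposite.op p) where
  injective x y hxy := MulOpposite.unop_injective (h.injective (congrArg MulOpposite.unop hxy))
  isUnit := h.isUnit.op
  commute := commute_op h.commute
  exists_pow_mul_eq x := by
    obtain ⟨k, y, hy⟩ := h.exists_pow_mul_eq x.unop
    refine ⟨k, MulOpposite.op y, MulOpposite.unop_injective ?_⟩
    rw [((h.commute _).pow_left k).eq] at hy
    exact hy

theorem exists_pow_mul_eq_of_finite (h : IsCentralLocalization i p) {ι : Type*} [Finite ι]
    (x : ι → T) : ∃ (k : ℕ) (y : ι → U), ∀ l, i p ^ k * x l = i (y l) := by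
  have := Fintype.ofFinite ι
  choose k y hy using fun l => h.exists_pow_mul_eq (x l)
  refine ⟨∑ l, k l, fun l => p ^ (∑ l, k l - k l) * y l, fun l => ?_⟩
  rw [map_mul, map_pow, ← hy l, ← mul_assoc, ← pow_add, Nat.sub_add_cancel
    (Finset.single_le_sum (fun _ _ => Nat.zero_le _) (Finset.mem_univ l))]

theorem isEquationallyFlat {S : Type*} [Ring S] {g : P →+* U} (hg : IsEquationallyFlat g) {q : P}
    {f : S →+* T} {j : P →+* S} (hj : IsCentralLocalization j q)
    (hi : IsCentralLocalization i (g q)) (hij : ∀ x, i (g x) = f (j x)) :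
    IsEquationallyFlat f := by
  intro m t a hta
  obtain ⟨ka, a', ha⟩ := hj.exists_pow_mul_eq_of_finite a
  obtain ⟨kt, t', ht⟩ := hi.exists_pow_mul_eq_of_finite t
  have hfa (l : Fin m) : i (g q) ^ ka * f (a l) = i (g (a' l)) := by
    rw [hij, hij, ← ha, map_mul, map_pow]
  obtain ⟨k, b, s, hbs, hs⟩ := hg m t' a' <| hi.injective <| by
    calc i (∑ l, t' l * g (a' l)) = ∑ l, i (g q) ^ kt * i (g q) ^ ka * (t l * f (a l)) := by
          rw [map_sum]
          refine Finset.sum_congr rfl fun l _ => ?_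
          rw [map_mul, ← ht, ← hfa, mul_assoc, ← mul_assoc (t l), ← ((hi.commute _).pow_left _).eq]
          simp only [mul_assoc]
      _ = i 0 := by rw [← Finset.mul_sum, hta, mul_zero, map_zero]
  refine ⟨k, fun l => Ring.inverse (i (g q) ^ kt) * i (b l), fun l r => j (s l r), fun r => ?_,
    fun l => ?_⟩
  · have htr : i (g q) ^ kt * t r = ∑ l, i (b l) * f (j (s l r)) := by
      rw [ht, hbs r, map_sum]
      simp only [map_mul, hij]
    simp only [mul_assoc]
    rw [← Finset.mul_sum, ← htr, ← mul_assoc, Ring.inverse_mul_cancel _ (hi.isUnit.pow kt), one_mul]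
  · refine (hj.isUnit.pow ka).mul_right_injective ?_
    change j q ^ ka * _ = j q ^ ka * 0
    rw [mul_zero, ← map_zero j, ← hs l, map_sum, Finset.mul_sum]
    refine Finset.sum_congr rfl fun r _ => ?_
    rw [map_mul, ← ha, ← mul_assoc, ← mul_assoc, ((hj.commute _).pow_left _).eq]

theorem isNoetherianRing [IsNoetherianRing U] (h : IsCentralLocalization i p) :
    IsNoetherianRing T := by
  rw [isNoetherianRing_iff_ideal_fg]
  intro I
  have hI : I = (I.comap i).map i := by
    refine le_antisymm (fun x hx => ?_) Ideal.map_comap_le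
    obtain ⟨k, y, hy⟩ := h.exists_pow_mul_eq x
    have hiy : i y ∈ (I.comap i).map i :=
      Ideal.mem_map_of_mem i (by rw [Ideal.mem_comap, ← hy]; exact I.mul_mem_left _ hx)
    rw [← one_mul x, ← Ring.inverse_mul_cancel _ (h.isUnit.pow k), mul_assoc, hy]
    exact Ideal.mul_mem_left _ _ hiy
  rw [hI]
  exact ((isNoetherianRing_iff_ideal_fg U).1 ‹_› _).map i

end IsCentralLocalization

end Completion

/-! ### Criteria for a noncommutative ring to be noetherian -/

section CompleteNoetherian

variable {B U : Type*} [Ring B] [Ring U] {p : U}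

/-- The left ideal of `B` of those elements whose image in `U` lies in the left ideal `I` modulo
the central element `p`. -/
def comapMod (ι : B →+* U) (hp : ∀ x, Commute p x) (I : Ideal U) : Ideal B where
  carrier := {b | ∃ x ∈ I, ∃ u, ι b = x + p * u}
  add_mem' := by
    rintro b b' ⟨x, hx, u, h⟩ ⟨x', hx', u', h'⟩
    exact ⟨x + x', I.add_mem hx hx', u + u', by rw [map_add, h, h', mul_add]; abel⟩
  zero_mem' := ⟨0, I.zero_mem, 0, by simp⟩
  smul_mem' := by
    rintro c b ⟨x, hx, u, h⟩
    exact ⟨ι c * x, I.mul_mem_left _ hx, ι c * u, by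
      rw [smul_eq_mul, map_mul, h, mul_add, ← mul_assoc, ← (hp (ι c)).eq, mul_assoc]⟩

theorem exists_generators_mod [IsNoetherianRing B] (ι : B →+* U) (hp : ∀ x, Commute p x)
    (happ : ∀ u, ∃ b u', u = ι b + p * u') (I : Ideal U) :
    ∃ (k : ℕ) (g : Fin k → U), Submodule.span U (Set.range g) ≤ I ∧
      ∀ x ∈ I, ∃ y ∈ Submodule.span U (Set.range g), ∃ u, x = y + p * u := by
  obtain ⟨k, b, hb⟩ := Submodule.fg_iff_exists_fin_generating_family.1
    (IsNoetherian.noetherian (comapMod ι hp I))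
  choose g hg w hw using fun l => show b l ∈ comapMod ι hp I from
    hb ▸ Submodule.subset_span ⟨l, rfl⟩
  refine ⟨k, g, Submodule.span_le.2 (Set.range_subset_iff.2 hg), fun x hx => ?_⟩
  obtain ⟨c, u, hu⟩ := happ x
  have hc : c ∈ comapMod ι hp I := ⟨x, hx, -u, by rw [hu]; simp⟩
  rw [← hb] at hc
  obtain ⟨a, rfl⟩ := (Submodule.mem_span_range_iff_exists_fun B).1 hc
  refine ⟨_, (Submodule.mem_span_range_iff_exists_fun U).2 ⟨fun l => ι (a l), rfl⟩,
    ∑ l, ι (a l) * w l + u, ?_⟩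
  rw [hu, mul_add, ← add_assoc, map_sum, Finset.mul_sum, ← Finset.sum_add_distrib]
  congr 1
  refine Finset.sum_congr rfl fun l _ => ?_
  rw [smul_eq_mul, map_mul, hw, mul_add, ← mul_assoc p, (hp (ι (a l))).eq, mul_assoc, smul_eq_mul]

theorem IsCentralComplete.fg_of_saturated [IsNoetherianRing B] (ι : B →+* U)
    (hp : IsCentralComplete p) (happ : ∀ u, ∃ b u', u = ι b + p * u') {I : Ideal U}
    (hI : ∀ x, p * x ∈ I → x ∈ I) : I.FG := by
  obtain ⟨k, g, hgI, hgen⟩ := exists_generators_mod ι hp.commute happ I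
  have hI_le : (I : Set U) ⊆ Submodule.span U (Set.range g) := by
    refine hp.subset_span_of_subset_add hp.separated fun x hx => ?_
    obtain ⟨y, hy, u, rfl⟩ := hgen x hx
    exact ⟨y, hy, u, hI u ((Submodule.add_mem_iff_right I (hgI hy)).1 hx), rfl⟩
  exact Submodule.fg_iff_exists_fin_generating_family.2 ⟨k, g, le_antisymm hgI hI_le⟩

theorem fg_of_fg_powColon_one [IsNoetherianRing B] (ι : B →+* U) (hp : ∀ x, Commute p x)
    (happ : ∀ u, ∃ b u', u = ι b + p * u') {I : Ideal U} (hI : (powColon hp I 1).FG) : I.FG := by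
  obtain ⟨k, g, hgI, hgen⟩ := exists_generators_mod ι hp happ I
  have hsup : I = Submodule.span U (Set.range g) ⊔
      Submodule.map (LinearMap.toSpanSingleton U U (p ^ 1)) (powColon hp I 1) := by
    refine le_antisymm (fun x hx => ?_) (sup_le hgI (Submodule.map_comap_le _ _))
    obtain ⟨y, hy, u, rfl⟩ := hgen x hx
    refine Submodule.add_mem_sup hy ⟨u, ?_, ?_⟩
    · rw [SetLike.mem_coe, mem_powColon, pow_one, ← (hp u).eq]
      exact (Submodule.add_mem_iff_right I (hgI hy)).1 hx
    · rw [LinearMap.toSpanSingleton_apply, smul_eq_mul, pow_one, (hp u).eq]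
  rw [hsup]
  exact (Submodule.fg_span (Set.finite_range g)).sup (Submodule.FG.map _ hI)

theorem fg_of_fg_powColon [IsNoetherianRing B] (ι : B →+* U) (hp : ∀ x, Commute p x)
    (happ : ∀ u, ∃ b u', u = ι b + p * u') {I : Ideal U} (k : ℕ) (hI : (powColon hp I k).FG) :
    I.FG := by
  induction k with
  | zero =>
    rwa [show powColon hp I 0 = I from Submodule.ext fun x => by
      rw [mem_powColon, pow_zero, mul_one]] at hI
  | succ k ih =>
    refine ih (fg_of_fg_powColon_one ι hp happ ?_)
    rwa [show powColon hp (powColon hp I k) 1 = powColon hp I (k + 1) from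
      Submodule.ext fun x => by
        rw [mem_powColon, mem_powColon, mem_powColon, pow_one, mul_assoc, ← pow_succ']]

theorem IsCentralComplete.isNoetherianRing [IsNoetherianRing B] (ι : B →+* U)
    (hp : IsCentralComplete p) (happ : ∀ u, ∃ b u', u = ι b + p * u') : IsNoetherianRing U := by
  rw [isNoetherianRing_iff_ideal_fg]
  intro I
  have hsat : (⨆ k, powColon hp.commute I k).FG := by
    refine hp.fg_of_saturated ι happ fun x hx => ?_
    rw [Submodule.mem_iSup_of_chain] at hx ⊢
    obtain ⟨k, hk⟩ := hx
    rw [mem_powColon, (hp.commute x).eq, mul_assoc, ← pow_succ'] at hk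
    exact ⟨k + 1, hk⟩
  obtain ⟨k, hk⟩ := Submodule.FG.stabilizes_of_iSup_eq hsat (powColon hp.commute I) rfl
  exact fg_of_fg_powColon ι hp.commute happ k (hk ▸ hsat)

theorem IsCompletionAlong.isNoetherianRing [IsNoetherianRing B] {ι : B →+* U} {b : B}
    (h : IsCompletionAlong ι b) : IsNoetherianRing U :=
  h.complete.isNoetherianRing ι h.exists_eq_add

end CompleteNoetherian

theorem isNoetherianRing_of_leadingTerms {Λ Q B : Type*} [Preorder Λ] [WellQuasiOrderedLE Λ]
    [PartialOrder Q] [WellFoundedGT Q] [Ring B] (L : Ideal B → Λ → Q) (hL : Monotone L)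
    (hLI : ∀ I, Monotone (L I)) (hinj : ∀ I J, I ≤ J → L I = L J → I = J) :
    IsNoetherianRing B := by
  rw [isNoetherianRing_iff, isNoetherian_iff', wellFoundedGT_iff_monotone_chain_condition]
  by_contra! hchain
  obtain ⟨a, ha⟩ := hchain
  choose s hs hne using ha
  let d (n : ℕ) : ℕ := s^[n] 0
  have hd (n : ℕ) : d (n + 1) = s (d n) := Function.iterate_succ_apply' s n 0
  have hdm : Monotone d := monotone_nat_of_le_succ fun n => by rw [hd]; exact hs _
  have hjump (n : ℕ) : ∃ α, L (a (d n)) α < L (a (d (n + 1))) α := by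
    by_contra! h
    have hle : a (d n) ≤ a (d (n + 1)) := a.monotone (hdm n.le_succ)
    refine hne (d n) ?_
    rw [← hd]
    exact hinj _ _ hle (funext fun α => (hL hle α).eq_of_not_lt (h α))
  choose α hα using hjump
  obtain ⟨g, hg⟩ := (wellQuasiOrdered_le (α := Λ)).exists_monotone_subseq α
  have hstrict : StrictMono fun n => L (a (d (g n + 1))) (α (g n)) :=
    strictMono_nat_of_lt_succ fun n => lt_of_le_of_lt
      ((hL (a.monotone (hdm (Nat.succ_le_of_lt (g.strictMono n.lt_succ_self)))) _).trans
        (hLI _ (hg _ _ n.le_succ)))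
      (hα (g (n + 1)))
  obtain ⟨n, hn⟩ := WellFoundedGT.monotone_chain_condition ⟨_, hstrict.monotone⟩
  exact (hstrict n.lt_succ_self).ne (hn (n + 1) n.le_succ)

section LeftSpan

variable {C B : Type*} [Ring C] [Ring B] {φ : C →+* B} {X Y : Set B}

variable (φ) in
/-- The left `C`-submodule of `B` spanned by `X`, where `C` acts through `φ`. It is encoded as an
additive subgroup so that no module structure has to be chosen on `B`. -/
def leftSpan (X : Set B) : AddSubgroup B :=
  AddSubgroup.closure (Set.image2 (fun c x => φ c * x) Set.univ X)

theorem base_mul_mem_leftSpan_of_mem (c : C) {x : B} (hx : x ∈ X) : φ c * x ∈ leftSpan φ X :=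
  AddSubgroup.subset_closure ⟨c, trivial, x, hx, rfl⟩

theorem subset_leftSpan : X ⊆ leftSpan φ X := fun x hx => by
  simpa using base_mul_mem_leftSpan_of_mem (φ := φ) 1 hx

theorem leftSpan_le {S : AddSubgroup B} : leftSpan φ X ≤ S ↔ ∀ c, ∀ x ∈ X, φ c * x ∈ S := by
  simp [leftSpan, AddSubgroup.closure_le, Set.image2_subset_iff]

theorem leftSpan_mono (h : X ⊆ Y) : leftSpan φ X ≤ leftSpan φ Y :=
  leftSpan_le.2 fun c _ hx => base_mul_mem_leftSpan_of_mem c (h hx)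

theorem base_mul_mem_leftSpan (c : C) {x : B} (hx : x ∈ leftSpan φ X) : φ c * x ∈ leftSpan φ X := by
  have h : leftSpan φ X ≤ (leftSpan φ X).comap (AddMonoidHom.mulLeft (φ c)) :=
    leftSpan_le.2 fun d x hx => by
      simpa [mul_assoc] using base_mul_mem_leftSpan_of_mem (φ := φ) (c * d) hx
  exact h hx

end LeftSpan

/-! ### Almost commutative extensions -/

theorem degree_add_single_one {σ : Type*} (α : σ →₀ ℕ) (j : σ) :
    (α + Finsupp.single j 1).degree = α.degree + 1 := by
  rw [map_add, Finsupp.degree_single]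

theorem length_toList_toMultiset {σ : Type*} (α : σ →₀ ℕ) :
    (Finsupp.toMultiset α).toList.length = α.degree := by
  rw [Multiset.length_toList, Finsupp.card_toMultiset, Finsupp.degree_apply, Finsupp.sum]
  rfl

section AlmostPolynomial

variable {C B : Type*} [Ring C] [Ring B] {φ : C →+* B} {r : ℕ} {y : Fin r → B}

/-- The ring `B` is generated by the image of `φ` and by the elements `y j`, which commute with the
image of `φ` and with each other up to terms of lower degree. The correction terms are written with
the coefficients on the left. -/
structure IsAlmostPolynomial (φ : C →+* B) (y : Fin r → B) : Prop where
  comm_base : ∀ j c, ∃ c', y j * φ c = φ c * y j + φ c'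
  comm_gen : ∀ i j, ∃ (c₀ : C) (c : Fin r → C),
    y i * y j = y j * y i + (φ c₀ + ∑ k, φ (c k) * y k)
  generates : ∀ P : Subring B, (∀ c, φ c ∈ P) → (∀ j, y j ∈ P) → P = ⊤

variable (φ y) in
/-- The left span of the words of length at most `n` in the elements `y j`. -/
def wordSpan (n : ℕ) : AddSubgroup B :=
  leftSpan φ ((fun l : List (Fin r) => (l.map y).prod) '' {l | l.length ≤ n})

theorem wordSpan_mono : Monotone (wordSpan φ y) := fun _ _ h =>
  leftSpan_mono (Set.image_mono fun _ hl => le_trans hl h)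

theorem wordSpan_le {n : ℕ} {S : AddSubgroup B} : wordSpan φ y n ≤ S ↔
    ∀ c, ∀ l : List (Fin r), l.length ≤ n → φ c * (l.map y).prod ∈ S := by
  simp [wordSpan, leftSpan_le]

theorem base_mul_word_mem_wordSpan {n : ℕ} (c : C) {l : List (Fin r)} (hl : l.length ≤ n) :
    φ c * (l.map y).prod ∈ wordSpan φ y n :=
  base_mul_mem_leftSpan_of_mem c ⟨l, hl, rfl⟩

/-- The monomial with exponent `α`. As the `y j` need not commute, the order of its letters is an
arbitrary choice, made by `Multiset.toList`. -/
def mon (y : Fin r → B) (α : Fin r →₀ ℕ) : B := ((Finsupp.toMultiset α).toList.map y).prod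

variable (φ y) in
/-- The left span of the monomials with exponent in `s`. -/
def monSpan (s : Set (Fin r →₀ ℕ)) : AddSubgroup B := leftSpan φ (mon y '' s)

theorem monSpan_mono : Monotone (monSpan φ y) := fun _ _ h => leftSpan_mono (Set.image_mono h)

theorem monSpan_le {s : Set (Fin r →₀ ℕ)} {S : AddSubgroup B} :
    monSpan φ y s ≤ S ↔ ∀ c, ∀ α ∈ s, φ c * mon y α ∈ S := by
  simp [monSpan, leftSpan_le]

theorem base_mul_mon_mem_monSpan {s : Set (Fin r →₀ ℕ)} (c : C) {α : Fin r →₀ ℕ} (hα : α ∈ s) :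
    φ c * mon y α ∈ monSpan φ y s :=
  base_mul_mem_leftSpan_of_mem c ⟨α, hα, rfl⟩

variable (φ y) in
/-- The left span of the monomials whose exponent precedes `α` in the degree-lexicographic order:
the terms that are neglected when leading coefficients in degree `α` are taken. -/
def lowSpan (α : Fin r →₀ ℕ) : AddSubgroup B := monSpan φ y {β | toDegLex β < toDegLex α}

namespace IsAlmostPolynomial

theorem gen_mul_mem (h : IsAlmostPolynomial φ y) {n : ℕ} (j : Fin r) {x : B}
    (hx : x ∈ wordSpan φ y n) : y j * x ∈ wordSpan φ y (n + 1) := by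
  suffices hle : wordSpan φ y n ≤ (wordSpan φ y (n + 1)).comap (AddMonoidHom.mulLeft (y j)) from
    hle hx
  refine wordSpan_le.2 fun c l hl => ?_
  obtain ⟨c', hc'⟩ := h.comm_base j c
  rw [AddSubgroup.mem_comap, AddMonoidHom.coe_mulLeft]
  rw [← mul_assoc, hc', add_mul, mul_assoc, ← List.prod_cons, ← List.map_cons]
  exact add_mem (base_mul_word_mem_wordSpan c (Nat.succ_le_succ hl))
    (base_mul_word_mem_wordSpan c' (Nat.le_succ_of_le hl))

theorem word_mul_mem (h : IsAlmostPolynomial φ y) {n : ℕ} {z : B} (hz : z ∈ wordSpan φ y n)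
    (l : List (Fin r)) : (l.map y).prod * z ∈ wordSpan φ y (l.length + n) := by
  induction l with
  | nil => simpa using hz
  | cons j l ih =>
    rw [List.map_cons, List.prod_cons, mul_assoc, List.length_cons, Nat.add_right_comm]
    exact h.gen_mul_mem j ih

theorem mul_mem (h : IsAlmostPolynomial φ y) {m n : ℕ} {x z : B} (hx : x ∈ wordSpan φ y m)
    (hz : z ∈ wordSpan φ y n) : x * z ∈ wordSpan φ y (m + n) := by
  suffices hle : wordSpan φ y m ≤ (wordSpan φ y (m + n)).comap (AddMonoidHom.mulRight z) from
    hle hx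
  refine wordSpan_le.2 fun c l hl => ?_
  rw [AddSubgroup.mem_comap, AddMonoidHom.mulRight_apply, mul_assoc]
  exact base_mul_mem_leftSpan c (wordSpan_mono (Nat.add_le_add_right hl n) (h.word_mul_mem hz l))

theorem exists_mem_wordSpan (h : IsAlmostPolynomial φ y) (b : B) : ∃ n, b ∈ wordSpan φ y n := by
  have base_mem (c : C) : φ c ∈ wordSpan φ y 0 := by
    simpa using base_mul_word_mem_wordSpan (φ := φ) (y := y) c (l := []) le_rfl
  let P : Subring B :=
    { carrier := {b | ∃ n, b ∈ wordSpan φ y n}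
      mul_mem' := fun ⟨m, hm⟩ ⟨n, hn⟩ => ⟨m + n, h.mul_mem hm hn⟩
      one_mem' := ⟨0, map_one φ ▸ base_mem 1⟩
      add_mem' := fun ⟨m, hm⟩ ⟨n, hn⟩ => ⟨max m n, add_mem
        (wordSpan_mono (le_max_left _ _) hm) (wordSpan_mono (le_max_right _ _) hn)⟩
      zero_mem' := ⟨0, zero_mem _⟩
      neg_mem' := fun ⟨n, hn⟩ => ⟨n, neg_mem hn⟩ }
  have hP : P = ⊤ := h.generates P (fun c => ⟨0, base_mem c⟩) fun j =>
    ⟨1, subset_leftSpan ⟨[j], by simp⟩⟩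
  exact hP.ge (Subring.mem_top b)

theorem sub_mem_of_perm (h : IsAlmostPolynomial φ y) {l l' : List (Fin r)} (hl : l.Perm l') :
    (l.map y).prod - (l'.map y).prod ∈ wordSpan φ y (l.length - 1) := by
  induction hl with
  | nil => simp
  | @cons j l l' hl ih =>
    rw [List.map_cons, List.map_cons, List.prod_cons, List.prod_cons, ← mul_sub,
      List.length_cons, Nat.add_sub_cancel]
    rcases l with _ | ⟨i, l⟩
    · simp [List.nil_perm.1 hl]
    · exact h.gen_mul_mem j ih
  | swap i j l =>
    obtain ⟨c₀, c, hc⟩ := h.comm_gen j i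
    simp only [List.map_cons, List.prod_cons, ← mul_assoc]
    rw [← sub_mul, hc, add_sub_cancel_left, add_mul, Finset.sum_mul]
    refine add_mem (base_mul_word_mem_wordSpan c₀ (by simp)) (sum_mem fun k _ => ?_)
    rw [mul_assoc, ← List.prod_cons, ← List.map_cons]
    exact base_mul_word_mem_wordSpan (c k) (by simp)
  | trans hl _ ih ih' =>
    rw [← hl.length_eq] at ih'
    simpa using add_mem ih ih'

theorem wordSpan_le_monSpan (h : IsAlmostPolynomial φ y) (n : ℕ) :
    wordSpan φ y n ≤ monSpan φ y {α | α.degree ≤ n} := by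
  induction n using Nat.strong_induction_on with
  | _ n ih =>
    refine wordSpan_le.2 fun c l hl => ?_
    let α : Fin r →₀ ℕ := Multiset.toFinsupp (l : Multiset (Fin r))
    have hα : (Finsupp.toMultiset α).toList.Perm l := by
      rw [← Multiset.coe_eq_coe, Multiset.coe_toList, Multiset.toFinsupp_toMultiset]
    have hdeg : α.degree = l.length := by rw [← length_toList_toMultiset, hα.length_eq]
    have hperm := h.sub_mem_of_perm hα.symm
    have hsub : (l.map y).prod - mon y α ∈ monSpan φ y {α | α.degree ≤ n} := by
      rcases l with _ | ⟨j, l⟩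
      · simp [mon, List.perm_nil.1 hα]
      · have hlt : l.length < n := hl
        exact monSpan_mono (fun β (hβ : β.degree ≤ l.length) => hβ.trans hlt.le) (ih _ hlt hperm)
    rw [← sub_add_cancel (l.map y).prod (mon y α), mul_add]
    exact add_mem (base_mul_mem_leftSpan c hsub)
      (base_mul_mon_mem_monSpan c (hdeg.trans_le hl))

theorem wordSpan_le_lowSpan (h : IsAlmostPolynomial φ y) {n : ℕ} {α : Fin r →₀ ℕ}
    (hn : n < α.degree) : wordSpan φ y n ≤ lowSpan φ y α :=
  (h.wordSpan_le_monSpan n).trans <| monSpan_mono fun _ hβ =>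
    Finsupp.DegLex.lt_iff.2 (Or.inl (lt_of_le_of_lt hβ hn))

theorem gen_mul_term (h : IsAlmostPolynomial φ y) (j : Fin r) (c : C) (α : Fin r →₀ ℕ) :
    y j * (φ c * mon y α) - φ c * mon y (α + Finsupp.single j 1) ∈ wordSpan φ y α.degree := by
  have hperm : (j :: (Finsupp.toMultiset α).toList).Perm
      (Finsupp.toMultiset (α + Finsupp.single j 1)).toList := by
    rw [← Multiset.coe_eq_coe, Multiset.coe_toList, ← Multiset.cons_coe, Multiset.coe_toList,
      map_add, Finsupp.toMultiset_single, one_smul, add_comm, Multiset.singleton_add]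
  have hmon : y j * mon y α - mon y (α + Finsupp.single j 1) ∈ wordSpan φ y α.degree := by
    simpa only [mon, List.map_cons, List.prod_cons, List.length_cons, Nat.add_sub_cancel,
      length_toList_toMultiset] using h.sub_mem_of_perm hperm
  obtain ⟨c', hc'⟩ := h.comm_base j c
  rw [← mul_assoc, hc', add_mul, mul_assoc, add_sub_right_comm, ← mul_sub]
  exact add_mem (base_mul_mem_leftSpan c hmon)
    (base_mul_word_mem_wordSpan c' (length_toList_toMultiset α).le)

theorem gen_mul_term_mem_lowSpan (h : IsAlmostPolynomial φ y) (j : Fin r) (c : C)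
    {α β : Fin r →₀ ℕ} (hαβ : α.degree ≤ β.degree) :
    y j * (φ c * mon y α) - φ c * mon y (α + Finsupp.single j 1) ∈
      lowSpan φ y (β + Finsupp.single j 1) := by
  refine h.wordSpan_le_lowSpan ?_ (h.gen_mul_term j c α)
  rw [degree_add_single_one]
  exact Nat.lt_succ_of_le hαβ

theorem gen_mul_lowSpan (h : IsAlmostPolynomial φ y) (j : Fin r) {α : Fin r →₀ ℕ} {x : B}
    (hx : x ∈ lowSpan φ y α) : y j * x ∈ lowSpan φ y (α + Finsupp.single j 1) := by
  suffices hle : lowSpan φ y α ≤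
      (lowSpan φ y (α + Finsupp.single j 1)).comap (AddMonoidHom.mulLeft (y j)) from hle hx
  refine monSpan_le.2 fun c β hβ => ?_
  rw [AddSubgroup.mem_comap, AddMonoidHom.coe_mulLeft,
    ← sub_add_cancel (y j * (φ c * mon y β)) (φ c * mon y (β + Finsupp.single j 1))]
  exact add_mem (h.gen_mul_term_mem_lowSpan j c (Finsupp.DegLex.monotone_degree hβ.le))
    (base_mul_mon_mem_monSpan c (add_lt_add_left (α := DegLex (Fin r →₀ ℕ)) hβ _))

end IsAlmostPolynomial

variable (φ y) in
/-- The left ideal of leading coefficients in degree `α` of the elements of a left ideal. -/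
def leadIdeal (I : Ideal B) (α : Fin r →₀ ℕ) : Ideal C where
  carrier := {c | ∃ x ∈ lowSpan φ y α, φ c * mon y α + x ∈ I}
  add_mem' := by
    rintro c c' ⟨x, hx, hI⟩ ⟨x', hx', hI'⟩
    refine ⟨x + x', add_mem hx hx', ?_⟩
    rw [map_add, add_mul, add_add_add_comm]
    exact I.add_mem hI hI'
  zero_mem' := ⟨0, zero_mem _, by simp⟩
  smul_mem' := by
    rintro d c ⟨x, hx, hI⟩
    refine ⟨φ d * x, base_mul_mem_leftSpan d hx, ?_⟩
    rw [smul_eq_mul, map_mul, mul_assoc, ← mul_add]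
    exact I.mul_mem_left _ hI

namespace IsAlmostPolynomial

theorem leadIdeal_le_add_single (h : IsAlmostPolynomial φ y) (I : Ideal B) (α : Fin r →₀ ℕ)
    (j : Fin r) : leadIdeal φ y I α ≤ leadIdeal φ y I (α + Finsupp.single j 1) := by
  rintro c ⟨x, hx, hI⟩
  refine ⟨y j * (φ c * mon y α + x) - φ c * mon y (α + Finsupp.single j 1), ?_, ?_⟩
  · rw [mul_add, add_sub_right_comm]
    exact add_mem (h.gen_mul_term_mem_lowSpan j c le_rfl) (h.gen_mul_lowSpan j hx)
  · rw [add_sub_cancel]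
    exact I.mul_mem_left _ hI

theorem monotone_leadIdeal (h : IsAlmostPolynomial φ y) (I : Ideal B) :
    Monotone (leadIdeal φ y I) := by
  suffices hle : ∀ γ α, leadIdeal φ y I α ≤ leadIdeal φ y I (α + γ) by
    intro α β hαβ
    obtain ⟨γ, rfl⟩ := exists_add_of_le hαβ
    exact hle γ α
  intro γ
  induction γ using Finsupp.induction_linear with
  | zero => simp
  | add γ γ' hγ hγ' => exact fun α => by rw [← add_assoc]; exact (hγ α).trans (hγ' _)
  | single j n =>
    induction n with
    | zero => simp
    | succ n ih =>
      intro α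
      rw [Finsupp.single_add, ← add_assoc]
      exact (ih α).trans (h.leadIdeal_le_add_single I _ j)

end IsAlmostPolynomial

theorem eq_zero_or_exists_of_mem_monSpan {s : Set (Fin r →₀ ℕ)} {x : B}
    (hx : x ∈ monSpan φ y s) :
    x = 0 ∨ ∃ β ∈ s, x ∈ monSpan φ y {γ | toDegLex γ ≤ toDegLex β} := by
  rcases s.eq_empty_or_nonempty with rfl | ⟨β₀, hβ₀⟩
  · have hbot : monSpan φ y ∅ ≤ ⊥ := monSpan_le.2 fun _ _ h => h.elim
    exact Or.inl (hbot hx)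
  let M (β : Fin r →₀ ℕ) : AddSubgroup B := monSpan φ y {γ | toDegLex γ ≤ toDegLex β}
  have hM {β γ : Fin r →₀ ℕ} (h : toDegLex β ≤ toDegLex γ) : M β ≤ M γ :=
    monSpan_mono fun _ h' => le_trans h' h
  have hdir : DirectedOn (Function.onFun (· ≤ ·) M) s := fun β hβ γ hγ =>
    (le_total (toDegLex β) (toDegLex γ)).elim
      (fun h => ⟨γ, hγ, hM h, le_rfl⟩) fun h => ⟨β, hβ, le_rfl, hM h⟩
  have hle : monSpan φ y s ≤ ⨆ β ∈ s, M β := monSpan_le.2 fun c β hβ =>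
    AddSubgroup.mem_iSup_of_mem β <| AddSubgroup.mem_iSup_of_mem hβ <|
      base_mul_mon_mem_monSpan c (le_refl (toDegLex β))
  exact Or.inr ((AddSubgroup.mem_biSup_of_directedOn hβ₀ hdir).1 (hle hx))

theorem exists_leading_of_mem_monSpan {α : Fin r →₀ ℕ} {x : B}
    (hx : x ∈ monSpan φ y {γ | toDegLex γ ≤ toDegLex α}) :
    ∃ c, ∃ z ∈ lowSpan φ y α, x = φ c * mon y α + z := by
  let T : AddSubgroup B := ((AddMonoidHom.mulRight (mon y α)).comp (φ : C →+ B)).range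
  suffices hle : monSpan φ y {γ | toDegLex γ ≤ toDegLex α} ≤ T ⊔ lowSpan φ y α by
    obtain ⟨_, ⟨c, rfl⟩, z, hz, rfl⟩ := AddSubgroup.mem_sup.1 (hle hx)
    exact ⟨c, z, hz, rfl⟩
  refine monSpan_le.2 fun c β (hβ : toDegLex β ≤ toDegLex α) => ?_
  rcases hβ.eq_or_lt with heq | hlt
  · exact AddSubgroup.mem_sup_left ⟨c, by simp [toDegLex_inj.1 heq]⟩
  · exact AddSubgroup.mem_sup_right (base_mul_mon_mem_monSpan c hlt)

theorem mem_of_leadIdeal_eq {I J : Ideal B} (hIJ : I ≤ J)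
    (hlead : leadIdeal φ y I = leadIdeal φ y J) (α : DegLex (Fin r →₀ ℕ)) {x : B} (hxJ : x ∈ J)
    (hx : x ∈ monSpan φ y {γ | toDegLex γ ≤ α}) : x ∈ I := by
  induction α using WellFoundedLT.induction generalizing x with
  | _ α ih =>
    obtain ⟨c, z, hz, rfl⟩ := exists_leading_of_mem_monSpan (α := ofDegLex α) hx
    obtain ⟨w, hw, hwI⟩ : c ∈ leadIdeal φ y I (ofDegLex α) := hlead ▸ ⟨z, hz, hxJ⟩
    have hzw : z - w ∈ I := by
      have hJ : z - w ∈ J := by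
        rw [← add_sub_add_left_eq_sub z w (φ c * mon y (ofDegLex α))]
        exact J.sub_mem hxJ (hIJ hwI)
      rcases eq_zero_or_exists_of_mem_monSpan (sub_mem hz hw) with h0 | ⟨β, hβ, hm⟩
      · exact h0 ▸ I.zero_mem
      · exact ih (toDegLex β) hβ hJ hm
    rw [← sub_add_cancel z w, add_left_comm]
    exact I.add_mem hzw hwI

namespace IsAlmostPolynomial

theorem isNoetherianRing [IsNoetherianRing C] (h : IsAlmostPolynomial φ y) :
    IsNoetherianRing B := by
  have : WellFoundedGT (Ideal C) := isNoetherian_iff'.1 ‹_›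
  refine isNoetherianRing_of_leadingTerms (leadIdeal φ y)
    (fun I J hIJ α c ⟨x, hx, hI⟩ => ⟨x, hx, hIJ hI⟩) h.monotone_leadIdeal
    fun I J hIJ hlead => le_antisymm hIJ fun x hx => ?_
  obtain ⟨n, hn⟩ := h.exists_mem_wordSpan x
  rcases eq_zero_or_exists_of_mem_monSpan (h.wordSpan_le_monSpan n hn) with rfl | ⟨β, -, hm⟩
  · exact I.zero_mem
  · exact mem_of_leadIdeal_eq hIJ hlead (toDegLex β) hx hm

theorem op (h : IsAlmostPolynomial φ y) :
    IsAlmostPolynomial (RingHom.op φ) fun j => MulOpposite.op (y j) where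
  comm_base j c := by
    obtain ⟨c', hc'⟩ := h.comm_base j c.unop
    refine ⟨MulOpposite.op (-c'), MulOpposite.unop_injective ?_⟩
    change φ c.unop * y j = y j * φ c.unop + φ (-c')
    rw [hc', map_neg, add_neg_cancel_right]
  comm_gen i j := by
    obtain ⟨c₀, c, hc⟩ := h.comm_gen j i
    choose d hd using fun k => h.comm_base k (c k)
    refine ⟨MulOpposite.op (c₀ - ∑ k, d k), fun k => MulOpposite.op (c k),
      MulOpposite.unop_injective ?_⟩
    rw [MulOpposite.unop_add, MulOpposite.unop_add, Finset.unop_sum]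
    change y j * y i = y i * y j + (φ (c₀ - ∑ k, d k) + ∑ k, y k * φ (c k))
    simp only [hc, hd, Finset.sum_add_distrib, map_sub, map_sum]
    abel
  generates P hφ hy := by
    have := h.generates P.unop (fun c => hφ (MulOpposite.op c)) hy
    rw [← Subring.op_unop P, this, Subring.op_top]

end IsAlmostPolynomial

end AlmostPolynomial

/-! ### Properties of the `ϖ`-adic completion -/

section PiCompletion

variable {R : Type*} [CommRing R] {ϖ : R} {B : Type*} [Ring B] [Algebra R B]

theorem mem_powIdeal_iff {k : ℕ} {b : B} : b ∈ powIdeal ϖ B k ↔ ∃ c : B, b = ϖ ^ k • c := by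
  rw [powIdeal, Ideal.mem_span_singleton']
  exact exists_congr fun c => by rw [← Algebra.commutes, ← Algebra.smul_def, eq_comm]

theorem mk_powIdeal_eq_iff {k : ℕ} {b c : B} :
    Ideal.Quotient.mk (powIdeal ϖ B k) b = Ideal.Quotient.mk (powIdeal ϖ B k) c ↔
      ∃ d : B, b = c + ϖ ^ k • d := by
  rw [Ideal.Quotient.eq, mem_powIdeal_iff]
  exact exists_congr fun d => sub_eq_iff_eq_add'

/-- The component of an element of the completion modulo `ϖ ^ k`. -/
def piComponent (k : ℕ) : PiCompletion ϖ B →ₐ[R] B ⧸ powIdeal ϖ B k :=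
  (Pi.evalAlgHom R _ k).comp (piCompletionSub ϖ B).val

/-- The element of the completion defined by a compatible family. -/
def piMk (x : ∀ k, B ⧸ powIdeal ϖ B k) (hx : ∀ k l (h : k ≤ l), powProj ϖ B h (x l) = x k) :
    PiCompletion ϖ B :=
  (⟨x, hx⟩ : piCompletionSub ϖ B)

theorem piComponent_piMk (x : ∀ k, B ⧸ powIdeal ϖ B k)
    (hx : ∀ k l (h : k ≤ l), powProj ϖ B h (x l) = x k) (k : ℕ) :
    piComponent k (piMk x hx) = x k := rfl

theorem piComponent_toPiCompletion (k : ℕ) (b : B) :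
    piComponent k (toPiCompletion ϖ B b) = Ideal.Quotient.mk (powIdeal ϖ B k) b := rfl

theorem piComponent_ext {x y : PiCompletion ϖ B} (h : ∀ k, piComponent k x = piComponent k y) :
    x = y := Subtype.ext (funext h)

theorem powProj_piComponent (x : PiCompletion ϖ B) {k l : ℕ} (h : k ≤ l) :
    powProj ϖ B h (piComponent l x) = piComponent k x := x.2 k l h

theorem powProj_mk {k l : ℕ} (h : k ≤ l) (b : B) :
    powProj ϖ B h (Ideal.Quotient.mk (powIdeal ϖ B l) b) = Ideal.Quotient.mk (powIdeal ϖ B k) b :=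
  rfl

theorem piComponent_pow_smul (k : ℕ) (x : PiCompletion ϖ B) : piComponent k (ϖ ^ k • x) = 0 := by
  obtain ⟨b, hb⟩ := Ideal.Quotient.mk_surjective (piComponent k x)
  rw [map_smul, ← hb, ← Ideal.Quotient.mkₐ_eq_mk R, ← map_smul, Ideal.Quotient.mkₐ_eq_mk,
    Ideal.Quotient.eq_zero_iff_mem]
  exact mem_powIdeal_iff.2 ⟨b, rfl⟩

theorem mk_pow_smul (k l : ℕ) (b : B) :
    Ideal.Quotient.mk (powIdeal ϖ B l) (ϖ ^ k • b) =
      ϖ ^ k • Ideal.Quotient.mk (powIdeal ϖ B l) b := rfl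

theorem exists_eq_pow_smul_of_piComponent (hB : IsSMulRegular B ϖ) {k : ℕ}
    {z : PiCompletion ϖ B} (hz : piComponent k z = 0) : ∃ u, z = ϖ ^ k • u := by
  have hc : ∀ l, ∃ c : B, Ideal.Quotient.mk (powIdeal ϖ B (k + l)) (ϖ ^ k • c) =
      piComponent (k + l) z := fun l => by
    obtain ⟨b, hb⟩ := Ideal.Quotient.mk_surjective (piComponent (k + l) z)
    have h0 : Ideal.Quotient.mk (powIdeal ϖ B k) b = 0 := by
      rw [← hz, ← powProj_piComponent z (Nat.le_add_right k l), ← hb, powProj_mk]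
    obtain ⟨c, rfl⟩ := mem_powIdeal_iff.1 (Ideal.Quotient.eq_zero_iff_mem.1 h0)
    exact ⟨c, hb⟩
  choose c hc using hc
  refine ⟨piMk (fun l => Ideal.Quotient.mk _ (c l)) fun l m h => ?_,
    piComponent_ext fun l => ?_⟩
  · rw [powProj_mk, mk_powIdeal_eq_iff]
    have hmk : Ideal.Quotient.mk (powIdeal ϖ B (k + l)) (ϖ ^ k • c m) =
        Ideal.Quotient.mk (powIdeal ϖ B (k + l)) (ϖ ^ k • c l) := by
      rw [hc l, ← powProj_piComponent z (Nat.add_le_add_left h k), ← hc m, powProj_mk]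
    obtain ⟨d, hd⟩ := mk_powIdeal_eq_iff.1 hmk
    refine ⟨d, hB.pow k ?_⟩
    change ϖ ^ k • c m = ϖ ^ k • (c l + ϖ ^ l • d)
    rw [hd, smul_add, smul_smul, ← pow_add]
  · rw [map_smul, piComponent_piMk, ← mk_pow_smul, ← powProj_piComponent z (Nat.le_add_left l k),
      ← hc l, powProj_mk]

theorem exists_eq_toPiCompletion_add (hB : IsSMulRegular B ϖ) (k : ℕ) (x : PiCompletion ϖ B) :
    ∃ b u, x = toPiCompletion ϖ B b + ϖ ^ k • u := by
  obtain ⟨b, hb⟩ := Ideal.Quotient.mk_surjective (piComponent k x)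
  obtain ⟨u, hu⟩ := exists_eq_pow_smul_of_piComponent hB (k := k)
    (z := x - toPiCompletion ϖ B b) (by rw [map_sub, piComponent_toPiCompletion, hb, sub_self])
  exact ⟨b, u, by rw [← hu, add_sub_cancel]⟩

theorem exists_eq_pow_smul_of_toPiCompletion {k : ℕ} {b : B} {u : PiCompletion ϖ B}
    (h : toPiCompletion ϖ B b = ϖ ^ k • u) : ∃ c : B, b = ϖ ^ k • c := by
  have h' := congrArg (piComponent k) h
  rw [piComponent_pow_smul, piComponent_toPiCompletion, Ideal.Quotient.eq_zero_iff_mem] at h'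
  exact mem_powIdeal_iff.1 h'

theorem isSMulRegular_piCompletion (hB : IsSMulRegular B ϖ) :
    IsSMulRegular (PiCompletion ϖ B) ϖ := by
  refine IsSMulRegular.of_right_eq_zero_of_smul fun u hu => piComponent_ext fun k => ?_
  obtain ⟨b, hb⟩ := Ideal.Quotient.mk_surjective (piComponent (k + 1) u)
  have hϖb : Ideal.Quotient.mk (powIdeal ϖ B (k + 1)) (ϖ • b) = 0 := by
    have := congrArg (piComponent (k + 1)) hu
    rwa [map_smul, ← hb, map_zero] at this
  obtain ⟨c, hc⟩ := mem_powIdeal_iff.1 (Ideal.Quotient.eq_zero_iff_mem.1 hϖb)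
  rw [pow_succ', mul_smul] at hc
  rw [map_zero, ← powProj_piComponent u k.le_succ, ← hb, powProj_mk,
    Ideal.Quotient.eq_zero_iff_mem]
  exact mem_powIdeal_iff.2 ⟨c, hB hc⟩

theorem algebraMap_pow_dvd_iff {B : Type*} [Ring B] [Algebra R B] {k : ℕ} {b : B} :
    algebraMap R B ϖ ^ k ∣ b ↔ ∃ c : B, b = ϖ ^ k • c := by
  simp only [← map_pow, Algebra.smul_def]
  rfl

theorem isCentralComplete_piCompletion (hB : IsSMulRegular B ϖ) :
    IsCentralComplete (algebraMap R (PiCompletion ϖ B) ϖ) where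
  commute x := Algebra.commutes ϖ x
  separated x hx := piComponent_ext fun k => by
    obtain ⟨y, rfl⟩ := algebraMap_pow_dvd_iff.1 (hx k)
    rw [piComponent_pow_smul, map_zero]
  complete c := by
    have compatible : ∀ k l (h : k ≤ l),
        powProj ϖ B h (∑ i ∈ Finset.range l, piComponent l (ϖ ^ i • c i)) =
          ∑ i ∈ Finset.range k, piComponent k (ϖ ^ i • c i) := by
      intro k l h
      rw [map_sum]
      simp only [powProj_piComponent]
      refine (Finset.sum_subset (Finset.range_mono h) fun i _ hi => ?_).symm
      have hki : k ≤ i := by simpa using hi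
      rw [← powProj_piComponent _ hki, piComponent_pow_smul, map_zero]
    refine ⟨piMk _ compatible, fun k => algebraMap_pow_dvd_iff.2 ?_⟩
    refine exists_eq_pow_smul_of_piComponent hB ?_
    simp only [← map_pow, ← Algebra.smul_def]
    rw [map_sub, map_sum, piComponent_piMk, sub_self]

theorem isCompletionAlong_toPiCompletion (hB : IsSMulRegular B ϖ) :
    IsCompletionAlong (toPiCompletion ϖ B : B →+* PiCompletion ϖ B) (algebraMap R B ϖ) := by
  have map_ϖ : (toPiCompletion ϖ B : B →+* PiCompletion ϖ B) (algebraMap R B ϖ) =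
      algebraMap R _ ϖ := (toPiCompletion ϖ B).commutes ϖ
  refine ⟨Algebra.commutes ϖ, ?_, fun u hu => ?_, fun u => ?_, fun b hb => ?_⟩
  · rw [map_ϖ]
    exact isCentralComplete_piCompletion hB
  · rw [map_ϖ, ← Algebra.smul_def] at hu
    exact (isSMulRegular_piCompletion hB).right_eq_zero_of_smul hu
  · obtain ⟨b, u', rfl⟩ := exists_eq_toPiCompletion_add hB 1 u
    exact ⟨b, u', by rw [map_ϖ, ← Algebra.smul_def, pow_one]; rfl⟩
  · rw [map_ϖ, ← pow_one (algebraMap R _ ϖ), algebraMap_pow_dvd_iff] at hb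
    obtain ⟨u, hu⟩ := hb
    rw [← pow_one (algebraMap R B ϖ), algebraMap_pow_dvd_iff]
    exact exists_eq_pow_smul_of_toPiCompletion hu

end PiCompletion

/-! ### Properties of the normed algebras defined by a lattice -/

section SeminormUniformity

variable {K : Type*} {V : Type*} [NormedField K] [AddCommGroup V] [Module K V]

theorem isUniformAddGroup_seminormUniformity (q : Seminorm K V) :
    @IsUniformAddGroup V (seminormUniformity q) _ :=
  q.toAddGroupSeminorm.toSeminormedAddCommGroup.to_isUniformAddGroup

theorem hasBasis_uniformity_seminorm (q : Seminorm K V) :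
    (@uniformity V (seminormUniformity q)).HasBasis (0 < ·)
      fun ε => {x : V × V | q (x.1 - x.2) < ε} := by
  let _ := q.toAddGroupSeminorm.toSeminormedAddCommGroup
  have := Metric.uniformity_basis_dist (α := V)
  simp only [dist_eq_norm] at this
  exact this

theorem hasBasis_nhds_seminorm (q : Seminorm K V) (x : V) :
    (@nhds V (seminormUniformity q).toTopologicalSpace x).HasBasis (0 < ·)
      fun ε => {y : V | q (y - x) < ε} := by
  let _ := q.toAddGroupSeminorm.toSeminormedAddCommGroup
  have h : (fun ε => Metric.ball x ε) = fun ε => {y : V | q (y - x) < ε} := by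
    ext ε y
    rw [Metric.mem_ball, dist_eq_norm]
    rfl
  rw [← h]
  exact Metric.nhds_basis_ball

theorem continuous_seminormUniformity (q : Seminorm K V) :
    @Continuous V ℝ (seminormUniformity q).toTopologicalSpace _ q := by
  let _ := q.toAddGroupSeminorm.toSeminormedAddCommGroup
  exact continuous_norm (E := V)

theorem seminormUniformity_le {q q' : Seminorm K V} {C : ℝ} (hC : 0 < C)
    (h : ∀ x, q x ≤ C * q' x) : seminormUniformity q' ≤ seminormUniformity q := by
  refine ((hasBasis_uniformity_seminorm q').le_basis_iff (hasBasis_uniformity_seminorm q)).2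
    fun ε hε => ⟨ε / C, div_pos hε hC, fun x hx => ?_⟩
  have hlt : q' (x.1 - x.2) < ε / C := hx
  exact (h _).trans_lt (by rwa [lt_div_iff₀' hC] at hlt)

theorem seminormUniformity_comap {W : Type*} [AddCommGroup W] [Module K W] (q : Seminorm K V)
    (q' : Seminorm K W) (f : W →+ V) (h : ∀ x, q' x = q (f x)) :
    seminormUniformity q' = UniformSpace.comap f (seminormUniformity q) := by
  ext1
  refine (hasBasis_uniformity_seminorm q').eq_of_same_basis ?_
  rw [uniformity_comap]
  convert (hasBasis_uniformity_seminorm q).comap (Prod.map f f) using 2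
  ext x
  change q' (x.1 - x.2) < _ ↔ q (f x.1 - f x.2) < _
  rw [h, map_sub]

end SeminormUniformity

section LatticeAlg

variable {R K : Type*} [CommRing R] [NormedField K] [Algebra R K]

theorem norm_algebraMap_le_one [IsUnitBall R K] (r : R) : ‖algebraMap R K r‖ ≤ 1 :=
  (IsUnitBall.norm_le_one_iff _).2 ⟨r, rfl⟩

theorem algebraMap_irreducible_ne_zero [IsFractionRing R K] {ϖ : R}
    (hϖ : Irreducible ϖ) : algebraMap R K ϖ ≠ 0 := by
  rw [Ne, IsFractionRing.to_map_eq_zero_iff]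
  exact hϖ.ne_zero

theorem norm_irreducible_lt_one [IsFractionRing R K] [IsUnitBall R K] {ϖ : R}
    (hϖ : Irreducible ϖ) : ‖algebraMap R K ϖ‖ < 1 := by
  refine (norm_algebraMap_le_one ϖ).lt_of_ne fun h => hϖ.not_isUnit ?_
  obtain ⟨s, hs⟩ := (IsUnitBall.norm_le_one_iff (R := R) (algebraMap R K ϖ)⁻¹).1 (by
    rw [norm_inv, h, inv_one])
  refine .of_mul_eq_one s (IsFractionRing.injective R K ?_)
  rw [map_mul, hs, map_one, mul_inv_cancel₀ (algebraMap_irreducible_ne_zero hϖ)]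

variable {B : Type*} [Ring B] [Algebra R B]

theorem latticeIncl_algebraMap (r : R) :
    latticeIncl R K B (algebraMap R B r) = algebraMap K _ (algebraMap R K r) := by
  rw [Algebra.algebraMap_eq_smul_one, latticeIncl_smul, map_one,
    ← Algebra.algebraMap_eq_smul_one (A := LatticeAlg R K B)]

theorem latticeSeminorm_smul_le [IsUnitBall R K] (c : K) (b : B) :
    latticeSeminorm R K B (c • latticeIncl R K B b) ≤ ‖c‖ :=
  csInf_le (gaugeSet_bddBelow R K B _) ⟨c, b, rfl, rfl⟩

theorem exists_of_latticeSeminorm_lt [IsUnitBall R K] {v : LatticeAlg R K B} {r : ℝ}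
    (h : latticeSeminorm R K B v < r) :
    ∃ (c : K) (b : B), v = c • latticeIncl R K B b ∧ ‖c‖ < r := by
  obtain ⟨_, ⟨c, b, hv, rfl⟩, hc⟩ := exists_lt_of_csInf_lt (gaugeSet_nonempty R K B v) h
  exact ⟨c, b, hv, hc⟩

theorem exists_ne_zero_of_latticeSeminorm_lt [IsFractionRing R K] [IsUnitBall R K] {ϖ : R}
    (hϖ : Irreducible ϖ) {v : LatticeAlg R K B} {r : ℝ}
    (h : latticeSeminorm R K B v < r) :
    ∃ (c : K) (b : B), c ≠ 0 ∧ v = c • latticeIncl R K B b ∧ ‖c‖ < r := by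
  obtain ⟨c, b, rfl, hc⟩ := exists_of_latticeSeminorm_lt h
  obtain rfl | hc₀ := eq_or_ne c 0
  · obtain ⟨k, hk⟩ := exists_pow_lt_of_lt_one ((norm_nonneg _).trans_lt hc)
      (norm_irreducible_lt_one (K := K) hϖ)
    refine ⟨algebraMap R K ϖ ^ k, 0, pow_ne_zero k (algebraMap_irreducible_ne_zero hϖ), ?_, ?_⟩
    · rw [zero_smul, map_zero, smul_zero]
    · rwa [norm_pow]
  · exact ⟨c, b, hc₀, rfl, hc⟩

theorem exists_of_latticeSeminorm_lt_norm [IsUnitBall R K] {v : LatticeAlg R K B} {d : K}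
    (h : latticeSeminorm R K B v < ‖d‖) : ∃ b : B, v = d • latticeIncl R K B b := by
  obtain ⟨c, b, rfl, hc⟩ := exists_of_latticeSeminorm_lt h
  obtain ⟨b', hb'⟩ := exists_common R K B d c 0 b hc.le
  exact ⟨b', by rw [← hb', map_zero, smul_zero, zero_add]⟩

theorem latticeSeminorm_add_le [IsUnitBall R K] (v w : LatticeAlg R K B) :
    latticeSeminorm R K B (v + w) ≤ max (latticeSeminorm R K B v) (latticeSeminorm R K B w) := by
  refine le_of_forall_gt fun r hr => ?_
  obtain ⟨s, hs, hs'⟩ := exists_lt_of_csInf_lt (gaugeSet_nonempty R K B v) (max_lt_iff.1 hr).1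
  obtain ⟨t, ht, ht'⟩ := exists_lt_of_csInf_lt (gaugeSet_nonempty R K B w) (max_lt_iff.1 hr).2
  exact (csInf_le (gaugeSet_bddBelow R K B _)
    (exists_add_mem_gaugeSet R K B hs ht)).trans_lt (max_lt hs' ht')

theorem latticeSeminorm_mul_le [IsUnitBall R K] (v w : LatticeAlg R K B) :
    latticeSeminorm R K B (v * w) ≤ latticeSeminorm R K B v * latticeSeminorm R K B w := by
  refine le_mul_of_forall_lt₀ fun r hr s hs => ?_
  obtain ⟨c, b, rfl, hc⟩ := exists_of_latticeSeminorm_lt hr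
  obtain ⟨d, b', rfl, hd⟩ := exists_of_latticeSeminorm_lt hs
  rw [smul_mul_smul_comm, ← map_mul]
  refine (latticeSeminorm_smul_le _ _).trans ?_
  rw [norm_mul]
  exact mul_le_mul hc.le hd.le (norm_nonneg d) ((norm_nonneg c).trans hc.le)

variable (R K B) in
/-- The gauge seminorm of a lattice, as a submultiplicative nonarchimedean seminorm. -/
def latticeAlgSeminorm [IsUnitBall R K] : AlgSeminorm K (LatticeAlg R K B) where
  toSeminorm := latticeSeminorm R K B
  add_le_max' := latticeSeminorm_add_le
  mul_le' := latticeSeminorm_mul_le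

theorem latticeSeminorm_latticeMap_le [IsUnitBall R K] {C : Type*} [Ring C] [Algebra R C]
    (f : B →ₐ[R] C) (v : LatticeAlg R K B) :
    latticeSeminorm R K C (latticeMap R K f v) ≤ latticeSeminorm R K B v := by
  refine le_of_forall_gt fun r hr => ?_
  obtain ⟨c, b, rfl, hc⟩ := exists_of_latticeSeminorm_lt hr
  rw [map_smul, latticeMap_latticeIncl]
  exact (latticeSeminorm_smul_le _ _).trans_lt hc

theorem exists_pow_smul_eq_latticeIncl [IsFractionRing R K] [IsUnitBall R K] {ϖ : R}
    (hϖ : Irreducible ϖ) (v : LatticeAlg R K B) :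
    ∃ (k : ℕ) (b : B), algebraMap R K ϖ ^ k • v = latticeIncl R K B b := by
  obtain ⟨_, c, b, rfl, -⟩ := gaugeSet_nonempty R K B v
  have hlim := (tendsto_pow_atTop_nhds_zero_of_lt_one (norm_nonneg _)
    (norm_irreducible_lt_one (K := K) hϖ)).mul_const ‖c‖
  rw [zero_mul] at hlim
  obtain ⟨k, hk⟩ := (hlim.eventually (gt_mem_nhds one_pos)).exists
  obtain ⟨r, hr⟩ := (IsUnitBall.norm_le_one_iff (R := R) (algebraMap R K ϖ ^ k * c)).1 (by
    rw [norm_mul, norm_pow]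
    exact hk.le)
  exact ⟨k, r • b, by rw [latticeIncl_smul, hr, smul_smul]⟩

theorem latticeIncl_injective [IsDomain R] [IsDiscreteValuationRing R] [IsFractionRing R K] {ϖ : R}
    (hϖ : Irreducible ϖ) (hB : IsSMulRegular B ϖ) :
    Function.Injective (latticeIncl R K B) := by
  rw [injective_iff_map_eq_zero]
  intro b hb
  have hb' : TensorProduct.mk R K B 1 b = 0 := hb
  obtain ⟨s, hs⟩ := (IsLocalizedModule.eq_zero_iff (nonZeroDivisors R)
    (TensorProduct.mk R K B 1)).1 hb'
  obtain ⟨n, u, hu⟩ := IsDiscreteValuationRing.eq_unit_mul_pow_irreducible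
    (nonZeroDivisors.ne_zero s.2) hϖ
  rw [Submonoid.smul_def, hu, mul_smul] at hs
  exact (hB.pow n).right_eq_zero_of_smul (u.isUnit.smul_eq_zero.1 hs)

instance [IsUnitBall R K] : IsUniformAddGroup (LatticeAlg R K B) :=
  isUniformAddGroup_seminormUniformity _

instance [IsUnitBall R K] : IsTopologicalRing (LatticeAlg R K B) := by
  let _ : SeminormedRing (LatticeAlg R K B) :=
    { (latticeSeminorm R K B).toAddGroupSeminorm.toSeminormedAddCommGroup,
      (inferInstance : Ring (LatticeAlg R K B)) with
      norm_mul_le := latticeSeminorm_mul_le }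
  exact (inferInstance : IsTopologicalRing (LatticeAlg R K B))

theorem continuous_latticeMap [IsUnitBall R K] {C : Type*} [Ring C] [Algebra R C]
    (f : B →ₐ[R] C) : Continuous (latticeMap R K f) := by
  refine continuous_of_continuousAt_zero (latticeMap R K f) ?_
  rw [ContinuousAt, map_zero]
  refine ((hasBasis_nhds_seminorm _ _).tendsto_iff (hasBasis_nhds_seminorm _ _)).2
    fun ε hε => ⟨ε, hε, fun x hx => ?_⟩
  simp only [sub_zero, Set.mem_ofPred_eq] at hx ⊢
  exact (latticeSeminorm_latticeMap_le f x).trans_lt hx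

variable [IsFractionRing R K] [IsUnitBall R K] {ϖ : R}

theorem eq_zero_of_latticeSeminorm_eq_zero [IsDomain R] [IsDiscreteValuationRing R]
    (hϖ : Irreducible ϖ) (hcomplete : IsCentralComplete (algebraMap R B ϖ)) (hB : IsSMulRegular B ϖ)
    {v : LatticeAlg R K B} (hv : latticeSeminorm R K B v = 0) : v = 0 := by
  have hne : algebraMap R K ϖ ≠ 0 := algebraMap_irreducible_ne_zero hϖ
  obtain ⟨k, b, hb⟩ := exists_pow_smul_eq_latticeIncl hϖ v
  have hb0 : b = 0 := hcomplete.separated b fun m => by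
    have hlt : latticeSeminorm R K B (latticeIncl R K B b) < ‖algebraMap R K ϖ ^ m‖ := by
      rw [← hb, map_smul_eq_mul, hv, mul_zero]
      exact norm_pos_iff.2 (pow_ne_zero m hne)
    obtain ⟨c, hc⟩ := exists_of_latticeSeminorm_lt_norm hlt
    refine algebraMap_pow_dvd_iff.2 ⟨c, latticeIncl_injective (K := K) hϖ hB ?_⟩
    rw [hc, latticeIncl_smul, map_pow]
  rw [hb0, map_zero] at hb
  exact (smul_eq_zero.1 hb).resolve_left (pow_ne_zero _ hne)

theorem t2Space_latticeAlg [IsDomain R] [IsDiscreteValuationRing R] (hϖ : Irreducible ϖ)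
    (hcomplete : IsCentralComplete (algebraMap R B ϖ)) (hB : IsSMulRegular B ϖ) :
    T2Space (LatticeAlg R K B) := by
  have : T0Space (LatticeAlg R K B) := by
    let _ := (latticeSeminorm R K B).toAddGroupSeminorm.toSeminormedAddCommGroup
    refine (t0Space_iff_inseparable _).2 fun x y h => ?_
    have hdist : dist x y = 0 := Metric.inseparable_iff.1 h
    rw [dist_eq_norm] at hdist
    exact sub_eq_zero.1 (eq_zero_of_latticeSeminorm_eq_zero hϖ hcomplete hB hdist)
  infer_instance

theorem completeSpace_latticeAlg (hϖ : Irreducible ϖ)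
    (hcomplete : IsCentralComplete (algebraMap R B ϖ)) : CompleteSpace (LatticeAlg R K B) := by
  have hpos := norm_pos_iff.2 (algebraMap_irreducible_ne_zero (K := K) hϖ)
  let _ := (latticeSeminorm R K B).toAddGroupSeminorm.toSeminormedAddCommGroup
  refine Metric.complete_of_convergent_controlled_sequences (α := LatticeAlg R K B)
    (fun n => ‖algebraMap R K ϖ ^ n‖) (fun n => by rw [norm_pow]; exact pow_pos hpos n) ?_
  intro s hs
  have hdiff (n : ℕ) : ∃ c : B, s (n + 1) - s n = algebraMap R K ϖ ^ n • latticeIncl R K B c := by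
    have hlt := hs n (n + 1) n n.le_succ le_rfl
    rw [dist_eq_norm] at hlt
    exact exists_of_latticeSeminorm_lt_norm hlt
  choose c hc using hdiff
  obtain ⟨w, hw⟩ := hcomplete.complete c
  have hsum (n : ℕ) : s n = s 0 + latticeIncl R K B (∑ i ∈ Finset.range n,
      algebraMap R B ϖ ^ i * c i) := by
    induction n with
    | zero => simp
    | succ n ih =>
      rw [Finset.sum_range_succ, map_add, ← add_assoc, ← ih, ← map_pow, ← Algebra.smul_def,
        latticeIncl_smul, map_pow, ← hc n, add_sub_cancel]
  refine ⟨s 0 + latticeIncl R K B w, ?_⟩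
  rw [tendsto_iff_dist_tendsto_zero]
  refine squeeze_zero (fun _ => dist_nonneg) (fun n => ?_)
    (tendsto_pow_atTop_nhds_zero_of_lt_one (norm_nonneg _) (norm_irreducible_lt_one (K := K) hϖ))
  obtain ⟨y, hy⟩ := algebraMap_pow_dvd_iff.1 (hw n)
  rw [dist_comm, dist_eq_norm, hsum n, add_sub_add_left_eq_sub, ← map_sub, hy, latticeIncl_smul,
    ← norm_pow, map_pow]
  exact latticeSeminorm_smul_le _ _

theorem isCentralLocalization_latticeIncl [IsDomain R] [IsDiscreteValuationRing R]
    (hϖ : Irreducible ϖ) (hB : IsSMulRegular B ϖ) :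
    IsCentralLocalization (latticeIncl R K B) (algebraMap R B ϖ) where
  injective := latticeIncl_injective hϖ hB
  isUnit := by
    rw [latticeIncl_algebraMap]
    exact (isUnit_iff_ne_zero.2 (algebraMap_irreducible_ne_zero hϖ)).map _
  commute v := by
    rw [latticeIncl_algebraMap]
    exact Algebra.commutes _ v
  exists_pow_mul_eq v := by
    obtain ⟨k, b, hb⟩ := exists_pow_smul_eq_latticeIncl hϖ v
    exact ⟨k, b, by rw [latticeIncl_algebraMap, ← map_pow, ← Algebra.smul_def, hb]⟩

theorem exists_eq_latticeMap_toPiCompletion_add (hϖ : Irreducible ϖ) (hB : IsSMulRegular B ϖ)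
    (k : ℕ) (v : LatticeAlg R K (PiCompletion ϖ B)) :
    ∃ z u, v = latticeMap R K (toPiCompletion ϖ B) z +
      algebraMap R K ϖ ^ k • latticeIncl R K _ u := by
  obtain ⟨m, x, hx⟩ := exists_pow_smul_eq_latticeIncl hϖ v
  obtain ⟨b, u, rfl⟩ := exists_eq_toPiCompletion_add hB (m + k) x
  have hne : algebraMap R K ϖ ^ m ≠ 0 := pow_ne_zero m (algebraMap_irreducible_ne_zero hϖ)
  refine ⟨(algebraMap R K ϖ ^ m)⁻¹ • latticeIncl R K B b, u, smul_right_injective _ hne ?_⟩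
  change _ • v = _ • _
  rw [hx, map_smul, latticeMap_latticeIncl, smul_add, smul_inv_smul₀ hne, smul_smul, ← pow_add,
    map_add, latticeIncl_smul, map_pow]

theorem exists_eq_latticeIncl_of_latticeMap_toPiCompletion [IsDomain R]
    [IsDiscreteValuationRing R] (hϖ : Irreducible ϖ) (hB : IsSMulRegular B ϖ)
    {z : LatticeAlg R K B} {u : PiCompletion ϖ B}
    (h : latticeMap R K (toPiCompletion ϖ B) z = latticeIncl R K _ u) :
    ∃ b, z = latticeIncl R K B b := by
  obtain ⟨k, b, hb⟩ := exists_pow_smul_eq_latticeIncl hϖ z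
  have hbu : toPiCompletion ϖ B b = ϖ ^ k • u := by
    apply latticeIncl_injective (K := K) hϖ (isSMulRegular_piCompletion hB)
    rw [latticeIncl_smul, ← h, ← latticeMap_latticeIncl, ← hb, map_smul, map_pow]
  obtain ⟨c, rfl⟩ := exists_eq_pow_smul_of_toPiCompletion hbu
  refine ⟨c, smul_right_injective _ (pow_ne_zero k (algebraMap_irreducible_ne_zero (K := K) hϖ)) ?_⟩
  change _ • z = _ • _
  rw [hb, latticeIncl_smul, map_pow]

end LatticeAlg

/-! ### Homomorphisms of localizations that preserve lattices up to completion -/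

section ComapRange

variable {S T U : Type*} [Ring S] [Ring T] [Ring U] (f : S →+* T) {i : U →+* T}

/-- The homomorphism `f ⁻¹ (i U) → U` induced by `f : S →+* T`, for an injective homomorphism
`i : U →+* T`. -/
def comapRangeHom (hi : Function.Injective i) : i.range.comap f →+* U :=
  ((RingEquiv.ofBijective i.rangeRestrict
    ⟨fun _ _ h => hi (congrArg Subtype.val h), i.rangeRestrict_surjective⟩).symm :
      i.range →+* U).comp (f.restrict (i.range.comap f) i.range fun _ h => h)

variable {f}

theorem map_comapRangeHom (hi : Function.Injective i) (x : i.range.comap f) :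
    i (comapRangeHom f hi x) = f x :=
  congrArg Subtype.val (RingEquiv.apply_symm_apply (RingEquiv.ofBijective i.rangeRestrict
    ⟨fun _ _ h => hi (congrArg Subtype.val h), i.rangeRestrict_surjective⟩) _)

namespace IsCentralLocalization

variable {q : U} {p : S}

theorem subtype_comap_range (hi : IsCentralLocalization i q) (hp : IsUnit p)
    (hcomm : ∀ x, Commute p x) (hpq : i q = f p) :
    IsCentralLocalization (i.range.comap f).subtype ⟨p, q, hpq⟩ where
  injective := Subtype.val_injective
  isUnit := hp
  commute := hcomm
  exists_pow_mul_eq x := by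
    obtain ⟨k, y, hy⟩ := hi.exists_pow_mul_eq (f x)
    exact ⟨k, ⟨p ^ k * x, y, by rw [← hy, hpq, map_mul, map_pow]⟩, rfl⟩

theorem comapRangeHom_mk (hi : IsCentralLocalization i q) (hpq : i q = f p) :
    comapRangeHom f hi.injective ⟨p, q, hpq⟩ = q :=
  hi.injective ((map_comapRangeHom hi.injective _).trans hpq.symm)

theorem isCompletionAlong_comapRangeHom (hi : IsCentralLocalization i q) (hp : IsUnit p)
    (hcomm : ∀ x, Commute p x) (hpq : i q = f p) (hq : IsCentralComplete q)
    (happ : ∀ u, ∃ s u', i u = f s + i (q * u')) :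
    IsCompletionAlong (comapRangeHom f hi.injective) ⟨p, q, hpq⟩ := by
  have hmk := hi.comapRangeHom_mk hpq
  refine ⟨fun x => Subtype.ext (hcomm x), by rwa [hmk], fun u hu => hi.injective ?_,
    fun u => ?_, ?_⟩
  · rw [map_zero, ← hi.isUnit.mul_right_eq_zero, ← map_mul, ← hmk, hu, map_zero]
  · obtain ⟨s, u', hu⟩ := happ u
    have hs : i (u - q * u') = f s := by rw [map_sub, hu, add_sub_cancel_right]
    exact ⟨⟨s, _, hs⟩, u', hi.injective (by rw [hmk, map_add, map_comapRangeHom, hu])⟩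
  · rintro t ⟨u, hu⟩
    rw [hmk] at hu
    have hft : f t = f p * i u := by
      rw [← map_comapRangeHom hi.injective t, hu, map_mul, hpq]
    have hinv : f (Ring.inverse p * t) = i u := by
      rw [map_mul, hft, ← mul_assoc, ← map_mul, Ring.inverse_mul_cancel _ hp, map_one, one_mul]
    exact ⟨⟨Ring.inverse p * t, u, hinv.symm⟩,
      Subtype.ext (Ring.mul_inverse_cancel_left _ _ hp).symm⟩

/-- The lattice `f ⁻¹ (i U)` of `S` splits `f` into a completion and a localization. -/
theorem isEquationallyFlat_of_comap_range [IsNoetherianRing (i.range.comap f)]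
    [IsNoetherianRing (i.range.comap f)ᵐᵒᵖ] (hi : IsCentralLocalization i q) (hp : IsUnit p)
    (hcomm : ∀ x, Commute p x) (hpq : i q = f p) (hq : IsCentralComplete q)
    (happ : ∀ u, ∃ s u', i u = f s + i (q * u')) :
    IsEquationallyFlat f ∧ IsEquationallyFlat (RingHom.op f) := by
  have hcompletion := hi.isCompletionAlong_comapRangeHom hp hcomm hpq hq happ
  have hlocalization := hi.subtype_comap_range hp hcomm hpq
  have hi' : IsCentralLocalization i (comapRangeHom f hi.injective ⟨p, q, hpq⟩) := by
    rwa [hi.comapRangeHom_mk hpq]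
  exact ⟨isEquationallyFlat hcompletion.isEquationallyFlat hlocalization hi'
      (map_comapRangeHom hi.injective),
    isEquationallyFlat hcompletion.op.isEquationallyFlat hlocalization.op hi'.op
      fun x => congrArg MulOpposite.op (map_comapRangeHom hi.injective x.unop)⟩

end IsCentralLocalization

end ComapRange

/-! ### Filtered algebras with commutative associated graded ring -/

theorem prod_map_X_toMultiset {σ S : Type*} [CommSemiring S] (α : σ →₀ ℕ) :
    ((Finsupp.toMultiset α).map MvPolynomial.X).prod = MvPolynomial.monomial α (1 : S) := by
  induction α using Finsupp.induction_linear with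
  | zero => simp
  | add α β hα hβ =>
    rw [map_add, Multiset.map_add, Multiset.prod_add, hα, hβ, MvPolynomial.monomial_mul, one_mul]
  | single j n =>
    rw [Finsupp.toMultiset_single, Multiset.map_nsmul, Multiset.prod_nsmul, Multiset.map_singleton,
      Multiset.prod_singleton, MvPolynomial.X_pow_eq_monomial]

namespace AlgFiltration

section Generators

variable {R A : Type*} [CommRing R] [Ring A] [Algebra R A] (𝓕 : AlgFiltration R A)

/-- The symbol of degree `i` of an element of `F i`, in the associated graded ring. -/
def grSymb (i : ℕ) (x : A) (hx : x ∈ 𝓕.F i) : 𝓕.gr :=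
  DirectSum.of 𝓕.grPiece i (𝓕.symb i ⟨x, hx⟩)

variable {𝓕} {r : ℕ} {Y : Fin r → A}

theorem grSymb_eq_iff {i : ℕ} {x y : A} {hx : x ∈ 𝓕.F i} {hy : y ∈ 𝓕.F i} :
    𝓕.grSymb i x hx = 𝓕.grSymb i y hy ↔ x - y ∈ 𝓕.lower i :=
  (DirectSum.of_injective i).eq_iff.trans 𝓕.symb_eq_iff

theorem grSymb_congr {i j : ℕ} (h : i = j) {x : A} (hx : x ∈ 𝓕.F i) (hx' : x ∈ 𝓕.F j) :
    𝓕.grSymb i x hx = 𝓕.grSymb j x hx' := by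
  subst h
  rfl

theorem grSymb_mul {i j : ℕ} {x y : A} (hx : x ∈ 𝓕.F i) (hy : y ∈ 𝓕.F j) :
    𝓕.grSymb i x hx * 𝓕.grSymb j y hy = 𝓕.grSymb (i + j) (x * y) (𝓕.mul_mem hx hy) :=
  DirectSum.of_mul_of _ _

theorem grSymb_add {i : ℕ} {x y : A} (hx : x ∈ 𝓕.F i) (hy : y ∈ 𝓕.F i) :
    𝓕.grSymb i x hx + 𝓕.grSymb i y hy = 𝓕.grSymb i (x + y) (add_mem hx hy) := by
  rw [grSymb, grSymb, ← map_add, ← map_add]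
  rfl

theorem grSymb_zero (i : ℕ) : 𝓕.grSymb i 0 (zero_mem _) = 0 := by
  rw [grSymb, show (⟨0, zero_mem _⟩ : 𝓕.F i) = 0 from rfl, map_zero, map_zero]

theorem commutator_mem_lower (hcomm : ∀ x y : 𝓕.gr, x * y = y * x) {i j : ℕ} {x y : A}
    (hx : x ∈ 𝓕.F i) (hy : y ∈ 𝓕.F j) : x * y - y * x ∈ 𝓕.lower (i + j) := by
  have hyx : y * x ∈ 𝓕.F (i + j) := Nat.add_comm j i ▸ 𝓕.mul_mem hy hx
  have hsymb := hcomm (𝓕.grSymb i x hx) (𝓕.grSymb j y hy)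
  rw [grSymb_mul, grSymb_mul, grSymb_congr (Nat.add_comm j i) _ hyx] at hsymb
  exact grSymb_eq_iff.1 hsymb

theorem prod_map_mem (hY : ∀ j, Y j ∈ 𝓕.F 1) (l : List (Fin r)) :
    (l.map Y).prod ∈ 𝓕.F l.length := by
  induction l with
  | nil => exact 𝓕.one_mem
  | cons j l ih =>
    rw [List.map_cons, List.prod_cons, List.length_cons, Nat.add_comm]
    exact 𝓕.mul_mem (hY j) ih

theorem grSymb_prod_map (hY : ∀ j, Y j ∈ 𝓕.F 1) (l : List (Fin r)) :
    𝓕.grSymb l.length (l.map Y).prod (prod_map_mem hY l) =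
      (l.map fun j => 𝓕.grSymb 1 (Y j) (hY j)).prod := by
  induction l with
  | nil => rfl
  | cons j l ih =>
    refine (grSymb_congr (Nat.add_comm _ _) _ (𝓕.mul_mem (hY j) (prod_map_mem hY l))).trans ?_
    rw [← grSymb_mul (hY j) (prod_map_mem hY l), ih, List.map_cons, List.prod_cons]

variable (𝓕 Y) in
/-- The elements `Y j` of `F 1` generate the algebra over `F 0`, compatibly with the filtration:
the elements of `F i` are left combinations of words of length at most `i`. -/
structure Generates : Prop where
  mem : ∀ j, Y j ∈ 𝓕.F 1
  le_wordSpan : ∀ i, (𝓕.F i).toAddSubgroup ≤ wordSpan (𝓕.zeroPart.val : 𝓕.zeroPart →+* A) Y i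

theorem generates_of_exists_sub_mem_lower (hY : ∀ j, Y j ∈ 𝓕.F 1)
    (h : ∀ i, ∀ x ∈ 𝓕.F i, ∃ x' ∈ wordSpan (𝓕.zeroPart.val : 𝓕.zeroPart →+* A) Y i,
      x' - x ∈ 𝓕.lower i) : 𝓕.Generates Y where
  mem := hY
  le_wordSpan i := by
    induction i with
    | zero =>
      intro x hx
      obtain ⟨x', hx', hlower⟩ := h 0 x hx
      rwa [← sub_eq_zero.1 ((Submodule.mem_bot R).1 hlower)]
    | succ i ih =>
      intro x hx
      obtain ⟨x', hx', hlower⟩ := h (i + 1) x hx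
      rw [← sub_sub_cancel x' x]
      exact sub_mem hx' (wordSpan_mono i.le_succ (ih hlower))

section Polynomial

variable {S : Type*} [CommSemiring S] {e : 𝓕.gr ≃+* MvPolynomial (Fin r) S}

theorem exists_grSymb_eq
    (he : ∀ i x, (∃ y, x = DirectSum.of 𝓕.grPiece i y) ↔ (e x).IsHomogeneous i) {i : ℕ}
    {P : MvPolynomial (Fin r) S} (hP : P.IsHomogeneous i) :
    ∃ (x : A) (hx : x ∈ 𝓕.F i), e (𝓕.grSymb i x hx) = P := by
  obtain ⟨y, hy⟩ := (he i (e.symm P)).2 (by rwa [e.apply_symm_apply])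
  obtain ⟨x, rfl⟩ := 𝓕.symb_surjective i y
  exact ⟨x, x.2, by rw [← e.apply_symm_apply P, hy]; rfl⟩

theorem exists_mem_wordSpan_grSymb_eq
    (he : ∀ i x, (∃ y, x = DirectSum.of 𝓕.grPiece i y) ↔ (e x).IsHomogeneous i)
    (hY : ∀ j, Y j ∈ 𝓕.F 1) (hYX : ∀ j, e (𝓕.grSymb 1 (Y j) (hY j)) = MvPolynomial.X j) {i : ℕ}
    {P : MvPolynomial (Fin r) S} (hP : P.IsHomogeneous i) :
    ∃ (x : A) (hx : x ∈ 𝓕.F i),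
      x ∈ wordSpan (𝓕.zeroPart.val : 𝓕.zeroPart →+* A) Y i ∧ e (𝓕.grSymb i x hx) = P := by
  rw [P.as_sum]
  refine Finset.sum_induction _ (fun P => ∃ (x : A) (hx : x ∈ 𝓕.F i),
    x ∈ wordSpan (𝓕.zeroPart.val : 𝓕.zeroPart →+* A) Y i ∧ e (𝓕.grSymb i x hx) = P) ?_ ?_ ?_
  · rintro _ _ ⟨x, hx, hxw, rfl⟩ ⟨y, hy, hyw, rfl⟩
    exact ⟨x + y, add_mem hx hy, add_mem hxw hyw, by rw [← map_add, grSymb_add]⟩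
  · exact ⟨0, zero_mem _, zero_mem _, by rw [grSymb_zero, map_zero]⟩
  · intro α hα
    obtain ⟨d, hd, hdC⟩ := exists_grSymb_eq he (MvPolynomial.isHomogeneous_C _ (P.coeff α))
    let l := (Finsupp.toMultiset α).toList
    have hl : l.length = i := by
      rw [length_toList_toMultiset, Finsupp.degree_eq_weight_one]
      exact hP (MvPolynomial.mem_support_iff.1 hα)
    have hword : (l.map MvPolynomial.X).prod = MvPolynomial.monomial α (1 : S) := by
      rw [← prod_map_X_toMultiset, ← Multiset.prod_coe, ← Multiset.map_coe, Multiset.coe_toList]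
    have hmem := 𝓕.mul_mem hd (prod_map_mem hY l)
    have hi : 0 + l.length = i := by rw [hl, zero_add]
    refine ⟨d * (l.map Y).prod, hi ▸ hmem,
      base_mul_word_mem_wordSpan (⟨d, hd⟩ : 𝓕.zeroPart) hl.le, ?_⟩
    rw [← grSymb_congr hi hmem, ← grSymb_mul hd (prod_map_mem hY l), grSymb_prod_map hY, map_mul,
      hdC, map_list_prod, List.map_map]
    simp only [Function.comp_def, hYX]
    rw [hword, MvPolynomial.C_mul_monomial, mul_one]

end Polynomial

variable (𝓕) in
/-- An almost commutative filtration: `F 0` is noetherian and `gr A` is commutative and generated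
over `F 0` by finitely many elements of degree one, represented here by lifts to `F 1`. -/
structure IsAlmostCommutative : Prop where
  zero_noetherian : IsNoetherianRing 𝓕.zeroPart
  gr_comm : ∀ x y : 𝓕.gr, x * y = y * x
  exists_generators : ∃ (r : ℕ) (Y : Fin r → A), 𝓕.Generates Y

theorem IsAdmissible.isAlmostCommutative {ϖ : R} (h : 𝓕.IsAdmissible ϖ) :
    𝓕.IsAlmostCommutative where
  zero_noetherian := h.zero_noetherian
  gr_comm := h.gr_comm
  exists_generators := by
    let _ := 𝓕.zeroPartCommRing h.zero_comm
    obtain ⟨r, e, he⟩ := h.gr_polynomial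
    choose Y hY hYX using fun j => exists_grSymb_eq he (MvPolynomial.isHomogeneous_X _ j)
    refine ⟨r, Y, generates_of_exists_sub_mem_lower hY fun i x hx => ?_⟩
    obtain ⟨x', hx', hw, hxe⟩ :=
      exists_mem_wordSpan_grSymb_eq he hY hYX ((he i (𝓕.grSymb i x hx)).1 ⟨_, rfl⟩)
    exact ⟨x', hw, grSymb_eq_iff.1 (e.injective hxe)⟩

namespace IsAlmostCommutative

theorem zero_comm (h : 𝓕.IsAlmostCommutative) (x y : 𝓕.zeroPart) : x * y = y * x :=
  Subtype.ext <| sub_eq_zero.1 <| (Submodule.mem_bot R).1 <| commutator_mem_lower h.gr_comm x.2 y.2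

theorem isNoetherianRing_op_zeroPart (h : 𝓕.IsAlmostCommutative) :
    IsNoetherianRing 𝓕.zeroPartᵐᵒᵖ := by
  let _ := 𝓕.zeroPartCommRing h.zero_comm
  have := h.zero_noetherian
  exact isNoetherianRing_of_ringEquiv _ (RingEquiv.toOpposite 𝓕.zeroPart)

end IsAlmostCommutative

end Generators

end AlgFiltration

section WordsOfLengthOne

theorem exists_of_mem_wordSpan_one {C B : Type*} [Ring C] [Ring B] {φ : C →+* B} {r : ℕ}
    {y : Fin r → B} {x : B} (hx : x ∈ wordSpan φ y 1) :
    ∃ (c₀ : C) (c : Fin r → C), x = φ c₀ + ∑ k, φ (c k) * y k := by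
  induction hx using AddSubgroup.closure_induction with
  | mem x hx =>
    obtain ⟨c, -, _, ⟨l, hl, rfl⟩, rfl⟩ := hx
    rcases l with _ | ⟨j, _ | ⟨i, l⟩⟩
    · exact ⟨c, 0, by simp⟩
    · exact ⟨0, Pi.single j c, by simp [Pi.single_apply, apply_ite φ]⟩
    · simp at hl
  | zero => exact ⟨0, 0, by simp⟩
  | add x x' _ _ hx hx' =>
    obtain ⟨c₀, c, rfl⟩ := hx
    obtain ⟨d₀, d, rfl⟩ := hx'
    refine ⟨c₀ + d₀, c + d, ?_⟩
    simp only [map_add, Pi.add_apply, add_mul, Finset.sum_add_distrib]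
    abel
  | neg x _ hx =>
    obtain ⟨c₀, c, rfl⟩ := hx
    refine ⟨-c₀, -c, ?_⟩
    simp only [map_neg, Pi.neg_apply, neg_mul, Finset.sum_neg_distrib, neg_add]

theorem prod_map_smul {R A ι : Type*} [CommSemiring R] [Semiring A] [Algebra R A] (c : R)
    (Y : ι → A) (l : List ι) : (l.map fun j => c • Y j).prod = c ^ l.length • (l.map Y).prod := by
  induction l with
  | nil => simp
  | cons j l ih =>
    rw [List.map_cons, List.prod_cons, ih, List.map_cons, List.prod_cons, smul_mul_smul_comm,
      List.length_cons, pow_succ']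

end WordsOfLengthOne

namespace AlgFiltration

section Deform

variable {R A : Type*} [CommRing R] [Ring A] [Algebra R A] {𝓕 : AlgFiltration R A} {ϖ : R}
  {r : ℕ} {Y : Fin r → A}

theorem deform_le {n : ℕ} {P : AddSubgroup A} (hP : ∀ i, ∀ a ∈ 𝓕.F i, ϖ ^ (n * i) • a ∈ P) :
    (𝓕.deform ϖ n).toSubring.toAddSubgroup ≤ P := by
  rintro _ ⟨p, hp, rfl⟩
  change Polynomial.eval₂ _ _ p ∈ P
  rw [Polynomial.eval₂_eq_sum, Polynomial.sum]
  refine sum_mem fun i _ => ?_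
  rw [← map_pow, ← pow_mul, ← Algebra.commutes, ← Algebra.smul_def]
  exact hP i _ (hp i)

theorem zeroPart_le_deform (𝓕 : AlgFiltration R A) (ϖ : R) (n : ℕ) :
    𝓕.zeroPart ≤ 𝓕.deform ϖ n := fun a ha => by
  simpa using 𝓕.pow_smul_mem_deform ϖ n (i := 0) ha

variable (𝓕 ϖ) in
/-- The inclusion `F 0 → A_n`. -/
def deformBase (n : ℕ) : 𝓕.zeroPart →+* 𝓕.deform ϖ n :=
  Subalgebra.inclusion (𝓕.zeroPart_le_deform ϖ n)

namespace Generates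

/-- The generators `ϖ ^ n • Y j` of `A_n` over `F 0`. -/
def deformGen (h : 𝓕.Generates Y) (ϖ : R) (n : ℕ) (j : Fin r) : 𝓕.deform ϖ n :=
  ⟨ϖ ^ n • Y j, by simpa using 𝓕.pow_smul_mem_deform ϖ n (h.mem j)⟩

theorem deform_le_subring (h : 𝓕.Generates Y) {n : ℕ} {P : Subring A}
    (hbase : ∀ c ∈ 𝓕.F 0, c ∈ P) (hgen : ∀ j, ϖ ^ n • Y j ∈ P) :
    (𝓕.deform ϖ n).toSubring ≤ P := by
  refine deform_le (P := P.toAddSubgroup) fun i a ha => ?_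
  suffices hle : wordSpan (𝓕.zeroPart.val : 𝓕.zeroPart →+* A) Y i ≤
      P.toAddSubgroup.comap (DistribSMul.toAddMonoidHom A (ϖ ^ (n * i))) from
    hle (h.le_wordSpan i ha)
  refine wordSpan_le.2 fun c l hl => ?_
  have hword : (l.map fun j => ϖ ^ n • Y j).prod ∈ P :=
    list_prod_mem (List.forall_mem_map.2 fun j _ => hgen j)
  have hmem := P.mul_mem (hbase _ ((𝓕.F 0).smul_mem (ϖ ^ (n * (i - l.length))) c.2)) hword
  rwa [prod_map_smul, smul_mul_smul_comm, ← pow_mul, ← pow_add, ← Nat.mul_add,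
    Nat.sub_add_cancel hl] at hmem

theorem isAlmostPolynomial_deform (h : 𝓕.Generates Y) (hcomm : ∀ x y : 𝓕.gr, x * y = y * x)
    (ϖ : R) (n : ℕ) : IsAlmostPolynomial (𝓕.deformBase ϖ n) (h.deformGen ϖ n) where
  comm_base j c := by
    have hmem : Y j * c - c * Y j ∈ 𝓕.F 0 := commutator_mem_lower hcomm (h.mem j) (j := 0) c.2
    refine ⟨⟨ϖ ^ n • (Y j * c - c * Y j), (𝓕.F 0).smul_mem _ hmem⟩, Subtype.ext ?_⟩
    change ϖ ^ n • Y j * (c : A) = c * ϖ ^ n • Y j + ϖ ^ n • (Y j * c - c * Y j)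
    rw [smul_mul_assoc, mul_smul_comm, ← smul_add, add_sub_cancel]
  comm_gen i j := by
    have hmem : Y i * Y j - Y j * Y i ∈ 𝓕.F 1 := commutator_mem_lower hcomm (h.mem i) (h.mem j)
    obtain ⟨c₀, c, hc⟩ := exists_of_mem_wordSpan_one (h.le_wordSpan 1 hmem)
    refine ⟨(ϖ ^ n * ϖ ^ n) • c₀, fun k => ϖ ^ n • c k, Subtype.ext ?_⟩
    change ϖ ^ n • Y i * ϖ ^ n • Y j = ϖ ^ n • Y j * ϖ ^ n • Y i +
      ((ϖ ^ n * ϖ ^ n) • (c₀ : A) + (𝓕.deform ϖ n).val (∑ k, _))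
    rw [map_sum]
    change _ = _ + (_ + ∑ k, (ϖ ^ n • (c k : A)) * (ϖ ^ n • Y k))
    simp only [smul_mul_smul_comm]
    rw [← Finset.smul_sum, ← smul_add, ← smul_add]
    exact congrArg _ (sub_eq_iff_eq_add'.1 hc)
  generates P hφ hy := by
    refine eq_top_iff.2 fun x _ => ?_
    have hle : (𝓕.deform ϖ n).toSubring ≤ P.map ((𝓕.deform ϖ n).val : 𝓕.deform ϖ n →+* A) :=
      h.deform_le_subring (fun c hc => ⟨_, hφ ⟨c, hc⟩, rfl⟩) fun j => ⟨_, hy j, rfl⟩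
    obtain ⟨z, hz, hzx⟩ := hle x.2
    rwa [← Subtype.ext hzx]

end Generates

end Deform

end AlgFiltration

/-! ### The algebras `Â_{n,K}` and their transition homomorphisms -/

namespace AlgFiltration

section Hat

variable {R A : Type*} [CommRing R] [Ring A] [Algebra R A] {𝓕 : AlgFiltration R A} {ϖ : R}

theorem isSMulRegular_deform (hA : IsSMulRegular A ϖ) (n : ℕ) :
    IsSMulRegular (𝓕.deform ϖ n) ϖ :=
  fun _ _ h => Subtype.ext (hA (congrArg Subtype.val h))

namespace IsAlmostCommutative

theorem isNoetherianRing_deform (h : 𝓕.IsAlmostCommutative) (ϖ : R) (n : ℕ) :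
    IsNoetherianRing (𝓕.deform ϖ n) ∧ IsNoetherianRing (𝓕.deform ϖ n)ᵐᵒᵖ := by
  obtain ⟨r, Y, hY⟩ := h.exists_generators
  have hpoly := hY.isAlmostPolynomial_deform h.gr_comm ϖ n
  have := h.zero_noetherian
  have := h.isNoetherianRing_op_zeroPart
  exact ⟨hpoly.isNoetherianRing, hpoly.op.isNoetherianRing⟩

theorem isNoetherianRing_piCompletion (h : 𝓕.IsAlmostCommutative) (hA : IsSMulRegular A ϖ)
    (n : ℕ) : IsNoetherianRing (PiCompletion ϖ (𝓕.deform ϖ n)) ∧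
      IsNoetherianRing (PiCompletion ϖ (𝓕.deform ϖ n))ᵐᵒᵖ := by
  obtain ⟨_, _⟩ := h.isNoetherianRing_deform ϖ n
  have hcompletion := isCompletionAlong_toPiCompletion (isSMulRegular_deform (𝓕 := 𝓕) hA n)
  exact ⟨hcompletion.isNoetherianRing, hcompletion.op.isNoetherianRing⟩

end IsAlmostCommutative

theorem commutator_mem_deform (hcomm : ∀ x y : 𝓕.gr, x * y = y * x) {n : ℕ} {y b : A}
    (hy : y ∈ 𝓕.F 1) (hb : b ∈ 𝓕.deform ϖ n) : y * b - b * y ∈ 𝓕.deform ϖ n := by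
  let commutator : A →+ A := AddMonoidHom.mulLeft y - AddMonoidHom.mulRight y
  refine deform_le (P := (𝓕.deform ϖ n).toSubring.toAddSubgroup.comap commutator)
    (fun i a ha => ?_) hb
  change y * ϖ ^ (n * i) • a - ϖ ^ (n * i) • a * y ∈ 𝓕.deform ϖ n
  rw [mul_smul_comm, smul_mul_assoc, ← smul_sub]
  refine 𝓕.pow_smul_mem_deform ϖ n ?_
  have hmem := commutator_mem_lower hcomm hy ha
  rwa [Nat.add_comm] at hmem

section HatSub

variable (𝓕) (K : Type*) [NormedField K] [Algebra R K] (ϖ : R) (n : ℕ)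

/-- The subring of `Â_{n+1,K}` of the elements that map to `Â_n`. The transition homomorphism
factors through it as a completion followed by the inversion of `ϖ`. -/
abbrev hatSub : Subring (𝓕.hatK K ϖ (n + 1)) :=
  (latticeIncl R K (PiCompletion ϖ (𝓕.deform ϖ n))).range.comap (𝓕.hatTransition K ϖ n).toRingHom

/-- The inclusion of `Â_{n+1}` into the subring of `Â_{n+1,K}` of the elements that map to
`Â_n`. -/
def toHatSub : PiCompletion ϖ (𝓕.deform ϖ (n + 1)) →+* 𝓕.hatSub K ϖ n :=
  (latticeIncl R K _).codRestrict (𝓕.hatSub K ϖ n) fun u =>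
    ⟨piCompletionMap ϖ (Subalgebra.inclusion (𝓕.deform_succ_le ϖ n)) u, rfl⟩

end HatSub

variable [IsDomain R] {K : Type*} [NormedField K] [Algebra R K] [IsFractionRing R K]

theorem IsAlmostCommutative.isNoetherianRing_hatK [IsDiscreteValuationRing R] [IsUnitBall R K]
    (h : 𝓕.IsAlmostCommutative) (hϖ : Irreducible ϖ) (hA : IsSMulRegular A ϖ) (n : ℕ) :
    IsNoetherianRing (𝓕.hatK K ϖ n) ∧ IsNoetherianRing (𝓕.hatK K ϖ n)ᵐᵒᵖ := by
  obtain ⟨_, _⟩ := h.isNoetherianRing_piCompletion hA n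
  have hlocalization := isCentralLocalization_latticeIncl (K := K) hϖ
    (isSMulRegular_piCompletion (isSMulRegular_deform (𝓕 := 𝓕) hA n))
  exact ⟨hlocalization.isNoetherianRing, hlocalization.op.isNoetherianRing⟩

section ToHat

variable (𝓕 K) in
/-- The canonical homomorphism `A → Â_{n,K}`. -/
def toHat (hϖ : Irreducible ϖ) (n : ℕ) : A →+* 𝓕.hatK K ϖ n :=
  (𝓕.toHatK K hϖ n).toRingHom.comp
    (Algebra.TensorProduct.includeRight : A →ₐ[R] K ⊗[R] A).toRingHom

variable (hϖ : Irreducible ϖ) (n : ℕ)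

theorem toHat_smul (c : R) (a : A) :
    𝓕.toHat K hϖ n (c • a) = algebraMap R K c • 𝓕.toHat K hϖ n a :=
  (congrArg (𝓕.toHatK K hϖ n) (latticeIncl_smul R K c a)).trans (map_smul _ _ _)

theorem toHat_of_mem (a : 𝓕.deform ϖ n) :
    𝓕.toHat K hϖ n a = latticeIncl R K _ (toPiCompletion ϖ (𝓕.deform ϖ n) a) :=
  𝓕.toHatK_deformToAK K hϖ n (latticeIncl R K _ a)

theorem hatTransition_toHat (a : A) :
    𝓕.hatTransition K ϖ n (𝓕.toHat K hϖ (n + 1) a) = 𝓕.toHat K hϖ n a :=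
  𝓕.hatTransition_toHatK K hϖ n _

variable [IsUnitBall R K] {n}

theorem exists_eq_toHatK_add (hA : IsSMulRegular A ϖ) (k : ℕ) (x : 𝓕.hatK K ϖ n) :
    ∃ v u, x = 𝓕.toHatK K hϖ n v + algebraMap R K ϖ ^ k • latticeIncl R K _ u := by
  obtain ⟨z, u, rfl⟩ :=
    exists_eq_latticeMap_toPiCompletion_add hϖ (isSMulRegular_deform hA n) k x
  exact ⟨𝓕.deformToAK K ϖ n z, u, by rw [toHatK_deformToAK]⟩

variable [IsDiscreteValuationRing R]

theorem exists_of_toHatK_eq_latticeIncl (hA : IsSMulRegular A ϖ) {v : K ⊗[R] A}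
    {u : PiCompletion ϖ (𝓕.deform ϖ n)} (h : 𝓕.toHatK K hϖ n v = latticeIncl R K _ u) :
    ∃ a : 𝓕.deform ϖ n, v = (1 : K) ⊗ₜ[R] (a : A) := by
  obtain ⟨z, rfl⟩ := (𝓕.deformToAK_bijective K hϖ n).2 v
  rw [toHatK_deformToAK] at h
  obtain ⟨a, rfl⟩ :=
    exists_eq_latticeIncl_of_latticeMap_toPiCompletion hϖ (isSMulRegular_deform hA n) h
  exact ⟨a, rfl⟩

end ToHat

theorem toHat_mem_hatSub (hϖ : Irreducible ϖ) (n : ℕ) (a : 𝓕.deform ϖ n) :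
    𝓕.toHat K hϖ (n + 1) a ∈ 𝓕.hatSub K ϖ n :=
  ⟨toPiCompletion ϖ _ a, (toHat_of_mem hϖ n a).symm.trans (hatTransition_toHat hϖ n (a : A)).symm⟩

variable (𝓕 K) in
/-- The canonical homomorphism `A_n → Â_{n+1,K}`, with values in the subring of the elements that
map to `Â_n`. -/
def deformToHatSub (hϖ : Irreducible ϖ) (n : ℕ) : 𝓕.deform ϖ n →+* 𝓕.hatSub K ϖ n :=
  ((𝓕.toHat K hϖ (n + 1)).comp ((𝓕.deform ϖ n).val : 𝓕.deform ϖ n →+* A)).codRestrict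
    (𝓕.hatSub K ϖ n) (toHat_mem_hatSub hϖ n)

theorem deformToHatSub_inclusion (hϖ : Irreducible ϖ) (n : ℕ) (a : 𝓕.deform ϖ (n + 1)) :
    𝓕.deformToHatSub K hϖ n (Subalgebra.inclusion (𝓕.deform_succ_le ϖ n) a) =
      𝓕.toHatSub K ϖ n (toPiCompletion ϖ _ a) :=
  Subtype.ext (toHat_of_mem hϖ (n + 1) a)

theorem deformToHatSub_deformBase (hϖ : Irreducible ϖ) (n : ℕ) (c : 𝓕.zeroPart) :
    𝓕.deformToHatSub K hϖ n (𝓕.deformBase ϖ n c) =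
      𝓕.toHatSub K ϖ n (toPiCompletion ϖ _ (𝓕.deformBase ϖ (n + 1) c)) :=
  deformToHatSub_inclusion hϖ n (𝓕.deformBase ϖ (n + 1) c)

theorem exists_eq_deformToHatSub_add [IsDiscreteValuationRing R] [IsUnitBall R K]
    (hϖ : Irreducible ϖ) (hA : IsSMulRegular A ϖ) {n : ℕ} (x : 𝓕.hatSub K ϖ n) :
    ∃ a u, x = 𝓕.deformToHatSub K hϖ n a + 𝓕.toHatSub K ϖ n u := by
  obtain ⟨v, u, hx⟩ := exists_eq_toHatK_add hϖ hA 0 (x : 𝓕.hatK K ϖ (n + 1))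
  rw [pow_zero, one_smul] at hx
  obtain ⟨w, hw : latticeIncl R K _ w = 𝓕.hatTransition K ϖ n x⟩ := x.2
  have hv : 𝓕.toHatK K hϖ n v = latticeIncl R K _
      (w - piCompletionMap ϖ (Subalgebra.inclusion (𝓕.deform_succ_le ϖ n)) u) := by
    rw [map_sub, hw, hx, map_add, hatTransition_toHatK]
    exact (add_sub_cancel_right _ _).symm
  obtain ⟨a, rfl⟩ := exists_of_toHatK_eq_latticeIncl hϖ hA hv
  exact ⟨a, u, Subtype.ext hx⟩

theorem exists_toHat_mul_latticeIncl_eq (hϖ : Irreducible ϖ) (hA : IsSMulRegular A ϖ)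
    (hcomm : ∀ x y : 𝓕.gr, x * y = y * x) {n : ℕ} {y : A} (hy : y ∈ 𝓕.F 1)
    (s : PiCompletion ϖ (𝓕.deform ϖ (n + 1))) :
    ∃ s', 𝓕.toHat K hϖ (n + 1) (ϖ ^ n • y) * latticeIncl R K _ s =
      latticeIncl R K _ s * 𝓕.toHat K hϖ (n + 1) (ϖ ^ n • y) + latticeIncl R K _ s' := by
  -- Modulo `A_{n+1}`, the element `ϖ ^ n • y` commutes with `A_{n+1}` and is killed by `ϖ`.
  obtain ⟨b, u, rfl⟩ := exists_eq_toPiCompletion_add (isSMulRegular_deform hA (n + 1)) 1 s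
  let y' : 𝓕.deform ϖ (n + 1) :=
    ⟨ϖ ^ (n + 1) • y, by simpa using 𝓕.pow_smul_mem_deform ϖ (n + 1) hy⟩
  let d : 𝓕.deform ϖ (n + 1) := ⟨ϖ ^ n • (y * b - b * y),
    (𝓕.deform ϖ (n + 1)).smul_mem (commutator_mem_deform hcomm hy b.2) (ϖ ^ n)⟩
  have hy' : latticeIncl R K _ (toPiCompletion ϖ _ y') =
      algebraMap R K ϖ • 𝓕.toHat K hϖ (n + 1) (ϖ ^ n • y) := by
    rw [← toHat_of_mem hϖ (n + 1) y', ← toHat_smul, smul_smul, ← pow_succ']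
  have hd : latticeIncl R K _ (toPiCompletion ϖ _ d) =
      𝓕.toHat K hϖ (n + 1) (ϖ ^ n • y) * latticeIncl R K _ (toPiCompletion ϖ _ b) -
        latticeIncl R K _ (toPiCompletion ϖ _ b) * 𝓕.toHat K hϖ (n + 1) (ϖ ^ n • y) := by
    rw [← toHat_of_mem hϖ (n + 1) d, ← toHat_of_mem hϖ (n + 1) b, ← map_mul, ← map_mul, ← map_sub,
      smul_mul_assoc, mul_smul_comm, ← smul_sub]
  refine ⟨toPiCompletion ϖ _ d + (toPiCompletion ϖ _ y' * u - u * toPiCompletion ϖ _ y'), ?_⟩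
  rw [pow_one, map_add, map_add, map_sub, map_mul, map_mul, latticeIncl_smul, hy', hd]
  simp only [mul_add, add_mul, smul_mul_assoc, mul_smul_comm]
  abel

variable [IsDiscreteValuationRing R] [IsUnitBall R K]

theorem Generates.isAlmostPolynomial_hatSub {r : ℕ} {Y : Fin r → A} (hY : 𝓕.Generates Y)
    (hϖ : Irreducible ϖ) (hA : IsSMulRegular A ϖ) (hcomm : ∀ x y : 𝓕.gr, x * y = y * x) (n : ℕ) :
    IsAlmostPolynomial (𝓕.toHatSub K ϖ n)
      fun j => 𝓕.deformToHatSub K hϖ n (hY.deformGen ϖ n j) where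
  comm_base j s := by
    obtain ⟨s', hs'⟩ := exists_toHat_mul_latticeIncl_eq (K := K) hϖ hA hcomm (hY.mem j) s
    exact ⟨s', Subtype.ext hs'⟩
  comm_gen i j := by
    obtain ⟨c₀, c, hc⟩ := (hY.isAlmostPolynomial_deform hcomm ϖ n).comm_gen i j
    refine ⟨toPiCompletion ϖ _ (𝓕.deformBase ϖ (n + 1) c₀),
      fun k => toPiCompletion ϖ _ (𝓕.deformBase ϖ (n + 1) (c k)), ?_⟩
    simp only [← deformToHatSub_deformBase hϖ]
    simpa only [map_add, map_mul, map_sum] using congrArg (𝓕.deformToHatSub K hϖ n) hc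
  generates P hφ hy := by
    have htop := (hY.isAlmostPolynomial_deform hcomm ϖ n).generates
      (P.comap (𝓕.deformToHatSub K hϖ n)) (fun c => by
        rw [Subring.mem_comap, deformToHatSub_deformBase]
        exact hφ _) hy
    refine eq_top_iff.2 fun x _ => ?_
    obtain ⟨a, u, rfl⟩ := exists_eq_deformToHatSub_add hϖ hA x
    exact add_mem (htop.ge (Subring.mem_top a)) (hφ u)

namespace IsAlmostCommutative

theorem isNoetherianRing_hatSub (h : 𝓕.IsAlmostCommutative) (hϖ : Irreducible ϖ)
    (hA : IsSMulRegular A ϖ) (n : ℕ) :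
    IsNoetherianRing (𝓕.hatSub K ϖ n) ∧ IsNoetherianRing (𝓕.hatSub K ϖ n)ᵐᵒᵖ := by
  obtain ⟨r, Y, hY⟩ := h.exists_generators
  have hpoly := hY.isAlmostPolynomial_hatSub (K := K) hϖ hA h.gr_comm n
  obtain ⟨_, _⟩ := h.isNoetherianRing_piCompletion hA (n + 1)
  exact ⟨hpoly.isNoetherianRing, hpoly.op.isNoetherianRing⟩

theorem isEquationallyFlat_hatTransition (h : 𝓕.IsAlmostCommutative) (hϖ : Irreducible ϖ)
    (hA : IsSMulRegular A ϖ) (n : ℕ) :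
    IsEquationallyFlat (𝓕.hatTransition K ϖ n).toRingHom ∧
      IsEquationallyFlat (RingHom.op (𝓕.hatTransition K ϖ n).toRingHom) := by
  have hdeform := isSMulRegular_deform (𝓕 := 𝓕) hA n
  obtain ⟨_, _⟩ := h.isNoetherianRing_hatSub (K := K) hϖ hA n
  refine IsCentralLocalization.isEquationallyFlat_of_comap_range
    (isCentralLocalization_latticeIncl hϖ (isSMulRegular_piCompletion hdeform))
    (p := algebraMap K _ (algebraMap R K ϖ))
    ((isUnit_iff_ne_zero.2 (algebraMap_irreducible_ne_zero hϖ)).map _)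
    (Algebra.commutes _) ?_ (isCentralComplete_piCompletion hdeform) fun u => ?_
  · rw [latticeIncl_algebraMap]
    exact ((𝓕.hatTransition K ϖ n).commutes _).symm
  · obtain ⟨b, u', rfl⟩ := exists_eq_toPiCompletion_add hdeform 1 u
    refine ⟨𝓕.toHat K hϖ (n + 1) b, u', ?_⟩
    rw [pow_one, Algebra.smul_def, map_add, ← toHat_of_mem hϖ n b]
    exact congrArg (· + _) (hatTransition_toHat hϖ n (b : A)).symm

end IsAlmostCommutative

end Hat

end AlgFiltration

/-! ### Completions and dense uniform embeddings -/

section Completion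

open UniformSpace

theorem exists_completion_ringEquiv_of_isUniformInducing {α β : Type*} [Ring α] [UniformSpace α]
    [IsTopologicalRing α] [IsUniformAddGroup α] [Ring β] [UniformSpace β] [IsTopologicalRing β]
    [IsUniformAddGroup β] [CompleteSpace β] [T2Space β] {f : α →+* β} (hf : IsUniformInducing f)
    (hd : DenseRange f) :
    ∃ e : Completion α ≃+* β, Continuous e ∧ Continuous e.symm ∧ ∀ a : α, e a = f a := by
  let pkg : AbstractCompletion α :=
    { space := β
      coe := f
      uniformStruct := inferInstance
      complete := inferInstance
      separation := inferInstance
      isUniformInducing := hf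
      dense := hd }
  let ext : Completion α →+* β := Completion.extensionHom f hf.uniformContinuous.continuous
  let eUnif : Completion α ≃ᵤ β := (Completion.cPkg (α := α)).compareEquiv pkg
  let e : Completion α ≃+* β := RingEquiv.ofBijective ext eUnif.bijective
  have hsymm : ∀ y, e.symm y = eUnif.symm y := fun y =>
    (RingEquiv.symm_apply_eq e).2 (eUnif.apply_symm_apply y).symm
  exact ⟨e, eUnif.continuous, eUnif.symm.continuous.congr fun y => (hsymm y).symm,
    Completion.extensionHom_coe f hf.uniformContinuous.continuous⟩

end Completion

/-! ### The topology of the projective limit -/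

section Comap

variable {K V W : Type*} [NormedField K] [Ring V] [Algebra K V] [Ring W] [Algebra K W]

/-- The pullback of a submultiplicative nonarchimedean seminorm. -/
def AlgSeminorm.comap (q : AlgSeminorm K V) (f : W →ₐ[K] V) : AlgSeminorm K W where
  toSeminorm := q.toSeminorm.comp f.toLinearMap
  add_le_max' x y := by
    change q.toSeminorm (f (x + y)) ≤ max (q.toSeminorm (f x)) (q.toSeminorm (f y))
    rw [map_add]
    exact q.add_le_max' _ _
  mul_le' x y := by
    change q.toSeminorm (f (x * y)) ≤ q.toSeminorm (f x) * q.toSeminorm (f y)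
    rw [map_mul]
    exact q.mul_le' _ _

theorem AlgSeminorm.uniformity_comap (q : AlgSeminorm K V) (f : W →ₐ[K] V) :
    seminormUniformity (q.comap f).toSeminorm =
      UniformSpace.comap f (seminormUniformity q.toSeminorm) :=
  seminormUniformity_comap _ _ f.toLinearMap.toAddMonoidHom fun _ => rfl

theorem SeminormedAlg.uniformSpace_singleton (q : AlgSeminorm K V) :
    SeminormedAlg.instUniformSpace ({q} : Set (AlgSeminorm K V)) =
      seminormUniformity q.toSeminorm :=
  iInf_unique (ι := ({q} : Set (AlgSeminorm K V))) (f := fun r => seminormUniformity r.1.toSeminorm)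

theorem SeminormedAlg.uniformSpace_comap (q : AlgSeminorm K V) (f : W →ₐ[K] V) :
    UniformSpace.comap f (seminormUniformity q.toSeminorm) =
      SeminormedAlg.instUniformSpace ({q.comap f} : Set (AlgSeminorm K W)) :=
  (q.uniformity_comap f).symm.trans (SeminormedAlg.uniformSpace_singleton _).symm

end Comap

namespace AlgFiltration

section Limit

variable {R A : Type*} [CommRing R] [Ring A] [Algebra R A] (𝓕 : AlgFiltration R A)
  (K : Type*) [NormedField K] [Algebra R K] (ϖ : R)

/-- The projection from the projective limit to `Â_{n,K}`. -/
def hatProj (n : ℕ) : 𝓕.hatLimit K ϖ →ₐ[K] 𝓕.hatK K ϖ n :=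
  (Pi.evalAlgHom K _ n).comp (𝓕.hatLimit K ϖ).val

theorem hatTransition_hatProj (n : ℕ) (x : 𝓕.hatLimit K ϖ) :
    𝓕.hatTransition K ϖ n (𝓕.hatProj K ϖ (n + 1) x) = 𝓕.hatProj K ϖ n x := x.2 n

theorem hatProj_toHatLimit [IsDomain R] [IsFractionRing R K] {ϖ : R} (hϖ : Irreducible ϖ) (n : ℕ)
    (v : K ⊗[R] A) :
    𝓕.hatProj K ϖ n (𝓕.toHatLimit K hϖ v) = 𝓕.toHatK K hϖ n v := rfl

variable [IsUnitBall R K]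

/-- The seminorm on the projective limit defined by the norm of `Â_{n,K}`. -/
def limitSeminorm (n : ℕ) : AlgSeminorm K (𝓕.hatLimit K ϖ) :=
  (latticeAlgSeminorm R K _).comap (𝓕.hatProj K ϖ n)

theorem limitSeminorm_le_succ (n : ℕ) :
    (𝓕.limitSeminorm K ϖ n).toSeminorm ≤ (𝓕.limitSeminorm K ϖ (n + 1)).toSeminorm := by
  intro x
  change latticeSeminorm R K _ (𝓕.hatProj K ϖ n x) ≤ latticeSeminorm R K _ (𝓕.hatProj K ϖ (n + 1) x)
  rw [← hatTransition_hatProj]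
  exact latticeSeminorm_latticeMap_le _ _

theorem limitSeminorm_mono : Monotone fun n => (𝓕.limitSeminorm K ϖ n).toSeminorm :=
  monotone_nat_of_le_succ (𝓕.limitSeminorm_le_succ K ϖ)

theorem uniformSpace_hatLimit : (instUniformSpaceSubtype : UniformSpace (𝓕.hatLimit K ϖ)) =
    ⨅ n, seminormUniformity (𝓕.limitSeminorm K ϖ n).toSeminorm := by
  change UniformSpace.comap Subtype.val (Pi.uniformSpace _) = _
  rw [Pi.uniformSpace_eq, UniformSpace.comap_iInf]
  refine iInf_congr fun n => ?_
  rw [limitSeminorm, AlgSeminorm.uniformity_comap, ← UniformSpace.comap_comap]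
  rfl

instance : IsUniformAddGroup (𝓕.hatLimit K ϖ) :=
  (𝓕.hatLimit K ϖ).toSubmodule.toAddSubgroup.isUniformAddGroup

instance : IsTopologicalRing (𝓕.hatLimit K ϖ) :=
  (𝓕.hatLimit K ϖ).toSubring.instIsTopologicalRing

theorem topology_hatLimit :
    (instUniformSpaceSubtype : UniformSpace (𝓕.hatLimit K ϖ)).toTopologicalSpace =
      ⨅ n, (seminormUniformity (𝓕.limitSeminorm K ϖ n).toSeminorm).toTopologicalSpace :=
  (congrArg (@UniformSpace.toTopologicalSpace _) (𝓕.uniformSpace_hatLimit K ϖ)).trans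
    UniformSpace.toTopologicalSpace_iInf

theorem hasBasis_nhds_hatLimit (x : 𝓕.hatLimit K ϖ) :
    (𝓝 x).HasBasis (fun i : ℕ × ℝ => 0 < i.2)
      fun i => {y | (𝓕.limitSeminorm K ϖ i.1).toSeminorm (y - x) < i.2} := by
  have hx : 𝓝 x = ⨅ n, @nhds _
      (seminormUniformity (𝓕.limitSeminorm K ϖ n).toSeminorm).toTopologicalSpace x :=
    (congrArg (fun t => @nhds _ t x) (𝓕.topology_hatLimit K ϖ)).trans nhds_iInf
  rw [hx]
  refine Filter.hasBasis_iInf_of_directed _ _ (fun n => hasBasis_nhds_seminorm _ x)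
    (directed_of_isDirected_le fun m n hmn => ?_)
  refine nhds_mono (UniformSpace.toTopologicalSpace_mono (seminormUniformity_le one_pos ?_))
  intro y
  rw [one_mul]
  exact 𝓕.limitSeminorm_mono K ϖ hmn y

variable [IsFractionRing R K] {ϖ}

theorem completeSpace_hatK (hϖ : Irreducible ϖ) (hA : IsSMulRegular A ϖ) (n : ℕ) :
    CompleteSpace (𝓕.hatK K ϖ n) :=
  completeSpace_latticeAlg hϖ (isCentralComplete_piCompletion (isSMulRegular_deform hA n))

variable [IsDomain R]

theorem denseRange_toHatK (hϖ : Irreducible ϖ) (hA : IsSMulRegular A ϖ) (n : ℕ) :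
    DenseRange (𝓕.toHatK K hϖ n) := by
  intro x
  refine (mem_closure_iff_nhds_basis (hasBasis_nhds_seminorm _ x)).2 fun ε hε => ?_
  obtain ⟨k, hk⟩ := exists_pow_lt_of_lt_one hε (norm_irreducible_lt_one (K := K) hϖ)
  obtain ⟨v, u, rfl⟩ := exists_eq_toHatK_add hϖ hA k x
  refine ⟨_, ⟨v, rfl⟩, ?_⟩
  rw [Set.mem_ofPred_eq, sub_add_cancel_left, map_neg_eq_map]
  refine (latticeSeminorm_smul_le _ _).trans_lt ?_
  rwa [norm_pow]

theorem denseRange_toHatLimit (hϖ : Irreducible ϖ) (hA : IsSMulRegular A ϖ) :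
    DenseRange (𝓕.toHatLimit K hϖ) := by
  intro x
  refine (mem_closure_iff_nhds_basis (𝓕.hasBasis_nhds_hatLimit K ϖ x)).2 fun ⟨n, ε⟩ hε => ?_
  obtain ⟨_, ⟨v, rfl⟩, hv⟩ := (mem_closure_iff_nhds_basis (hasBasis_nhds_seminorm _ _)).1
    (𝓕.denseRange_toHatK K hϖ hA n (𝓕.hatProj K ϖ n x)) ε hε
  refine ⟨_, ⟨v, rfl⟩, ?_⟩
  change latticeSeminorm R K _ (𝓕.hatProj K ϖ n (𝓕.toHatLimit K hϖ v - x)) < ε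
  rw [map_sub, hatProj_toHatLimit]
  exact hv

theorem denseRange_hatProj (hϖ : Irreducible ϖ) (hA : IsSMulRegular A ϖ) (n : ℕ) :
    DenseRange (𝓕.hatProj K ϖ n) :=
  (𝓕.denseRange_toHatK K hϖ hA n).mono (by
    rintro _ ⟨v, rfl⟩
    exact ⟨𝓕.toHatLimit K hϖ v, rfl⟩)

variable [IsDiscreteValuationRing R]

theorem t2Space_hatK (hϖ : Irreducible ϖ) (hA : IsSMulRegular A ϖ) (n : ℕ) :
    T2Space (𝓕.hatK K ϖ n) :=
  t2Space_latticeAlg hϖ (isCentralComplete_piCompletion (isSMulRegular_deform hA n))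
    (isSMulRegular_piCompletion (isSMulRegular_deform hA n))

theorem t2Space_hatLimit (hϖ : Irreducible ϖ) (hA : IsSMulRegular A ϖ) :
    T2Space (𝓕.hatLimit K ϖ) := by
  have := 𝓕.t2Space_hatK K hϖ hA
  infer_instance

theorem completeSpace_hatLimit (hϖ : Irreducible ϖ) (hA : IsSMulRegular A ϖ) :
    CompleteSpace (𝓕.hatLimit K ϖ) := by
  have := 𝓕.t2Space_hatK K hϖ hA
  have := 𝓕.completeSpace_hatK K hϖ hA
  have hset : (𝓕.hatLimit K ϖ : Set (∀ n, 𝓕.hatK K ϖ n)) =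
      ⋂ n, {x | 𝓕.hatTransition K ϖ n (x (n + 1)) = x n} := by
    ext x
    rw [Set.mem_iInter]
    rfl
  have hcl : IsClosed (𝓕.hatLimit K ϖ : Set (∀ n, 𝓕.hatK K ϖ n)) := by
    rw [hset]
    exact isClosed_iInter fun n => isClosed_eq
      ((continuous_latticeMap _).comp (continuous_apply (n + 1))) (continuous_apply n)
  exact hcl.isComplete.completeSpace_coe

theorem exists_seminormCompletion_equiv (hϖ : Irreducible ϖ) (hA : IsSMulRegular A ϖ) (n : ℕ) :
    ∃ e : SeminormCompletion (𝓕.limitSeminorm K ϖ n) ≃+* 𝓕.hatK K ϖ n,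
      Continuous e ∧ ∀ x : 𝓕.hatLimit K ϖ,
        e (UniformSpace.Completion.coeRingHom
          (show SeminormedAlg {𝓕.limitSeminorm K ϖ n} from x)) = 𝓕.hatProj K ϖ n x := by
  have := 𝓕.t2Space_hatK K hϖ hA n
  have := 𝓕.completeSpace_hatK K hϖ hA n
  let f : SeminormedAlg {𝓕.limitSeminorm K ϖ n} →+* 𝓕.hatK K ϖ n := (𝓕.hatProj K ϖ n).toRingHom
  have hf : IsUniformInducing f := isUniformInducing_iff_uniformSpace.2
    (SeminormedAlg.uniformSpace_comap (latticeAlgSeminorm R K _) (𝓕.hatProj K ϖ n))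
  obtain ⟨e, he, -, hef⟩ :=
    exists_completion_ringEquiv_of_isUniformInducing hf (𝓕.denseRange_hatProj K hϖ hA n)
  exact ⟨e, he, hef⟩

section SeminormCompletion

variable {𝓕 K}

theorem isNoetherianRing_seminormCompletion (h : 𝓕.IsAlmostCommutative) (hϖ : Irreducible ϖ)
    (hA : IsSMulRegular A ϖ) (n : ℕ) :
    IsNoetherianRing (SeminormCompletion (𝓕.limitSeminorm K ϖ n)) ∧
      IsNoetherianRing (SeminormCompletion (𝓕.limitSeminorm K ϖ n))ᵐᵒᵖ := by
  obtain ⟨e, -, -⟩ := 𝓕.exists_seminormCompletion_equiv K hϖ hA n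
  obtain ⟨_, _⟩ := h.isNoetherianRing_hatK (K := K) hϖ hA n
  exact ⟨isNoetherianRing_of_ringEquiv _ e.symm,
    isNoetherianRing_of_ringEquiv _ (RingEquiv.op e.symm)⟩

theorem exists_completionTransition_eq (hϖ : Irreducible ϖ) (hA : IsSMulRegular A ϖ) (n : ℕ) :
    ∃ (e : SeminormCompletion (𝓕.limitSeminorm K ϖ n) ≃+* 𝓕.hatK K ϖ n)
      (e' : SeminormCompletion (𝓕.limitSeminorm K ϖ (n + 1)) ≃+* 𝓕.hatK K ϖ (n + 1)),
      ∀ x, e (completionTransition (𝓕.limitSeminorm_le_succ K ϖ n) x) =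
        𝓕.hatTransition K ϖ n (e' x) := by
  have := 𝓕.t2Space_hatK K hϖ hA n
  obtain ⟨e, he_cont, he⟩ := 𝓕.exists_seminormCompletion_equiv K hϖ hA n
  obtain ⟨e', he'_cont, he'⟩ := 𝓕.exists_seminormCompletion_equiv K hϖ hA (n + 1)
  refine ⟨e, e', fun x => ?_⟩
  induction x using UniformSpace.Completion.induction_on with
  | hp =>
    exact isClosed_eq (he_cont.comp UniformSpace.Completion.continuous_map)
      ((continuous_latticeMap _).comp he'_cont)
  | ih a =>
    refine Eq.trans ?_ ((hatTransition_hatProj 𝓕 K ϖ n a).symm.trans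
      (congrArg (𝓕.hatTransition K ϖ n) (he' a).symm))
    exact (congrArg e (UniformSpace.Completion.mapRingHom_coe _ a)).trans (he a)

theorem isFlatHom_completionTransition (h : 𝓕.IsAlmostCommutative) (hϖ : Irreducible ϖ)
    (hA : IsSMulRegular A ϖ) (n : ℕ) :
    IsFlatHom (completionTransition (𝓕.limitSeminorm_le_succ K ϖ n)) := by
  obtain ⟨e, e', he⟩ := exists_completionTransition_eq (𝓕 := 𝓕) (K := K) hϖ hA n
  have hsymm : ∀ x, e.symm ((𝓕.hatTransition K ϖ n).toRingHom x) =
      completionTransition (𝓕.limitSeminorm_le_succ K ϖ n) (e'.symm x) := fun x => by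
    rw [RingEquiv.symm_apply_eq, he, RingEquiv.apply_symm_apply]
    rfl
  obtain ⟨hflat, hflat_op⟩ := h.isEquationallyFlat_hatTransition (K := K) hϖ hA n
  have hflat_op' : IsEquationallyFlat
      (RingHom.op (completionTransition (𝓕.limitSeminorm_le_succ K ϖ n))) :=
    hflat_op.of_ringEquiv (RingEquiv.op e'.symm) (RingEquiv.op e.symm) fun x =>
      congrArg MulOpposite.op (hsymm x.unop)
  exact ⟨(hflat.of_ringEquiv e'.symm e.symm hsymm).rightFlat, hflat_op'.rightFlat⟩

theorem isFrechetStein_hatLimit (h : 𝓕.IsAlmostCommutative) (hϖ : Irreducible ϖ)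
    (hA : IsSMulRegular A ϖ) : IsFrechetStein K (𝓕.hatLimit K ϖ) where
  isUniformAddGroup := inferInstance
  completeSpace := 𝓕.completeSpace_hatLimit K hϖ hA
  t2Space := 𝓕.t2Space_hatLimit K hϖ hA
  exists_seminorms := ⟨𝓕.limitSeminorm K ϖ, 𝓕.limitSeminorm_le_succ K ϖ, 𝓕.topology_hatLimit K ϖ,
    isNoetherianRing_seminormCompletion h hϖ hA, isFlatHom_completionTransition h hϖ hA⟩

end SeminormCompletion

end Limit

end AlgFiltration

/-! ### The continuous seminorms on `A_K` -/

section Ball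

variable {K V : Type*} [NormedField K] [Ring V] [Algebra K V]

/-- The closed balls of a nonarchimedean seminorm, as additive subgroups. -/
def AlgSeminorm.ball (q : AlgSeminorm K V) {C : ℝ} (hC : 0 ≤ C) : AddSubgroup V where
  carrier := {x | q.toSeminorm x ≤ C}
  zero_mem' := (map_zero q.toSeminorm).trans_le hC
  add_mem' {x y} hx hy := (q.add_le_max' x y).trans (max_le hx hy)
  neg_mem' {x} hx := (map_neg_eq_map q.toSeminorm x).trans_le hx

theorem AlgSeminorm.mul_list_prod_le {ι : Type*} (q : AlgSeminorm K V) {Z : ι → V} {M : ℝ}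
    (hM : 0 ≤ M) (hZ : ∀ j, q.toSeminorm (Z j) ≤ M) (x : V) (l : List ι) :
    q.toSeminorm (x * (l.map Z).prod) ≤ q.toSeminorm x * M ^ l.length := by
  induction l generalizing x with
  | nil => simp
  | cons j l ih =>
    rw [List.map_cons, List.prod_cons, ← mul_assoc, List.length_cons, pow_succ', ← mul_assoc]
    refine (ih _).trans (mul_le_mul_of_nonneg_right ?_ (pow_nonneg hM _))
    exact (q.mul_le' _ _).trans (mul_le_mul_of_nonneg_left (hZ j) (apply_nonneg q.toSeminorm x))

end Ball

theorem one_tmul_smul_mul_prod {R A K ι : Type*} [CommRing R] [Ring A] [Algebra R A] [NormedField K]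
    [Algebra R K] (c : R) (a : A) (Y : ι → A) (l : List ι) :
    (1 : K) ⊗ₜ[R] (c • (a * (l.map Y).prod)) = algebraMap R K c •
      ((1 : K) ⊗ₜ[R] a * (l.map fun j => (1 : K) ⊗ₜ[R] Y j).prod) := by
  let incl : A →ₐ[R] K ⊗[R] A := Algebra.TensorProduct.includeRight
  refine (latticeIncl_smul R K c _).trans (congrArg _ ((map_mul incl _ _).trans (congrArg _ ?_)))
  rw [map_list_prod, List.map_map]
  rfl

namespace AlgFiltration

section Gauge

variable {R A : Type*} [CommRing R] [Ring A] [Algebra R A] (𝓕 : AlgFiltration R A)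
  (K : Type*) [NormedField K] [Algebra R K]

theorem continuous_zeroPartToAK [IsUnitBall R K] :
    Continuous[inferInstance, 𝓕.topologyAK K] (𝓕.zeroPartToAK K) :=
  continuous_sInf_rng.2 fun _ h => h.2

variable {𝓕 K} in
theorem Generates.le_of_mem_deform {r : ℕ} {Y : Fin r → A} (hY : 𝓕.Generates Y)
    {q : AlgSeminorm K (K ⊗[R] A)} {ϖ : R} {C M : ℝ}
    (hC : ∀ c : 𝓕.zeroPart, q.toSeminorm ((1 : K) ⊗ₜ[R] (c : A)) ≤ C) (hM : 1 ≤ M)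
    (hYM : ∀ j, q.toSeminorm ((1 : K) ⊗ₜ[R] Y j) ≤ M) {n : ℕ}
    (hn : ‖algebraMap R K ϖ‖ ^ n * M ≤ 1) {a : A} (ha : a ∈ 𝓕.deform ϖ n) :
    q.toSeminorm ((1 : K) ⊗ₜ[R] a) ≤ C := by
  have hC₀ : 0 ≤ C := (apply_nonneg _ _).trans (hC 0)
  let ι : A →+ K ⊗[R] A :=
    ((Algebra.TensorProduct.includeRight : A →ₐ[R] K ⊗[R] A) : A →+ K ⊗[R] A)
  let P : AddSubgroup A := (q.ball hC₀).comap ι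
  refine deform_le (P := P) (fun i b hb => ?_) ha
  have hword : wordSpan (𝓕.zeroPart.val : 𝓕.zeroPart →+* A) Y i ≤
      P.comap (DistribSMul.toAddMonoidHom A (ϖ ^ (n * i))) := wordSpan_le.2 fun c l hl => by
    change q.toSeminorm ((1 : K) ⊗ₜ[R] (ϖ ^ (n * i) • ((c : A) * (l.map Y).prod))) ≤ C
    rw [one_tmul_smul_mul_prod, map_smul_eq_mul, map_pow, norm_pow, pow_mul]
    calc _ ≤ (‖algebraMap R K ϖ‖ ^ n) ^ i * (C * M ^ i) := by
          refine mul_le_mul_of_nonneg_left ?_ (by positivity)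
          exact (q.mul_list_prod_le (zero_le_one.trans hM) hYM _ l).trans
            (mul_le_mul (hC c) (pow_le_pow_right₀ hM hl) (by positivity) hC₀)
      _ = C * (‖algebraMap R K ϖ‖ ^ n * M) ^ i := by rw [mul_pow]; ring
      _ ≤ C := mul_le_of_le_one_right hC₀ (pow_le_one₀ (by positivity) hn)
  exact hword (hY.le_wordSpan i hb)

variable [IsFractionRing R K] {ϖ : R}

variable {𝓕 K} in
theorem exists_bound_zeroPart [IsUnitBall R K] (hϖ : Irreducible ϖ)
    {q : AlgSeminorm K (K ⊗[R] A)} (hq : q ∈ 𝓕.contSeminorms K) :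
    ∃ C : ℝ, 0 < C ∧ ∀ c : 𝓕.zeroPart, q.toSeminorm ((1 : K) ⊗ₜ[R] (c : A)) ≤ C := by
  have hcont : Continuous fun z => q.toSeminorm (𝓕.zeroPartToAK K z) :=
    @Continuous.comp _ _ _ _ (𝓕.topologyAK K) _ _ _ hq (𝓕.continuous_zeroPartToAK K)
  have hnhds : ∀ᶠ z in 𝓝 (0 : LatticeAlg R K 𝓕.zeroPart),
      q.toSeminorm (𝓕.zeroPartToAK K z) < 1 := by
    refine hcont.continuousAt.eventually_lt continuousAt_const ?_
    rw [map_zero, map_zero]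
    exact one_pos
  obtain ⟨ε, hε, hball⟩ := (hasBasis_nhds_seminorm _ _).eventually_iff.1 hnhds
  obtain ⟨k, hk⟩ := exists_pow_lt_of_lt_one hε (norm_irreducible_lt_one (K := K) hϖ)
  have hpos : 0 < ‖algebraMap R K ϖ‖ ^ k :=
    pow_pos (norm_pos_iff.2 (algebraMap_irreducible_ne_zero hϖ)) k
  refine ⟨(‖algebraMap R K ϖ‖ ^ k)⁻¹, inv_pos.2 hpos, fun c => ?_⟩
  have hc : q.toSeminorm (𝓕.zeroPartToAK K (algebraMap R K ϖ ^ k • latticeIncl R K _ c)) < 1 := by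
    refine hball ?_
    rw [Set.mem_ofPred_eq, sub_zero]
    refine (latticeSeminorm_smul_le _ _).trans_lt ?_
    rwa [norm_pow]
  rw [map_smul, map_smul_eq_mul, norm_pow] at hc
  exact ((lt_inv_mul_iff₀ hpos).2 hc).le.trans_eq (mul_one _)

variable {𝓕 K} in
theorem Generates.exists_bound_deform [IsUnitBall R K] {r : ℕ} {Y : Fin r → A}
    (hY : 𝓕.Generates Y) (hϖ : Irreducible ϖ) {q : AlgSeminorm K (K ⊗[R] A)}
    (hq : q ∈ 𝓕.contSeminorms K) :
    ∃ (n : ℕ) (C : ℝ), 0 < C ∧ ∀ a ∈ 𝓕.deform ϖ n, q.toSeminorm ((1 : K) ⊗ₜ[R] a) ≤ C := by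
  obtain ⟨C, hC, hbound⟩ := exists_bound_zeroPart hϖ hq
  obtain ⟨M₀, hM₀⟩ := (Set.finite_range fun j => q.toSeminorm ((1 : K) ⊗ₜ[R] Y j)).bddAbove
  have hM_pos : 0 < max 1 M₀ := one_pos.trans_le (le_max_left _ _)
  obtain ⟨n, hn⟩ :=
    exists_pow_lt_of_lt_one (inv_pos.2 hM_pos) (norm_irreducible_lt_one (K := K) hϖ)
  refine ⟨n, C, hC, fun a ha => hY.le_of_mem_deform hbound (le_max_left 1 M₀)
    (fun j => (hM₀ ⟨j, rfl⟩).trans (le_max_right _ _)) ?_ ha⟩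
  exact (mul_le_mul_of_nonneg_right hn.le hM_pos.le).trans_eq (inv_mul_cancel₀ hM_pos.ne')

variable [IsDomain R]

theorem toHatK_zeroPartToAK (hϖ : Irreducible ϖ) (n : ℕ) (z : LatticeAlg R K 𝓕.zeroPart) :
    𝓕.toHatK K hϖ n (𝓕.zeroPartToAK K z) = latticeMap R K
      ((toPiCompletion ϖ (𝓕.deform ϖ n)).comp
        (Subalgebra.inclusion (𝓕.zeroPart_le_deform ϖ n))) z :=
  latticeAlg_hom_ext (φ := (𝓕.toHatK K hϖ n).comp (𝓕.zeroPartToAK K))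
    (ψ := latticeMap R K ((toPiCompletion ϖ (𝓕.deform ϖ n)).comp
      (Subalgebra.inclusion (𝓕.zeroPart_le_deform ϖ n))))
    (fun b => toHat_of_mem hϖ n (Subalgebra.inclusion (𝓕.zeroPart_le_deform ϖ n) b)) z

variable [IsUnitBall R K]

/-- The seminorm on `A_K` with unit ball `A_n`, defined as the pullback of the norm of
`Â_{n,K}`. -/
def gauge (hϖ : Irreducible ϖ) (n : ℕ) : AlgSeminorm K (K ⊗[R] A) :=
  (latticeAlgSeminorm R K _).comap (𝓕.toHatK K hϖ n)

theorem uniformity_gauge (hϖ : Irreducible ϖ) (n : ℕ) :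
    seminormUniformity (𝓕.gauge K hϖ n).toSeminorm =
      UniformSpace.comap (𝓕.toHatK K hϖ n) inferInstance :=
  (latticeAlgSeminorm R K _).uniformity_comap (𝓕.toHatK K hϖ n)

theorem gauge_mem_contSeminorms (hϖ : Irreducible ϖ) (n : ℕ) :
    𝓕.gauge K hϖ n ∈ 𝓕.contSeminorms K := by
  refine continuous_le_dom (sInf_le ?_) (continuous_seminormUniformity (𝓕.gauge K hϖ n).toSeminorm)
  refine ⟨⟨{(𝓕.gauge K hϖ n).toSeminorm}, ?_, ?_⟩, ?_⟩
  · rintro _ rfl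
    exact (𝓕.gauge K hϖ n).add_le_max'
  · exact (iInf_singleton (f := fun q : Seminorm K (K ⊗[R] A) =>
      (seminormUniformity q).toTopologicalSpace)).symm
  · rw [uniformity_gauge]
    refine continuous_induced_rng.2 ?_
    exact (continuous_latticeMap _).congr fun z => (𝓕.toHatK_zeroPartToAK K hϖ n z).symm

variable {𝓕 K}

theorem comap_toHatLimit (hϖ : Irreducible ϖ) :
    UniformSpace.comap (𝓕.toHatLimit K hϖ) instUniformSpaceSubtype =
      ⨅ n, seminormUniformity (𝓕.gauge K hϖ n).toSeminorm := by
  rw [uniformSpace_hatLimit, UniformSpace.comap_iInf]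
  refine iInf_congr fun n => ?_
  exact (AlgSeminorm.uniformity_comap (𝓕.limitSeminorm K ϖ n) (𝓕.toHatLimit K hϖ)).symm

variable [IsDiscreteValuationRing R]

theorem exists_eq_smul_of_gauge_lt (hϖ : Irreducible ϖ) (hA : IsSMulRegular A ϖ) {n : ℕ}
    {v : K ⊗[R] A} {s : ℝ} (hv : (𝓕.gauge K hϖ n).toSeminorm v < s) :
    ∃ (d : K) (a : 𝓕.deform ϖ n), v = d • ((1 : K) ⊗ₜ[R] (a : A)) ∧ ‖d‖ < s := by
  obtain ⟨d, u, hd, hu, hds⟩ :=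
    exists_ne_zero_of_latticeSeminorm_lt hϖ (v := 𝓕.toHatK K hϖ n v) hv
  obtain ⟨a, ha⟩ := exists_of_toHatK_eq_latticeIncl hϖ hA (v := d⁻¹ • v) (u := u) (by
    rw [map_smul, hu, smul_smul, inv_mul_cancel₀ hd, one_smul])
  exact ⟨d, a, by rw [← ha, smul_smul, mul_inv_cancel₀ hd, one_smul], hds⟩

theorem Generates.exists_le_gauge {r : ℕ} {Y : Fin r → A} (hY : 𝓕.Generates Y)
    (hϖ : Irreducible ϖ) (hA : IsSMulRegular A ϖ) {q : AlgSeminorm K (K ⊗[R] A)}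
    (hq : q ∈ 𝓕.contSeminorms K) :
    ∃ (n : ℕ) (C : ℝ), 0 < C ∧ ∀ v, q.toSeminorm v ≤ C * (𝓕.gauge K hϖ n).toSeminorm v := by
  obtain ⟨n, C, hC, hbound⟩ := hY.exists_bound_deform hϖ hq
  refine ⟨n, C, hC, fun v => ?_⟩
  rw [← div_le_iff₀' hC]
  refine le_of_forall_gt_imp_ge_of_dense fun s hs => ?_
  obtain ⟨d, a, rfl, hds⟩ := exists_eq_smul_of_gauge_lt hϖ hA hs
  rw [div_le_iff₀ hC, map_smul_eq_mul]
  exact mul_le_mul hds.le (hbound a a.2) (apply_nonneg _ _) ((norm_nonneg d).trans hds.le)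

theorem Generates.uniformSpace_contSeminorms {r : ℕ} {Y : Fin r → A} (hY : 𝓕.Generates Y)
    (hϖ : Irreducible ϖ) (hA : IsSMulRegular A ϖ) :
    SeminormedAlg.instUniformSpace (𝓕.contSeminorms K) =
      ⨅ n, seminormUniformity (𝓕.gauge K hϖ n).toSeminorm := by
  refine le_antisymm (le_iInf fun n => ?_) (le_iInf fun q => ?_)
  · exact iInf_le (fun q : 𝓕.contSeminorms K => seminormUniformity q.1.toSeminorm)
      ⟨_, 𝓕.gauge_mem_contSeminorms K hϖ n⟩
  · obtain ⟨n, C, hC, hle⟩ := hY.exists_le_gauge hϖ hA q.2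
    exact (iInf_le _ n).trans (seminormUniformity_le hC hle)

theorem Generates.exists_hatLimit_algEquiv {r : ℕ} {Y : Fin r → A} (hY : 𝓕.Generates Y)
    (hϖ : Irreducible ϖ) (hA : IsSMulRegular A ϖ) :
    ∃ e : 𝓕.hatLimit K ϖ ≃ₐ[K] 𝓕.ArensMichael K, Continuous e ∧ Continuous e.symm ∧
      ∀ a : K ⊗[R] A, e (𝓕.toHatLimit K hϖ a) = 𝓕.toArensMichael K a := by
  have := 𝓕.t2Space_hatLimit K hϖ hA
  have := 𝓕.completeSpace_hatLimit K hϖ hA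
  let f : SeminormedAlg (𝓕.contSeminorms K) →+* 𝓕.hatLimit K ϖ := (𝓕.toHatLimit K hϖ).toRingHom
  have hf : IsUniformInducing f := isUniformInducing_iff_uniformSpace.2
    ((comap_toHatLimit hϖ).trans (hY.uniformSpace_contSeminorms hϖ hA).symm)
  obtain ⟨e, he, he_symm, hef⟩ :=
    exists_completion_ringEquiv_of_isUniformInducing hf (𝓕.denseRange_toHatLimit K hϖ hA)
  have hcoe : ∀ a : K ⊗[R] A, e.symm (𝓕.toHatLimit K hϖ a) = 𝓕.toArensMichael K a := fun a =>
    (RingEquiv.symm_apply_eq e).2 (hef a).symm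
  refine ⟨AlgEquiv.ofRingEquiv (f := e.symm) fun c => ?_, he_symm, he, hcoe⟩
  refine Eq.trans ?_ ((hcoe (algebraMap K (K ⊗[R] A) c)).trans ?_)
  · rw [AlgHom.commutes]
  · exact (UniformSpace.Completion.algebraMap_def
      (SeminormedAlg (𝓕.contSeminorms K)) K c).symm

end Gauge

end AlgFiltration

end

end AMEnvelope

theorem mainTheorem8_general {R K A : Type*} [CommRing R] [IsDomain R]
    [IsDiscreteValuationRing R] [NormedField K] [Algebra R K] [IsFractionRing R K] [IsUnitBall R K]
    [Ring A] [Algebra R A] [Module.Flat R A]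
    (ϖ : R) (hϖ : Irreducible ϖ) (𝓕 : AlgFiltration R A) (h𝓕 : 𝓕.IsAlmostCommutative) :
    (∀ n : ℕ, IsFlatHom (𝓕.hatTransition K ϖ n).toRingHom) ∧
    IsFrechetStein K (𝓕.hatLimit K ϖ) ∧
    ∃ e : 𝓕.hatLimit K ϖ ≃ₐ[K] 𝓕.ArensMichael K,
      Continuous e ∧ Continuous e.symm ∧
      ∀ a : TensorProduct R K A, e (𝓕.toHatLimit K hϖ a) = 𝓕.toArensMichael K a := by
  have hA : IsSMulRegular A ϖ :=
    Module.Flat.isSMulRegular_of_nonZeroDivisors (mem_nonZeroDivisors_of_ne_zero hϖ.ne_zero)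
  obtain ⟨r, Y, hY⟩ := h𝓕.exists_generators
  refine ⟨fun n => ?_, AlgFiltration.isFrechetStein_hatLimit h𝓕 hϖ hA,
    hY.exists_hatLimit_algEquiv hϖ hA⟩
  obtain ⟨hflat, hflat_op⟩ := h𝓕.isEquationallyFlat_hatTransition (K := K) hϖ hA n
  exact ⟨hflat.rightFlat, hflat_op.rightFlat⟩

theorem mainTheorem8 {R K A : Type*} [CommRing R] [IsDomain R] [IsDiscreteValuationRing R]
    [IsAdicComplete (IsLocalRing.maximalIdeal R) R]
    [NormedField K] [Algebra R K] [IsFractionRing R K] [IsUnitBall R K]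
    [Ring A] [Algebra R A] [Module.Flat R A]
    (ϖ : R) (hϖ : Irreducible ϖ) (𝓕 : AlgFiltration R A) (h𝓕 : 𝓕.IsAdmissible ϖ) :
    (∀ n : ℕ, IsFlatHom (𝓕.hatTransition K ϖ n).toRingHom) ∧
    IsFrechetStein K (𝓕.hatLimit K ϖ) ∧
    ∃ e : 𝓕.hatLimit K ϖ ≃ₐ[K] 𝓕.ArensMichael K,
      Continuous e ∧ Continuous e.symm ∧
      ∀ a : TensorProduct R K A, e (𝓕.toHatLimit K hϖ a) = 𝓕.toArensMichael K a :=
  mainTheorem8_general ϖ hϖ 𝓕 h𝓕.isAlmostCommutative
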